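/- Conventions. The homotopy groups $\pi_n(X,x)$ of a (not necessarily Kan) simplicial set $X$, and the set $\pi_0(X)$, are those of its geometric realization $|X|$; a map of simplicial sets is a weak equivalence if it induces a bijection on $\pi_0$ and on $\pi_n$ for all $n\ge 1$ and all base points. A trivial cofibration is a monomorphism that is a weak equivalence. Given $p:X\to Y$, a map $f:A\to X$ is fiberwise homotopic to $f':A\to X$ relative to $Y$ if there is a map $H:A\times\Delta^1\to X$ from $f$ to $f'$ such that $p\circ H$ is the trivial homotopy from $p\circ f$ to itself. A map $i:A\to B$ has the weak lifting property with respect to $p:X\to Y$ if for all $f:A\to X$ and $g:B\to Y$ with $p\circ f=g\circ i$ there is $h:B\to X$ such that $p\circ h=g$ and $f$ is fiberwise homotopic to $h\circ i$ relative to $Y$. The map $p$ is a weak Kan fibration if every trivial cofibration $A\to\Delta^n$, $n\ge 0$, has the weak lifting property with respect to $p$; it is a trivial weak Kan fibration if, in addition, every inclusion $\partial\Delta^n\to\Delta^n$, $n\ge 0$, has the weak lifting property with respect to $p$. Lemma. Let $p:X\to Y$ be a trivial weak Kan fibration of simplicial sets. Assume that $Y$ is a Kan simplicial set, and that there exists a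 Kan simplicial set $X'$ together with a weak equivalence $X'\to X$. Then $p$ is a weak equivalence. -/

import Mathlib

open CategoryTheory MonoidalCategory CartesianMonoidalCategory Simplicial

universe u

/-- The map `π₀(S) → π₀(T)` on path components induced by a continuous map. -/
def pathComponentsMap {S T : Type*} [TopologicalSpace S] [TopologicalSpace T] (f : C(S, T)) :
    ZerothHomotopy S → ZerothHomotopy T :=
  Quotient.map f fun _ _ h => h.map f.continuous

/-- Composing a generalized loop based at `x` with a continuous map `f` gives a generalized loop
based at `f x`. -/
def genLoopMap {S T : Type*} [TopologicalSpace S] [TopologicalSpace T] (n : ℕ) (f : C(S, T))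
    (x : S) (γ : GenLoop (Fin n) S x) : GenLoop (Fin n) T (f x) :=
  ⟨f.comp γ.1, fun y hy => congrArg f (γ.2 y hy)⟩

/-- The map `πₙ(S, x) → πₙ(T, f x)` induced by a continuous map `f`. -/
def homotopyGroupMap {S T : Type*} [TopologicalSpace S] [TopologicalSpace T] (n : ℕ) (f : C(S, T))
    (x : S) : HomotopyGroup.Pi n S x → HomotopyGroup.Pi n T (f x) :=
  Quotient.map (genLoopMap n f x) fun _ _ h => h.comp_continuousMap f

/-- A weak homotopy equivalence of topological spaces: a bijection on path components, and a
bijection on all higher homotopy groups at all base points. The condition on path components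
is not relative to a base point, so that an empty source forces an empty target. -/
def IsWeakHomotopyEquivalence {S T : Type*} [TopologicalSpace S] [TopologicalSpace T]
    (f : C(S, T)) : Prop :=
  Function.Bijective (pathComponentsMap f) ∧
    ∀ n : ℕ, 1 ≤ n → ∀ x : S, Function.Bijective (homotopyGroupMap n f x)

namespace SSet

/-- A weak equivalence of simplicial sets: a morphism which induces bijections on the homotopy
groups (and on `π₀`), the homotopy groups of a simplicial set being those of its geometric
realization. -/
def IsWeakEquivalence {X Y : SSet.{u}} (p : X ⟶ Y) : Prop :=
  IsWeakHomotopyEquivalence (SSet.toTop.map p).hom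

/-- A trivial cofibration of simplicial sets: a monomorphism which is a weak equivalence. -/
def IsTrivialCofibration {A B : SSet.{u}} (i : A ⟶ B) : Prop :=
  Mono i ∧ IsWeakEquivalence i

/-- For `p : X ⟶ Y`, the morphism `f : A ⟶ X` is fiberwise homotopic to `f' : A ⟶ X` relative
to `Y`: there is a homotopy `A ⊗ Δ[1] ⟶ X` from `f` to `f'` whose composition with `p` is the
trivial homotopy from `f ≫ p` to itself. -/
def FiberwiseHomotopic {A X Y : SSet.{u}} (p : X ⟶ Y) (f f' : A ⟶ X) : Prop :=
  ∃ H : A ⊗ Δ[1] ⟶ X, SSet.ι₀ ≫ H = f ∧ SSet.ι₁ ≫ H = f' ∧ H ≫ p = fst A Δ[1] ≫ f ≫ p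

/-- The weak (left) lifting property of `i : A ⟶ B` with respect to `p : X ⟶ Y`: in every
commutative square there is `h : B ⟶ X` for which the lower triangle commutes strictly, and the
upper triangle commutes up to fiberwise homotopy relative to `Y`. -/
def HasWeakLiftingProperty {A B X Y : SSet.{u}} (i : A ⟶ B) (p : X ⟶ Y) : Prop :=
  ∀ (f : A ⟶ X) (g : B ⟶ Y), f ≫ p = i ≫ g →
    ∃ h : B ⟶ X, h ≫ p = g ∧ FiberwiseHomotopic p f (i ≫ h)

/-- A weak Kan fibration: a morphism with respect to which every trivial cofibration
`A ⟶ Δ[n]` has the weak lifting property. -/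
def IsWeakKanFibration {X Y : SSet.{u}} (p : X ⟶ Y) : Prop :=
  ∀ (n : ℕ) (A : SSet.{u}) (i : A ⟶ Δ[n]), IsTrivialCofibration i → HasWeakLiftingProperty i p

/-- A trivial weak Kan fibration: a weak Kan fibration with respect to which moreover all the
boundary inclusions `∂Δ[n] ⟶ Δ[n]`, `n ≥ 0`, have the weak lifting property. -/
def IsTrivialWeakKanFibration {X Y : SSet.{u}} (p : X ⟶ Y) : Prop :=
  IsWeakKanFibration p ∧ ∀ n : ℕ, HasWeakLiftingProperty (SSet.boundary.{u} n).ι p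

end SSet

/-! ### Gluing of maps, and lifting of homotopies relative to a subobject -/

namespace SSet
open HomotopicalAlgebra Opposite
open scoped SSet.modelCategoryQuillen

/-! A continuous map is a weak homotopy equivalence as soon as every square from the boundary
inclusion of a cube into it has a diagonal that is strict on the boundary and correct in the target
up to homotopy relative to the boundary (`isWeakHomotopyEquivalence_of_hasRelativeLift`). For $|p|$,
with cubes traded for simplices, such a square is a pair $a:\partial\Delta^n\to \mathrm{Sing}|X|$,
$b:\Delta^n\to \mathrm{Sing}|Y|$. The weak lifting property concerns maps into $X$ and $Y$, so both
maps have to be brought back along the units $X\to \mathrm{Sing}|X|$ and $Y\to \mathrm{Sing}|Y|$.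

On the side of $Y$ this is possible because $Y$ is Kan: its unit is then a homotopy equivalence of
Kan complexes, and `IsKanEquivalence.exists_extension` deforms $b$ into $Y$ with prescribed
behaviour on the boundary. On the side of $X$ the Kan complex $X'$ is used. The boundary of a
simplex is a contractible horn with one cell attached, and $X'\to X$ is surjective on homotopy
groups, so $a$ lifts up to homotopy to $\mathrm{Sing}|X'|$ (`exists_boundary_lift_up_to_htpy`). As
$X'$ is Kan, this lift deforms into $X'$. Hence $a$ is homotopic to the image of some
$f:\partial\Delta^n\to X$, to which the weak lifting property applies. Homotopy extension in
$\mathrm{Sing}|X|$ and composition of homotopies in $\mathrm{Sing}|Y|$ turn the outcome into the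
required diagonal (`exists_relative_lift`).

The main input is that the unit $X\to \mathrm{Sing}|X|$ is an equivalence for every $X$
(`isKanEquivalence_toSingTop`). Equivalence means Kan equivalence here: a bijection on homotopy
classes of maps into each Kan complex. The monomorphisms among these are exactly those with the left
lifting property against fibrations between Kan complexes (`IsKanAnodyne`), so they can be glued and
passed to unions.

To prove the main input, $X$ is replaced by the nerve of the poset of its simplices with labelled
vertices. The last vertex map to $X$ is a Kan equivalence by cellular induction
(`labNerve.isKanEquivalence_last`), and $\mathrm{Sing}|\cdot|$ preserves Kan equivalences
(`IsKanEquivalence.map_sing`). This leaves nerves of posets $P$ with a strictly monotone function to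
$\mathbb N$. The realization of such a nerve is covered by contractible open stars of finite chains.
Singular simplices lying in one star suffice (`isKanEquivalence_smallSing`). The complex
`frontPairs`, of singular simplices together with chains of stars that control their front faces,
projects by Kan equivalences both to these small simplices and to the nerve of the poset of finite
chains. The nerve of chains in turn maps to the nerve of $P$ by taking maxima, again a Kan
equivalence. -/

lemma exists_desc {κ : Type*} {A : κ → SSet.{u}} {X Z : SSet.{u}} (f : ∀ k, A k ⟶ X)
    (g : ∀ k, A k ⟶ Z) (hf : ∀ n (x : X.obj n), ∃ k a, (f k).app n a = x)
    (hg : ∀ n k l (a : (A k).obj n) (b : (A l).obj n), (f k).app n a = (f l).app n b →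
      (g k).app n a = (g l).app n b) :
    ∃ d : X ⟶ Z, ∀ k, f k ≫ d = g k := by
  choose k a h using hf
  refine ⟨{ app := fun n ↦ ↾fun x ↦ (g (k n x)).app n (a n x), naturality := ?_ }, ?_⟩
  · intro m n α
    ext x
    change (g (k n (X.map α x))).app n _ = Z.map α ((g (k m x)).app m (a m x))
    rw [← NatTrans.naturality_apply]
    apply hg
    refine (h n _).trans ?_
    rw [NatTrans.naturality_apply, h]
  · intro l
    ext n x
    exact hg _ _ _ _ _ (h n _)

lemma hom_eq_of_jointly_surjective {κ : Type*} {A : κ → SSet.{u}} {X Z : SSet.{u}}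
    (f : ∀ k, A k ⟶ X) (hf : ∀ n (x : X.obj n), ∃ k a, (f k).app n a = x) {d d' : X ⟶ Z}
    (h : ∀ k, f k ≫ d = f k ≫ d') : d = d' := by
  ext n x
  obtain ⟨k, a, rfl⟩ := hf n x
  exact ConcreteCategory.congr_hom (NatTrans.congr_app (h k) n) a

lemma app_injective_of_mono {A X : SSet.{u}} (i : A ⟶ X) [Mono i] (n) :
    Function.Injective (i.app n) := by
  rw [← mono_iff_injective]
  infer_instance

lemma mono_of_app_injective {A X : SSet.{u}} (i : A ⟶ X)
    (h : ∀ n, Function.Injective (i.app n)) : Mono i := by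
  rw [NatTrans.mono_iff_mono_app]
  intro n
  rw [mono_iff_injective]
  exact h n

/-- The two constant sections of the cylinder. -/
noncomputable def inc {X : SSet.{u}} (e : Fin 2) : X ⟶ X ⊗ Δ[1] :=
  lift (𝟙 X) (const (stdSimplex.obj₀Equiv.{u}.symm e))

lemma ι₀_eq_inc (X : SSet.{u}) : (ι₀ : X ⟶ _) = inc 0 := rfl
lemma ι₁_eq_inc (X : SSet.{u}) : (ι₁ : X ⟶ _) = inc 1 := rfl

@[simp]
lemma inc_comp_assoc {X Y Z : SSet.{u}} (e : Fin 2) (f : X ⟶ Y) (g : Y ⊗ Δ[1] ⟶ Z) :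
    inc e ≫ f ▷ _ ≫ g = f ≫ inc e ≫ g := rfl

@[simp]
lemma inc_fst (X : SSet.{u}) (e : Fin 2) : inc e ≫ fst X _ = 𝟙 X := rfl

@[simp]
lemma inc_fst_assoc (X : SSet.{u}) (e : Fin 2) {Z : SSet.{u}} (g : X ⟶ Z) :
    inc e ≫ fst X _ ≫ g = g := rfl

/-- The pushout product of a monomorphism with an anodyne extension is anodyne. The two partial maps
`a` and `x` glue to a map on its source. -/
lemma exists_lift_tensor {A X J K E B : SSet.{u}} (i : A ⟶ X) [Mono i] (j : J ⟶ K)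
    (hj : anodyneExtensions j) (p : E ⟶ B) [Fibration p] (a : A ⊗ K ⟶ E) (x : X ⊗ J ⟶ E)
    (b : X ⊗ K ⟶ B) (hax : A ◁ j ≫ a = i ▷ J ≫ x) (hab : a ≫ p = i ▷ K ≫ b)
    (hxb : x ≫ p = X ◁ j ≫ b) :
    ∃ H : X ⊗ K ⟶ E, i ▷ K ≫ H = a ∧ X ◁ j ≫ H = x ∧ H ≫ p = b := by
  let sq := Functor.PushoutObjObj.ofHasPushout (curriedTensor SSet.{u}) i j
  have : HasLiftingProperty sq.ι p :=
    anodyneExtensions_pushoutObjObjι sq hj p ((HomotopicalAlgebra.fibration_iff p).1 inferInstance)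
  have h : sq.isPushout.desc x a hax.symm ≫ p = sq.ι ≫ b := by
    apply sq.isPushout.hom_ext
    · rw [sq.isPushout.inl_desc_assoc, sq.inl_ι_assoc]; exact hxb
    · rw [sq.isPushout.inr_desc_assoc, sq.inr_ι_assoc]; exact hab
  have cs : CommSq (sq.isPushout.desc x a hax.symm) sq.ι p b := ⟨h⟩
  refine ⟨cs.lift, ?_, ?_, cs.fac_right⟩
  · have := sq.inr_ι =≫ cs.lift
    rw [Category.assoc, cs.fac_left, sq.isPushout.inr_desc] at this
    exact this.symm
  · have := sq.inl_ι =≫ cs.lift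
    rw [Category.assoc, cs.fac_left, sq.isPushout.inl_desc] at this
    exact this.symm

/-- A vertex of `Δ[1]` is the only face in a one-dimensional horn, so lifting against it is horn
filling. The vertex `e` is the face opposite to the other vertex, hence the exchange of indices. -/
lemma anodyneExtensions_vertex (e : Fin 2) :
    anodyneExtensions (const (stdSimplex.obj₀Equiv.{u}.symm e) : Δ[0] ⟶ Δ[1]) := by
  intro E B p hp
  have : Fibration p := (HomotopicalAlgebra.fibration_iff p).2 hp
  have key : ∀ (k i : Fin 2), k ≠ i → HasLiftingProperty (stdSimplex.δ k : Δ[0] ⟶ Δ[1]) p := by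
    intro k i hki
    refine ⟨fun {u v} sq ↦ ?_⟩
    have hc : horn.IsCompatible (i := i) (fun (j : Fin 2) (_ : j ≠ i) ↦ (u : Δ[0] ⟶ E)) := by
      simp
    obtain ⟨φ, h1, h2⟩ := hc.exists_lift p v (by
      intro j hj
      obtain rfl : j = k := by omega
      exact sq.w)
    exact ⟨⟨⟨φ, h1 k hki, h2⟩⟩⟩
  fin_cases e
  · exact stdSimplex.δ_one_eq_const.{u} ▸ key 1 0 (by decide)
  · exact stdSimplex.δ_zero_eq_const.{u} ▸ key 0 1 (by decide)

/-- Homotopy lifting relative to a subobject, from either end of the cylinder: `exists_lift_tensor`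
for a vertex of `Δ[1]`, with the factor `Δ[0]` removed. Most constructions below reduce to it. -/
lemma exists_lift_cylinder {A X E B : SSet.{u}} (i : A ⟶ X) [Mono i] (p : E ⟶ B) [Fibration p]
    (e : Fin 2) (a : A ⊗ Δ[1] ⟶ E) (x : X ⟶ E) (b : X ⊗ Δ[1] ⟶ B)
    (hax : inc e ≫ a = i ≫ x) (hab : a ≫ p = i ▷ _ ≫ b) (hxb : x ≫ p = inc e ≫ b) :
    ∃ H : X ⊗ Δ[1] ⟶ E, i ▷ _ ≫ H = a ∧ inc e ≫ H = x ∧ H ≫ p = b := by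
  obtain ⟨H, h1, h2, h3⟩ := exists_lift_tensor i _ (anodyneExtensions_vertex e) p a
    (fst _ _ ≫ x) b (by
      have : A ◁ (const (stdSimplex.obj₀Equiv.{u}.symm e) : Δ[0] ⟶ Δ[1]) =
        fst _ _ ≫ inc e := rfl
      rw [this, Category.assoc, hax]; rfl) hab (by
      rw [Category.assoc, hxb]; rfl)
  refine ⟨H, h1, ?_, h3⟩
  have : (inc e : X ⟶ _) = lift (𝟙 X) (const (stdSimplex.obj₀Equiv.{u}.symm 0)) ≫
    X ◁ (const (stdSimplex.obj₀Equiv.{u}.symm e) : Δ[0] ⟶ Δ[1]) := rfl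
  rw [this, Category.assoc, h2]; rfl

lemma exists_extend_cylinder {A X Z : SSet.{u}} (i : A ⟶ X) [Mono i] [KanComplex Z]
    (e : Fin 2) (a : A ⊗ Δ[1] ⟶ Z) (x : X ⟶ Z) (hax : inc e ≫ a = i ≫ x) :
    ∃ H : X ⊗ Δ[1] ⟶ Z, i ▷ _ ≫ H = a ∧ inc e ≫ H = x := by
  obtain ⟨H, h1, h2, -⟩ := exists_lift_cylinder i (Limits.terminal.from Z) e a x
    (Limits.terminal.from _) hax (by simp) (by simp)
  exact ⟨H, h1, h2⟩

end SSet

/-! ### Frames of cylinders, squares of homotopies, and homotopy classes of maps -/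

namespace SSet
open HomotopicalAlgebra Opposite
open scoped SSet.modelCategoryQuillen

lemma inc_app_ne {X : SSet.{u}} {n} (x y : X.obj n) :
    (inc (0 : Fin 2)).app n x ≠ (inc (1 : Fin 2) : X ⟶ _).app n y := by
  intro h
  have := congrArg (fun z : (X ⊗ Δ[1]).obj n ↦ (stdSimplex.objEquiv z.2).toOrderHom 0) h
  exact absurd this (by change ¬ ((0 : Fin 2) = 1); decide)

/-- `X × ∂Δ[1] ∪ A × Δ[1]` as a subcomplex of the cylinder on `X`. -/
noncomputable def cylinderFrame {A X : SSet.{u}} (i : A ⟶ X) : (X ⊗ Δ[1]).Subcomplex :=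
  Subcomplex.range (inc (0 : Fin 2)) ⊔ Subcomplex.range (inc (1 : Fin 2)) ⊔
    Subcomplex.range (i ▷ Δ[1])

lemma range_inc_le {A X : SSet.{u}} (i : A ⟶ X) (e : Fin 2) :
    Subcomplex.range (inc e) ≤ cylinderFrame i := by
  fin_cases e
  · exact le_sup_of_le_left le_sup_left
  · exact le_sup_of_le_left le_sup_right

/-- The ends of the cylinder, in the frame. -/
noncomputable def frameInc {A X : SSet.{u}} (i : A ⟶ X) (e : Fin 2) :
    X ⟶ (cylinderFrame i : SSet.{u}) :=
  Subcomplex.lift (inc e) (range_inc_le i e)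

/-- The sides of the cylinder, in the frame. -/
noncomputable def frameSide {A X : SSet.{u}} (i : A ⟶ X) :
    A ⊗ Δ[1] ⟶ (cylinderFrame i : SSet.{u}) :=
  Subcomplex.lift (i ▷ _) le_sup_right

/-- The source of a piece of the frame. -/
abbrev framePiece (A X : SSet.{u}) (k : Option (Fin 2)) : SSet.{u} :=
  k.elim (A ⊗ Δ[1]) fun _ ↦ X

/-- The pieces of the frame. -/
noncomputable abbrev framePieceMap {A X : SSet.{u}} (i : A ⟶ X) :
    ∀ k, framePiece A X k ⟶ (cylinderFrame i : SSet.{u}) :=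
  Option.rec (frameSide i) (frameInc i)

lemma framePieceMap_surjective {A X : SSet.{u}} (i : A ⟶ X) (n)
    (x : (cylinderFrame i : SSet.{u}).obj n) : ∃ k a, (framePieceMap i k).app n a = x := by
  obtain ⟨x, (⟨y, hy⟩ | ⟨y, hy⟩) | ⟨y, hy⟩⟩ := x
  · exact ⟨some 0, y, Subtype.ext hy⟩
  · exact ⟨some 1, y, Subtype.ext hy⟩
  · exact ⟨none, y, Subtype.ext hy⟩

/-- The two ends are disjoint and `i` is injective, so the only real overlap is that of a side with
an end. The spare factor `T` is an interval for squares of homotopies, a point for plain maps, and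
an arbitrary object in the exponential argument of `IsKanAnodyne.exists_extension_homotopy`. -/
lemma frame_compat {A X T Z : SSet.{u}} (i : A ⟶ X) [Mono i]
    (x : Fin 2 → (X ⊗ T ⟶ Z)) (a : (A ⊗ Δ[1]) ⊗ T ⟶ Z)
    (h : ∀ e, inc e ▷ T ≫ a = i ▷ T ≫ x e) :
    ∃ d : (cylinderFrame i : SSet.{u}) ⊗ T ⟶ Z, (∀ e, frameInc i e ▷ T ≫ d = x e) ∧
      frameSide i ▷ T ≫ d = a := by
  obtain ⟨d, hd⟩ := exists_desc (fun k ↦ framePieceMap i k ▷ T)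
    (Option.rec a x : ∀ k, framePiece A X k ⊗ T ⟶ Z)
    (fun n y ↦ by
      obtain ⟨k, z, hz⟩ := framePieceMap_surjective i n y.1
      exact ⟨k, (z, y.2), Prod.ext hz rfl⟩) (by
    have side : ∀ n e (b : (X ⊗ T).obj n) (c : ((A ⊗ Δ[1]) ⊗ T).obj n),
        (frameInc i e ▷ T).app n b = (frameSide i ▷ T).app n c → (x e).app n b = a.app n c := by
      intro n e b c hbc
      have h1 : (inc e).app n b.1 = (i ▷ Δ[1]).app n c.1 := congrArg (fun z ↦ (z.1).1) hbc
      have h2 : b.2 = c.2 := congrArg (fun z ↦ z.2) hbc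
      have h3 : b.1 = i.app n c.1.1 := congrArg Prod.fst h1
      have h4 : c.1 = (inc e).app n c.1.1 := Prod.ext rfl (congrArg Prod.snd h1).symm
      let w : (A ⊗ T).obj n := (c.1.1, c.2)
      have h5 : b = (i ▷ T).app n w := Prod.ext h3 h2
      have h6 : c = (inc e ▷ T).app n w := Prod.ext h4 rfl
      rw [h5, h6]
      exact (ConcreteCategory.congr_hom (NatTrans.congr_app (h e) n) w).symm
    rintro n (_ | e) (_ | e') b c hbc
    · have h1 : (i ▷ Δ[1]).app n b.1 = (i ▷ Δ[1]).app n c.1 := congrArg (fun z ↦ (z.1).1) hbc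
      have h2 : b.2 = c.2 := congrArg (fun z ↦ z.2) hbc
      have : b = c := Prod.ext (Prod.ext (app_injective_of_mono i n (congrArg Prod.fst h1))
        (congrArg (fun z ↦ z.2) h1)) h2
      rw [this]
    · exact (side n e' c b hbc.symm).symm
    · exact side n e b c hbc
    · have h1 : (inc e).app n b.1 = (inc e').app n c.1 := congrArg (fun z ↦ (z.1).1) hbc
      have h2 : b.2 = c.2 := congrArg (fun z ↦ z.2) hbc
      have h3 : b.1 = c.1 := congrArg (fun z ↦ z.1) h1
      have : b = c := Prod.ext h3 h2
      subst this
      fin_cases e <;> fin_cases e'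
      · rfl
      · exact absurd h1 (inc_app_ne _ _)
      · exact absurd h1.symm (inc_app_ne _ _)
      · rfl)
  exact ⟨d, fun e ↦ hd (some e), hd none⟩

lemma frame_hom_ext {A X T Z : SSet.{u}} (i : A ⟶ X)
    {d d' : (cylinderFrame i : SSet.{u}) ⊗ T ⟶ Z}
    (h : ∀ e, frameInc i e ▷ T ≫ d = frameInc i e ▷ T ≫ d')
    (h' : frameSide i ▷ T ≫ d = frameSide i ▷ T ≫ d') : d = d' := by
  refine hom_eq_of_jointly_surjective (fun k ↦ framePieceMap i k ▷ T)
    (fun n y ↦ by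
      obtain ⟨k, z, hz⟩ := framePieceMap_surjective i n y.1
      exact ⟨k, (z, y.2), Prod.ext hz rfl⟩) ?_
  rintro (_ | e)
  · exact h'
  · exact h e

lemma frame_compat₀ {A X Z : SSet.{u}} (i : A ⟶ X) [Mono i]
    (x : Fin 2 → (X ⟶ Z)) (a : (A ⊗ Δ[1]) ⟶ Z) (h : ∀ e, inc e ≫ a = i ≫ x e) :
    ∃ d : (cylinderFrame i : SSet.{u}) ⟶ Z, (∀ e, frameInc i e ≫ d = x e) ∧
      frameSide i ≫ d = a := by
  obtain ⟨d, h1, h2⟩ := frame_compat i (T := Δ[0]) (fun e ↦ fst _ _ ≫ x e) (fst _ _ ≫ a)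
    (fun e ↦ by
      have := fst _ Δ[0] ≫= h e
      simpa using this)
  let t (S : SSet.{u}) : S ⟶ Δ[0] := const (stdSimplex.obj₀Equiv.symm 0)
  refine ⟨lift (𝟙 _) (t _) ≫ d, fun e ↦ ?_, ?_⟩
  · have := lift (𝟙 _) (t _) ≫= h1 e
    exact this
  · have := lift (𝟙 _) (t _) ≫= h2
    exact this

/-- Filling of squares of homotopies, relative to a subobject and over a base. -/
lemma exists_lift_square {A X E B : SSet.{u}} (i : A ⟶ X) [Mono i] (p : E ⟶ B) [Fibration p]
    (e : Fin 2) (K : X ⊗ Δ[1] ⟶ E) (S : Fin 2 → (X ⊗ Δ[1] ⟶ E))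
    (Q : (A ⊗ Δ[1]) ⊗ Δ[1] ⟶ E) (b : (X ⊗ Δ[1]) ⊗ Δ[1] ⟶ B)
    (hSK : ∀ s, inc e ≫ S s = inc s ≫ K)
    (hQS : ∀ s, inc s ▷ _ ≫ Q = i ▷ _ ≫ S s)
    (hQK : inc e ≫ Q = i ▷ _ ≫ K)
    (hK : K ≫ p = inc e ≫ b) (hS : ∀ s, S s ≫ p = inc s ▷ _ ≫ b)
    (hQ : Q ≫ p = (i ▷ _) ▷ _ ≫ b) :
    ∃ H : (X ⊗ Δ[1]) ⊗ Δ[1] ⟶ E, inc e ≫ H = K ∧ (∀ s, inc s ▷ _ ≫ H = S s) ∧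
      (i ▷ _) ▷ _ ≫ H = Q ∧ H ≫ p = b := by
  -- The second cylinder coordinate is the direction of lifting. The maps `S` and `Q` form a
  -- homotopy on the frame of the first cylinder, which is to be extended with `K` prescribed at the
  -- end `e`.
  obtain ⟨d, h1, h2⟩ := frame_compat i S Q hQS
  obtain ⟨H, H1, H2, H3⟩ := exists_lift_cylinder (cylinderFrame i).ι p e d K b
    (by
      refine hom_eq_of_jointly_surjective (framePieceMap i) (framePieceMap_surjective i) ?_
      rintro (_ | s)
      · have := inc e ≫= h2
        exact this.trans hQK
      · have := inc e ≫= h1 s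
        exact this.trans (hSK s))
    (by
      apply frame_hom_ext
      · intro s
        have := h1 s =≫ p
        exact this.trans (hS s)
      · have := h2 =≫ p
        exact this.trans hQ) hK
  refine ⟨H, H2, fun s ↦ ?_, ?_, H3⟩
  · rw [← h1, ← H1]; rfl
  · rw [← h2, ← H1]; rfl

/-- Homotopy of maps of simplicial sets (one step). -/
def Htpy {A Z : SSet.{u}} (f g : A ⟶ Z) : Prop :=
  ∃ H : A ⊗ Δ[1] ⟶ Z, inc 0 ≫ H = f ∧ inc 1 ≫ H = g

namespace Htpy

variable {A X Z Z' : SSet.{u}}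

lemma refl (f : A ⟶ Z) : Htpy f f := ⟨fst _ _ ≫ f, rfl, rfl⟩

lemma comp_left {f g : A ⟶ Z} (h : Htpy f g) (k : X ⟶ A) : Htpy (k ≫ f) (k ≫ g) := by
  obtain ⟨H, rfl, rfl⟩ := h
  exact ⟨k ▷ _ ≫ H, rfl, rfl⟩

lemma comp_right {f g : A ⟶ Z} (h : Htpy f g) (k : Z ⟶ Z') : Htpy (f ≫ k) (g ≫ k) := by
  obtain ⟨H, rfl, rfl⟩ := h
  exact ⟨H ≫ k, rfl, rfl⟩

end Htpy

instance mono_of_empty {X : SSet.{u}} : Mono ((⊥ : X.Subcomplex).ι) := inferInstance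

/-- The case of the empty subobject, where the conditions on sides hold because anything with a map
to an empty simplicial set has only one map to each target. -/
lemma exists_lift_square_absolute {X E B : SSet.{u}} (p : E ⟶ B) [Fibration p]
    (e : Fin 2) (K : X ⊗ Δ[1] ⟶ E) (S : Fin 2 → (X ⊗ Δ[1] ⟶ E))
    (b : (X ⊗ Δ[1]) ⊗ Δ[1] ⟶ B) (hSK : ∀ s, inc e ≫ S s = inc s ≫ K)
    (hK : K ≫ p = inc e ≫ b) (hS : ∀ s, S s ≫ p = inc s ▷ _ ≫ b) :
    ∃ H : (X ⊗ Δ[1]) ⊗ Δ[1] ⟶ E, inc e ≫ H = K ∧ (∀ s, inc s ▷ _ ≫ H = S s) ∧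
      H ≫ p = b := by
  have ex : ∀ {T R : SSet.{u}} (f : T ⟶ (⊥ : X.Subcomplex)) (g g' : T ⟶ R), g = g' := by
    intro T R f g g'
    ext n x
    exact (f.app n x).2.elim
  obtain ⟨H, h1, h2, -, h4⟩ := exists_lift_square (⊥ : X.Subcomplex).ι p e K S
    ((fst _ _ ≫ fst _ _) ≫ Subcomplex.isInitialBot.to _) b hSK (fun s ↦ ex (fst _ _) _ _)
    (ex (fst _ _) _ _) hK hS (ex (fst _ _ ≫ fst _ _) _ _)
  exact ⟨H, h1, h2, h4⟩

lemma exists_square {X Z : SSet.{u}} [KanComplex Z]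
    (e : Fin 2) (K : X ⊗ Δ[1] ⟶ Z) (S : Fin 2 → (X ⊗ Δ[1] ⟶ Z))
    (hSK : ∀ s, inc e ≫ S s = inc s ≫ K) :
    ∃ H : (X ⊗ Δ[1]) ⊗ Δ[1] ⟶ Z, inc e ≫ H = K ∧ (∀ s, inc s ▷ _ ≫ H = S s) := by
  obtain ⟨H, h1, h2, -⟩ := exists_lift_square_absolute (Limits.terminal.from Z) e K S
    (Limits.terminal.from _) hSK (by simp) (by simp)
  exact ⟨H, h1, h2⟩

lemma Htpy.symm {A Z : SSet.{u}} [KanComplex Z] {f g : A ⟶ Z} (h : Htpy f g) : Htpy g f := by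
  obtain ⟨h, rfl, rfl⟩ := h
  -- In a square with constant bottom, left side `h` and constant right side, the top edge is the
  -- reverse of `h`.
  obtain ⟨H, h1, h2⟩ := exists_square 0 (fst _ _ ≫ inc 0 ≫ h) (Fin.cons h fun _ ↦ fst _ _ ≫ inc 0 ≫ h)
    (Fin.forall_fin_two.2 ⟨(inc_fst_assoc _ _ _).symm, by
      change inc 0 ≫ fst _ _ ≫ inc 0 ≫ h = _
      rw [inc_fst_assoc, inc_fst_assoc]⟩)
  refine ⟨inc 1 ≫ H, ?_, ?_⟩
  · rw [← inc_comp_assoc, h2]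
    rfl
  · rw [← inc_comp_assoc, h2]
    exact inc_fst_assoc _ _ _

lemma Htpy.trans {A Z : SSet.{u}} [KanComplex Z] {f g k : A ⟶ Z} (h : Htpy f g)
    (h' : Htpy g k) : Htpy f k := by
  obtain ⟨h, rfl, rfl⟩ := h
  obtain ⟨h', e, rfl⟩ := h'
  obtain ⟨H, h1, h2⟩ := exists_square 0 h (Fin.cons (fst _ _ ≫ inc 0 ≫ h) fun _ ↦ h')
    (Fin.forall_fin_two.2 ⟨inc_fst_assoc _ _ _, e⟩)
  refine ⟨inc 1 ≫ H, ?_, ?_⟩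
  · rw [← inc_comp_assoc, h2]
    exact inc_fst_assoc _ _ _
  · rw [← inc_comp_assoc, h2]
    rfl

/-- The setoid of homotopy classes of maps into a Kan complex. -/
def htpySetoid (A Z : SSet.{u}) [KanComplex Z] : Setoid (A ⟶ Z) where
  r := Htpy
  iseqv := ⟨Htpy.refl, Htpy.symm, Htpy.trans⟩

/-- Homotopy classes of maps into a Kan complex. -/
def HtpyClass (A Z : SSet.{u}) [KanComplex Z] : Type u := Quotient (htpySetoid A Z)

/-- Restriction of homotopy classes. -/
def HtpyClass.pre {A X : SSet.{u}} (f : A ⟶ X) (Z : SSet.{u}) [KanComplex Z] :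
    HtpyClass X Z → HtpyClass A Z :=
  Quotient.map (fun g ↦ f ≫ g) fun _ _ h ↦ h.comp_left f

/-- Weak equivalences, tested by maps into Kan complexes. -/
def IsKanEquivalence {A X : SSet.{u}} (f : A ⟶ X) : Prop :=
  ∀ (Z : SSet.{u}) [KanComplex Z], Function.Bijective (HtpyClass.pre f Z)

end SSet

/-! ### Kan equivalences and trivial fibrations -/

namespace SSet
open HomotopicalAlgebra Opposite Limits
open scoped SSet.modelCategoryQuillen

lemma isKanEquivalence_iff {A X : SSet.{u}} (f : A ⟶ X) :
    IsKanEquivalence f ↔ ∀ (Z : SSet.{u}) [KanComplex Z],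
      (∀ h h' : X ⟶ Z, Htpy (f ≫ h) (f ≫ h') → Htpy h h') ∧
        ∀ g : A ⟶ Z, ∃ h : X ⟶ Z, Htpy (f ≫ h) g := by
  refine forall₂_congr fun Z _ ↦ and_congr ⟨fun H h h' e ↦ ?_, fun H a b ↦ ?_⟩ ⟨fun H g ↦ ?_,
    fun H a ↦ ?_⟩
  · exact Quotient.exact (H (Quotient.sound (s := htpySetoid A Z) e :
      HtpyClass.pre f Z (Quotient.mk _ h) = HtpyClass.pre f Z (Quotient.mk _ h')))
  · induction a using Quotient.inductionOn with | _ a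
    induction b using Quotient.inductionOn with | _ b
    exact fun e ↦ Quotient.sound (H _ _ (Quotient.exact e))
  · obtain ⟨a, ha⟩ := H (Quotient.mk _ g)
    induction a using Quotient.inductionOn with | _ a
    exact ⟨a, Quotient.exact ha⟩
  · induction a using Quotient.inductionOn with | _ a
    obtain ⟨h, hh⟩ := H a
    exact ⟨Quotient.mk _ h, Quotient.sound hh⟩

lemma HtpyClass.pre_comp {A X Y : SSet.{u}} (f : A ⟶ X) (g : X ⟶ Y) (Z : SSet.{u})
    [KanComplex Z] : HtpyClass.pre (f ≫ g) Z = HtpyClass.pre f Z ∘ HtpyClass.pre g Z := by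
  ext a
  induction a using Quotient.inductionOn with | _ a
  exact congrArg (Quotient.mk _) (Category.assoc _ _ _)

lemma HtpyClass.pre_id (A Z : SSet.{u}) [KanComplex Z] : HtpyClass.pre (𝟙 A) Z = id := by
  ext a
  induction a using Quotient.inductionOn with | _ a
  exact congrArg (Quotient.mk _) (Category.id_comp _)

lemma HtpyClass.pre_congr {A X : SSet.{u}} {f f' : A ⟶ X} (h : Htpy f f') (Z : SSet.{u})
    [KanComplex Z] : HtpyClass.pre f Z = HtpyClass.pre f' Z := by
  ext a
  induction a using Quotient.inductionOn with | _ a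
  exact Quotient.sound (h.comp_right a)

namespace IsKanEquivalence

variable {A X Y T : SSet.{u}} {f f' : A ⟶ X} {g : X ⟶ Y} {h : Y ⟶ T}

lemma id (A : SSet.{u}) : IsKanEquivalence (𝟙 A) := fun Z _ ↦ by
  rw [HtpyClass.pre_id]
  exact Function.bijective_id

lemma comp (hf : IsKanEquivalence f) (hg : IsKanEquivalence g) : IsKanEquivalence (f ≫ g) :=
  fun Z _ ↦ by
    rw [HtpyClass.pre_comp]
    exact (hf Z).comp (hg Z)

lemma of_comp_left (hf : IsKanEquivalence f) (hfg : IsKanEquivalence (f ≫ g)) :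
    IsKanEquivalence g := fun Z _ ↦ by
  have := hfg Z
  rw [HtpyClass.pre_comp] at this
  exact (Function.Bijective.of_comp_iff' (hf Z) _).1 this

lemma of_comp_right (hg : IsKanEquivalence g) (hfg : IsKanEquivalence (f ≫ g)) :
    IsKanEquivalence f := fun Z _ ↦ by
  have := hfg Z
  rw [HtpyClass.pre_comp] at this
  exact (Function.Bijective.of_comp_iff _ (hg Z)).1 this

/-- Precomposition with `g` is injective because of `f ≫ g` and surjective because of `g ≫ h`. -/
lemma two_of_six (hfg : IsKanEquivalence (f ≫ g)) (hgh : IsKanEquivalence (g ≫ h)) :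
    IsKanEquivalence g := fun Z _ ↦ by
  have h1 := hfg Z
  have h2 := hgh Z
  rw [HtpyClass.pre_comp] at h1 h2
  exact ⟨h1.1.of_comp, h2.2.of_comp⟩

lemma of_htpy (hf : IsKanEquivalence f) (h : Htpy f f') : IsKanEquivalence f' := fun Z _ ↦ by
  rw [← HtpyClass.pre_congr h]
  exact hf Z

lemma of_htpy' (hf : IsKanEquivalence f') (h : Htpy f f') : IsKanEquivalence f := fun Z _ ↦ by
  rw [HtpyClass.pre_congr h]
  exact hf Z

lemma of_isIso (f : A ⟶ X) [IsIso f] : IsKanEquivalence f := by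
  have h1 : IsKanEquivalence (f ≫ inv f) := by rw [IsIso.hom_inv_id]; exact id _
  have h2 : IsKanEquivalence (inv f ≫ f) := by rw [IsIso.inv_hom_id]; exact id _
  exact h2.two_of_six h1

/-- The Yoneda argument: between Kan complexes the test objects may be taken to be `A` and `X`
themselves. -/
lemma exists_inverse [KanComplex A] [KanComplex X] (hf : IsKanEquivalence f) :
    ∃ g : X ⟶ A, Htpy (f ≫ g) (𝟙 A) ∧ Htpy (g ≫ f) (𝟙 X) := by
  rw [isKanEquivalence_iff] at hf
  obtain ⟨g, hg⟩ := (hf A).2 (𝟙 A)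
  refine ⟨g, hg, (hf X).1 _ _ ?_⟩
  have := hg.comp_right f
  rw [Category.assoc, Category.id_comp] at this
  rwa [Category.comp_id]

end IsKanEquivalence

lemma IsKanEquivalence.of_inverse {A X : SSet.{u}} {f : A ⟶ X} {g : X ⟶ A}
    (h1 : IsKanEquivalence (f ≫ g)) (h2 : IsKanEquivalence (g ≫ f)) : IsKanEquivalence f :=
  h2.two_of_six h1

section curry
open MonoidalClosed

lemma whiskerLeft_inc_associator_inv_assoc (T A : SSet.{u}) (e : Fin 2) {Z : SSet.{u}}
    (g : (T ⊗ A) ⊗ Δ[1] ⟶ Z) :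
    T ◁ (inc e : A ⟶ _) ≫ (α_ T A Δ[1]).inv ≫ g = inc e ≫ g := rfl

lemma inc_associator_hom_assoc (T A : SSet.{u}) (e : Fin 2) {Z : SSet.{u}}
    (g : T ⊗ A ⊗ Δ[1] ⟶ Z) :
    inc e ≫ (α_ T A Δ[1]).hom ≫ g = T ◁ (inc e : A ⟶ _) ≫ g := rfl

lemma Htpy.curry {T A Z : SSet.{u}} {f g : T ⊗ A ⟶ Z} (h : Htpy f g) :
    Htpy (MonoidalClosed.curry f) (MonoidalClosed.curry g) := by
  obtain ⟨H, rfl, rfl⟩ := h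
  refine ⟨MonoidalClosed.curry ((α_ T A Δ[1]).inv ≫ H), ?_, ?_⟩ <;>
    rw [← curry_natural_left, whiskerLeft_inc_associator_inv_assoc]

lemma Htpy.uncurry {T A Z : SSet.{u}} {f g : A ⟶ (ihom T).obj Z} (h : Htpy f g) :
    Htpy (MonoidalClosed.uncurry f) (MonoidalClosed.uncurry g) := by
  obtain ⟨H, rfl, rfl⟩ := h
  refine ⟨(α_ T A Δ[1]).hom ≫ MonoidalClosed.uncurry H, ?_, ?_⟩ <;>
    rw [inc_associator_hom_assoc, uncurry_natural_left]

/-- Homotopy classes of maps from `T ⊗ A` to `Z` are those from `A` to the internal hom `Z^T`, which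
is Kan when `Z` is. -/
lemma IsKanEquivalence.whiskerLeft {A X : SSet.{u}} {f : A ⟶ X} (hf : IsKanEquivalence f)
    (T : SSet.{u}) : IsKanEquivalence (T ◁ f) := by
  rw [isKanEquivalence_iff] at hf ⊢
  refine fun Z _ ↦ ⟨fun h h' e ↦ ?_, fun g ↦ ?_⟩
  · have := e.curry
    rw [curry_natural_left, curry_natural_left] at this
    have := ((hf _).1 _ _ this).uncurry
    rwa [uncurry_curry, uncurry_curry] at this
  · obtain ⟨h, hh⟩ := (hf _).2 (MonoidalClosed.curry g)
    have := hh.uncurry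
    rw [uncurry_natural_left, uncurry_curry] at this
    exact ⟨_, this⟩

lemma IsKanEquivalence.whiskerRight {A X : SSet.{u}} {f : A ⟶ X} (hf : IsKanEquivalence f)
    (T : SSet.{u}) : IsKanEquivalence (f ▷ T) := by
  have : f ▷ T = (β_ A T).hom ≫ T ◁ f ≫ (β_ T X).hom := rfl
  rw [this]
  exact (of_isIso _).comp ((hf.whiskerLeft T).comp (of_isIso _))

/-- The evaluation `A ⊗ Z^A ⟶ Z` extends up to homotopy over `X ⊗ Z^A`. The adjoint of this
extension is a homotopy inverse of the restriction `Z^X ⟶ Z^A`. -/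
lemma isKanEquivalence_pre {A X : SSet.{u}} {i : A ⟶ X} (hi : IsKanEquivalence i)
    (Z : SSet.{u}) [KanComplex Z] : IsKanEquivalence ((MonoidalClosed.pre i).app Z) := by
  have h1 := (isKanEquivalence_iff _).1 (hi.whiskerRight ((ihom A).obj Z))
  have h2 := (isKanEquivalence_iff _).1 (hi.whiskerRight ((ihom X).obj Z))
  obtain ⟨r, hr⟩ := (h1 Z).2 ((ihom.ev A).app Z)
  have e1 : Htpy (MonoidalClosed.curry r ≫ (MonoidalClosed.pre i).app Z) (𝟙 _) := by
    rw [curry_pre_app]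
    have := hr.curry
    rwa [← uncurry_id_eq_ev, curry_uncurry] at this
  refine IsKanEquivalence.of_inverse (g := MonoidalClosed.curry r)
    ((IsKanEquivalence.id _).of_htpy' ?_) ((IsKanEquivalence.id _).of_htpy' e1)
  have := (h2 Z).1 (MonoidalClosed.uncurry ((MonoidalClosed.pre i).app Z ≫ MonoidalClosed.curry r))
    (MonoidalClosed.uncurry (𝟙 _)) (by
      rw [← uncurry_pre_app, ← uncurry_pre_app, Category.assoc, Category.id_comp]
      have := (e1.comp_left ((MonoidalClosed.pre i).app Z)).uncurry
      rwa [Category.comp_id] at this)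
  have := this.curry
  rwa [curry_uncurry, curry_uncurry] at this

end curry

/-- Trivial fibrations: the right lifting property against all monomorphisms. -/
def IsTrivialFib {E B : SSet.{u}} (p : E ⟶ B) : Prop :=
  ∀ ⦃A X : SSet.{u}⦄ (i : A ⟶ X), Mono i → HasLiftingProperty i p

lemma isTrivialFib_of_boundary {E B : SSet.{u}} {p : E ⟶ B}
    (h : ∀ n, HasLiftingProperty (boundary.{u} n).ι p) : IsTrivialFib p := by
  have : modelCategoryQuillen.I.rlp p := by
    rintro _ _ _ ⟨n⟩
    exact h n
  rw [← rlp_monomorphisms] at this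
  exact fun A X i hi ↦ this i hi

lemma hasLiftingProperty_of_exists {A X E B : SSet.{u}} {i : A ⟶ X} {p : E ⟶ B}
    (h : ∀ (u : A ⟶ E) (v : X ⟶ B), u ≫ p = i ≫ v → ∃ w : X ⟶ E, i ≫ w = u ∧ w ≫ p = v) :
    HasLiftingProperty i p := by
  refine ⟨fun {u v} sq ↦ ?_⟩
  obtain ⟨w, h1, h2⟩ := h u v sq.w
  exact ⟨⟨⟨w, h1, h2⟩⟩⟩

lemma exists_lift_of_hasLiftingProperty {A X E B : SSet.{u}} {i : A ⟶ X} {p : E ⟶ B}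
    (h : HasLiftingProperty i p) (u : A ⟶ E) (v : X ⟶ B) (e : u ≫ p = i ≫ v) :
    ∃ w : X ⟶ E, i ≫ w = u ∧ w ≫ p = v := by
  have sq : CommSq u i p v := ⟨e⟩
  exact ⟨sq.lift, sq.fac_left, sq.fac_right⟩

lemma hom_bot_eq {X T R : SSet.{u}} (f : T ⟶ (⊥ : X.Subcomplex)) (g g' : T ⟶ R) : g = g' := by
  ext n x
  exact (f.app n x).2.elim

lemma exists_lift_homotopy {X E B : SSet.{u}} (p : E ⟶ B) [Fibration p] (e : Fin 2) (x : X ⟶ E)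
    (b : X ⊗ Δ[1] ⟶ B) (hxb : x ≫ p = inc e ≫ b) :
    ∃ H : X ⊗ Δ[1] ⟶ E, inc e ≫ H = x ∧ H ≫ p = b := by
  obtain ⟨H, -, h2, h3⟩ := exists_lift_cylinder (⊥ : X.Subcomplex).ι p e
    (fst _ _ ≫ Subcomplex.isInitialBot.to _) x b (hom_bot_eq (𝟙 _) _ _)
    (hom_bot_eq (fst _ _) _ _) hxb
  exact ⟨H, h2, h3⟩

namespace IsTrivialFib

variable {E B : SSet.{u}} {p : E ⟶ B}

lemma exists_lift (hp : IsTrivialFib p) {X : SSet.{u}} (v : X ⟶ B) : ∃ w : X ⟶ E, w ≫ p = v := by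
  obtain ⟨w, -, h⟩ := exists_lift_of_hasLiftingProperty (hp (⊥ : X.Subcomplex).ι inferInstance)
    (Subcomplex.isInitialBot.to _) v (hom_bot_eq (𝟙 _) _ _)
  exact ⟨w, h⟩

lemma exists_lift_homotopy (hp : IsTrivialFib p) {A X : SSet.{u}} (i : A ⟶ X) [Mono i]
    (x : Fin 2 → (X ⟶ E)) (a : A ⊗ Δ[1] ⟶ E) (b : X ⊗ Δ[1] ⟶ B)
    (ha : ∀ e, inc e ≫ a = i ≫ x e) (hab : a ≫ p = i ▷ _ ≫ b) (hx : ∀ e, x e ≫ p = inc e ≫ b) :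
    ∃ H : X ⊗ Δ[1] ⟶ E, i ▷ _ ≫ H = a ∧ (∀ e, inc e ≫ H = x e) ∧ H ≫ p = b := by
  obtain ⟨d, h1, h2⟩ := frame_compat₀ i x a ha
  obtain ⟨H, e1, e2⟩ := exists_lift_of_hasLiftingProperty (hp (cylinderFrame i).ι inferInstance)
    d b (by
      refine hom_eq_of_jointly_surjective (framePieceMap i) (framePieceMap_surjective i) ?_
      rintro (_ | s)
      · change frameSide i ≫ _ = frameSide i ≫ _
        rw [reassoc_of% h2, hab]; rfl
      · change frameInc i s ≫ _ = frameInc i s ≫ _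
        rw [reassoc_of% h1, hx]; rfl)
  refine ⟨H, ?_, fun e ↦ ?_, e2⟩
  · rw [← h2, ← e1]; rfl
  · rw [← h1, ← e1]; rfl

lemma exists_lift_homotopy_absolute (hp : IsTrivialFib p) {X : SSet.{u}}
    (x : Fin 2 → (X ⟶ E)) (b : X ⊗ Δ[1] ⟶ B) (hx : ∀ e, x e ≫ p = inc e ≫ b) :
    ∃ H : X ⊗ Δ[1] ⟶ E, (∀ e, inc e ≫ H = x e) ∧ H ≫ p = b := by
  obtain ⟨H, -, h⟩ := hp.exists_lift_homotopy (⊥ : X.Subcomplex).ι x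
    (fst _ _ ≫ Subcomplex.isInitialBot.to _) b (fun _ ↦ hom_bot_eq (𝟙 _) _ _)
    (hom_bot_eq (fst _ _) _ _) hx
  exact ⟨H, h⟩

lemma isKanEquivalence (hp : IsTrivialFib p) : IsKanEquivalence p := by
  obtain ⟨s, hs⟩ := hp.exists_lift (𝟙 B)
  obtain ⟨H, hH, -⟩ := hp.exists_lift_homotopy_absolute (Fin.cons (𝟙 E) fun _ ↦ p ≫ s)
    (fst _ _ ≫ p) (Fin.forall_fin_two.2 ⟨by
      rw [inc_fst_assoc]; exact Category.id_comp _, by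
      rw [inc_fst_assoc]
      change (p ≫ s) ≫ p = p
      rw [Category.assoc, hs, Category.comp_id]⟩)
  refine IsKanEquivalence.of_inverse (g := s) ((IsKanEquivalence.id E).of_htpy ⟨H, hH 0, hH 1⟩) ?_
  rw [hs]
  exact IsKanEquivalence.id B

/-- A homotopy inverse is straightened to a section `s` by homotopy lifting, and the homotopy from
the identity to `p ≫ s` is made vertical. A lifting problem is then solved by starting from `v ≫ s`
and running the vertical homotopy backwards relative to `A`. -/
lemma of_fibration [Fibration p] [KanComplex E] [KanComplex B] (hp : IsKanEquivalence p) :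
    IsTrivialFib p := by
  obtain ⟨g, h1, ⟨H, hH0, hH1⟩⟩ := hp.exists_inverse
  obtain ⟨H', e1, e2⟩ := SSet.exists_lift_homotopy p 0 g H hH0.symm
  obtain ⟨s, hs, hps⟩ : ∃ s : B ⟶ E, s ≫ p = 𝟙 B ∧ Htpy (𝟙 E) (p ≫ s) := by
    refine ⟨inc 1 ≫ H', by rw [Category.assoc, e2, hH1], ?_⟩
    exact h1.symm.trans (Htpy.comp_left ⟨H', e1, rfl⟩ p)
  obtain ⟨K, hK0, hK1⟩ := hps
  have hKs : K ≫ p ≫ s ≫ p = K ≫ p := by rw [hs, Category.comp_id]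
  -- The homotopies `K` and `K ≫ p ≫ s` have the same projection to `B` and the same end. The
  -- remaining edge of the square on them runs from the identity to `p ≫ s` over a constant
  -- homotopy.
  obtain ⟨H, a1, a2, a3⟩ := exists_lift_square_absolute p 1 (fst _ _ ≫ p ≫ s)
    (Fin.cons K fun _ ↦ K ≫ p ≫ s) (fst _ _ ▷ _ ≫ K ≫ p)
    (Fin.forall_fin_two.2 ⟨by rw [inc_fst_assoc]; exact hK1, by
      rw [inc_fst_assoc]
      change inc 1 ≫ K ≫ p ≫ s = _
      rw [reassoc_of% hK1, reassoc_of% hs]⟩)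
    (by
      rw [inc_comp_assoc, reassoc_of% hK1]
      simp only [Category.assoc])
    (Fin.forall_fin_two.2 ⟨by
      rw [← comp_whiskerRight_assoc, inc_fst, id_whiskerRight, Category.id_comp]; rfl, by
      rw [← comp_whiskerRight_assoc, inc_fst, id_whiskerRight, Category.id_comp]
      change (K ≫ p ≫ s) ≫ p = _
      simp only [Category.assoc]
      exact hKs⟩)
  have L0 : inc 0 ≫ inc 0 ≫ H = 𝟙 E := by
    rw [← inc_comp_assoc, a2]; exact hK0
  have L1 : inc 1 ≫ inc 0 ≫ H = p ≫ s := by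
    rw [← inc_comp_assoc, a2]
    change inc 0 ≫ K ≫ p ≫ s = _
    rw [reassoc_of% hK0]
  have Lp : (inc 0 ≫ H) ≫ p = fst _ _ ≫ p := by
    rw [Category.assoc, a3, inc_comp_assoc, reassoc_of% hK0]
  intro A X i hi
  refine hasLiftingProperty_of_exists fun u v huv ↦ ?_
  obtain ⟨M, m1, m2, m3⟩ := exists_lift_cylinder i p 1 (u ▷ _ ≫ inc 0 ≫ H) (v ≫ s)
    (fst _ _ ≫ v) (by rw [inc_comp_assoc, L1, reassoc_of% huv])
    (by rw [Category.assoc, Lp, whiskerRight_fst_assoc, huv, whiskerRight_fst_assoc])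
    (by rw [Category.assoc, hs, Category.comp_id, inc_fst_assoc])
  refine ⟨inc 0 ≫ M, ?_, ?_⟩
  · rw [← inc_comp_assoc, m1, inc_comp_assoc, L0, Category.comp_id]
  · rw [Category.assoc, m3, inc_fst_assoc]

end IsTrivialFib

/-- Monomorphisms with the left lifting property against fibrations between Kan complexes. -/
def IsKanAnodyne {A X : SSet.{u}} (i : A ⟶ X) : Prop :=
  Mono i ∧ ∀ ⦃E B : SSet.{u}⦄ (p : E ⟶ B) [Fibration p] [KanComplex E] [KanComplex B],
    HasLiftingProperty i p

end SSet

/-! ### Monomorphisms that lift against fibrations between Kan complexes -/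

namespace SSet
open HomotopicalAlgebra Opposite Limits
open scoped SSet.modelCategoryQuillen

/-- The pieces of a subcomplex which is a supremum of two ranges. -/
lemma exists_desc_of_cover {A₁ A₂ X Z : SSet.{u}} (f₁ : A₁ ⟶ X) (f₂ : A₂ ⟶ X) (g₁ : A₁ ⟶ Z)
    (g₂ : A₂ ⟶ Z) (hf : ∀ n (x : X.obj n), (∃ a, f₁.app n a = x) ∨ ∃ a, f₂.app n a = x)
    (h₁₁ : ∀ n a b, f₁.app n a = f₁.app n b → g₁.app n a = g₁.app n b)
    (h₁₂ : ∀ n a b, f₁.app n a = f₂.app n b → g₁.app n a = g₂.app n b)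
    (h₂₂ : ∀ n a b, f₂.app n a = f₂.app n b → g₂.app n a = g₂.app n b) :
    ∃ d : X ⟶ Z, f₁ ≫ d = g₁ ∧ f₂ ≫ d = g₂ := by
  obtain ⟨d, hd⟩ := exists_desc (A := fun k : Bool ↦ if k then A₁ else A₂)
    (Bool.rec f₂ f₁) (Bool.rec g₂ g₁)
    (fun n x ↦ (hf n x).elim (fun ⟨a, ha⟩ ↦ ⟨true, a, ha⟩) (fun ⟨a, ha⟩ ↦ ⟨false, a, ha⟩)) (by
      rintro n (_ | _) (_ | _) a b e
      · exact h₂₂ n a b e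
      · exact (h₁₂ n b a e.symm).symm
      · exact h₁₂ n a b e
      · exact h₁₁ n a b e)
  exact ⟨d, hd true, hd false⟩

lemma hom_eq_of_cover {A₁ A₂ X Z : SSet.{u}} (f₁ : A₁ ⟶ X) (f₂ : A₂ ⟶ X)
    (hf : ∀ n (x : X.obj n), (∃ a, f₁.app n a = x) ∨ ∃ a, f₂.app n a = x) {d d' : X ⟶ Z}
    (h₁ : f₁ ≫ d = f₁ ≫ d') (h₂ : f₂ ≫ d = f₂ ≫ d') : d = d' := by
  ext n x
  obtain ⟨a, rfl⟩ | ⟨a, rfl⟩ := hf n x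
  · exact ConcreteCategory.congr_hom (NatTrans.congr_app h₁ n) a
  · exact ConcreteCategory.congr_hom (NatTrans.congr_app h₂ n) a

instance fibration_terminal_from (Z : SSet.{u}) [KanComplex Z] : Fibration (terminal.from Z) :=
  inferInstance

instance kanComplex_terminal : KanComplex (⊤_ SSet.{u}) := by
  have : IsIso (terminal.from (⊤_ SSet.{u})) :=
    isIso_of_isTerminal terminalIsTerminal terminalIsTerminal _
  exact (isFibrant_iff _).2 inferInstance

namespace IsKanAnodyne

lemma exists_lift {A X : SSet.{u}} {i : A ⟶ X} (hi : IsKanAnodyne i) {E B : SSet.{u}} (p : E ⟶ B)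
    [Fibration p] [KanComplex E] [KanComplex B] (u : A ⟶ E) (v : X ⟶ B) (h : u ≫ p = i ≫ v) :
    ∃ w : X ⟶ E, i ≫ w = u ∧ w ≫ p = v :=
  exists_lift_of_hasLiftingProperty (hi.2 p) u v h

lemma of_exists {A X : SSet.{u}} {i : A ⟶ X} (hi : Mono i)
    (h : ∀ ⦃E B : SSet.{u}⦄ (p : E ⟶ B) [Fibration p] [KanComplex E] [KanComplex B]
      (u : A ⟶ E) (v : X ⟶ B), u ≫ p = i ≫ v → ∃ w : X ⟶ E, i ≫ w = u ∧ w ≫ p = v) :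
    IsKanAnodyne i :=
  ⟨hi, fun _ _ p _ _ _ ↦ hasLiftingProperty_of_exists (h p)⟩

lemma exists_extension {A X : SSet.{u}} {i : A ⟶ X} (hi : IsKanAnodyne i) {Z : SSet.{u}}
    [KanComplex Z] (u : A ⟶ Z) : ∃ w : X ⟶ Z, i ≫ w = u := by
  obtain ⟨w, h, -⟩ := hi.exists_lift (terminal.from Z) u (terminal.from X) (by simp)
  exact ⟨w, h⟩

lemma of_anodyneExtensions {A X : SSet.{u}} {i : A ⟶ X} [hm : Mono i] (hi : anodyneExtensions i) :
    IsKanAnodyne i :=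
  ⟨hm, fun _ _ p _ _ _ ↦ hi p ((HomotopicalAlgebra.fibration_iff p).1 inferInstance)⟩

/-- By adjunction this is a lifting problem of `i` against the fibration of Kan complexes that
restricts maps on an interval to its two ends. The ends appear as the frame of the cylinder on
`Δ[0]` relative to the empty subobject. -/
lemma exists_extension_homotopy {A X : SSet.{u}} {i : A ⟶ X} (hi : IsKanAnodyne i)
    {Z : SSet.{u}} [KanComplex Z] (x : Fin 2 → (X ⟶ Z)) (a : A ⊗ Δ[1] ⟶ Z)
    (h : ∀ e, inc e ≫ a = i ≫ x e) :
    ∃ H : X ⊗ Δ[1] ⟶ Z, i ▷ _ ≫ H = a ∧ ∀ e, inc e ≫ H = x e := by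
  let b : (⊥ : (Δ[0] : SSet.{u}).Subcomplex).toSSet ⟶ Δ[0] := (⊥ : Subcomplex _).ι
  obtain ⟨d, hd, -⟩ := frame_compat (T := X) b (fun e ↦ snd _ _ ≫ x e)
    ((fst _ _ ≫ fst _ _) ≫ Subcomplex.isInitialBot.to _) (fun _ ↦ hom_bot_eq (fst _ _) _ _)
  let a' : ((Δ[0] : SSet.{u}) ⊗ Δ[1]) ⊗ A ⟶ Z := lift (snd _ _) (fst _ _ ≫ snd _ _) ≫ a
  obtain ⟨w, w1, w2⟩ := hi.exists_lift ((MonoidalClosed.pre (cylinderFrame b).ι).app Z)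
    (MonoidalClosed.curry a') (MonoidalClosed.curry d) (by
      rw [MonoidalClosed.curry_pre_app, ← MonoidalClosed.curry_natural_left]
      congr 1
      apply frame_hom_ext
      · intro e
        have e1 : frameInc b e ▷ A ≫ (cylinderFrame b).ι ▷ A ≫ a' =
          snd _ _ ≫ inc e ≫ a := rfl
        have e2 : frameInc b e ▷ A ≫ (cylinderFrame b : SSet.{u}) ◁ i ≫ d =
          (Δ[0] ◁ i) ≫ frameInc b e ▷ X ≫ d := rfl
        rw [e1, e2, hd, h]; rfl
      · exact hom_bot_eq (fst _ _ ≫ fst _ _) _ _)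
  have w3 : (cylinderFrame b).ι ▷ X ≫ MonoidalClosed.uncurry w = d := by
    rw [← MonoidalClosed.uncurry_pre_app, w2, MonoidalClosed.uncurry_curry]
  have w4 : _ ◁ i ≫ MonoidalClosed.uncurry w = a' := by
    rw [← MonoidalClosed.uncurry_natural_left, w1, MonoidalClosed.uncurry_curry]
  let t (Y : SSet.{u}) : Y ⟶ Δ[0] := const (stdSimplex.obj₀Equiv.symm 0)
  refine ⟨lift (lift (fst _ _ ≫ t X) (snd _ _)) (fst _ _) ≫ MonoidalClosed.uncurry w, ?_,
    fun e ↦ ?_⟩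
  · have := lift (lift (fst _ _ ≫ t A) (snd _ _)) (fst _ _) ≫= w4
    exact this
  · have := lift (t X) (𝟙 X) ≫= hd e
    rw [← w3] at this
    exact this

lemma isKanEquivalence {A X : SSet.{u}} {i : A ⟶ X} (hi : IsKanAnodyne i) :
    IsKanEquivalence i := by
  rw [isKanEquivalence_iff]
  refine fun Z _ ↦ ⟨fun h h' ⟨a, ha0, ha1⟩ ↦ ?_, fun g ↦ ?_⟩
  · obtain ⟨H, -, hH⟩ := hi.exists_extension_homotopy (Fin.cons h fun _ ↦ h') a
      (Fin.forall_fin_two.2 ⟨ha0, ha1⟩)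
    exact ⟨H, hH 0, hH 1⟩
  · obtain ⟨w, hw⟩ := hi.exists_extension g
    exact ⟨w, hw ▸ Htpy.refl _⟩

/-- For a Kan complex `Z` the restriction `Z^X ⟶ Z^A` is a trivial fibration. With `Z = E` this
extends `u` to some `x`, regardless of `v`. With `Z = B` it gives a homotopy from `x ≫ p` to `v`
that is constant on `A`. Lifting this homotopy along `p` relative to `A`, from `x`, ends at a
solution. -/
lemma of_isKanEquivalence {A X : SSet.{u}} {i : A ⟶ X} [hm : Mono i] (hi : IsKanEquivalence i) :
    IsKanAnodyne i := by
  have tf (Z : SSet.{u}) [KanComplex Z] : IsTrivialFib ((MonoidalClosed.pre i).app Z) :=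
    IsTrivialFib.of_fibration (isKanEquivalence_pre hi Z)
  refine of_exists hm fun E B p _ _ _ u v huv ↦ ?_
  let t (S : SSet.{u}) : S ⟶ Δ[0] := const (stdSimplex.obj₀Equiv.symm 0)
  obtain ⟨x, hx⟩ : ∃ x : X ⟶ E, i ≫ x = u := by
    obtain ⟨w, hw⟩ := (tf E).exists_lift (MonoidalClosed.curry (fst A Δ[0] ≫ u))
    have hw' : i ▷ Δ[0] ≫ MonoidalClosed.uncurry w = fst _ _ ≫ u := by
      rw [← MonoidalClosed.uncurry_pre_app, hw, MonoidalClosed.uncurry_curry]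
    refine ⟨lift (𝟙 _) (t X) ≫ MonoidalClosed.uncurry w, ?_⟩
    have := lift (𝟙 _) (t A) ≫= hw'
    exact this
  obtain ⟨b, hb, hb0, hb1⟩ : ∃ b : X ⊗ Δ[1] ⟶ B, i ▷ _ ≫ b = fst _ _ ≫ u ≫ p ∧
      inc 0 ≫ b = x ≫ p ∧ inc 1 ≫ b = v := by
    obtain ⟨H, h1, h2⟩ := (tf B).exists_lift_homotopy_absolute (X := Δ[0])
      (Fin.cons (MonoidalClosed.curry (fst _ _ ≫ x ≫ p)) fun _ ↦
        (MonoidalClosed.curry (fst _ _ ≫ v)))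
      (MonoidalClosed.curry (fst A (Δ[0] ⊗ Δ[1]) ≫ u ≫ p)) (Fin.forall_fin_two.2 ⟨by
        change MonoidalClosed.curry (fst _ _ ≫ x ≫ p) ≫ _ = _
        rw [MonoidalClosed.curry_pre_app, ← MonoidalClosed.curry_natural_left,
          whiskerRight_fst_assoc, whiskerLeft_fst_assoc, ← hx, Category.assoc], by
        change MonoidalClosed.curry (fst _ _ ≫ v) ≫ _ = _
        rw [MonoidalClosed.curry_pre_app, ← MonoidalClosed.curry_natural_left,
          whiskerRight_fst_assoc, whiskerLeft_fst_assoc, huv]⟩)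
    have h3 : i ▷ _ ≫ MonoidalClosed.uncurry H = fst A (Δ[0] ⊗ Δ[1]) ≫ u ≫ p := by
      rw [← MonoidalClosed.uncurry_pre_app, h2, MonoidalClosed.uncurry_curry]
    have h4 : X ◁ inc 0 ≫ MonoidalClosed.uncurry H = fst X Δ[0] ≫ x ≫ p := by
      rw [← MonoidalClosed.uncurry_natural_left, h1 0]
      exact MonoidalClosed.uncurry_curry _
    have h5 : X ◁ inc 1 ≫ MonoidalClosed.uncurry H = fst X Δ[0] ≫ v := by
      rw [← MonoidalClosed.uncurry_natural_left, h1 1]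
      exact MonoidalClosed.uncurry_curry _
    refine ⟨lift (fst _ _) (lift (fst _ _ ≫ t X) (snd _ _)) ≫ MonoidalClosed.uncurry H, ?_, ?_, ?_⟩
    · have := lift (fst _ _) (lift (fst _ _ ≫ t A) (snd _ _)) ≫= h3
      exact this
    · have := lift (𝟙 _) (t X) ≫= h4
      exact this
    · have := lift (𝟙 _) (t X) ≫= h5
      exact this
  obtain ⟨H, h1, h2, h3⟩ := exists_lift_cylinder i p 0 (fst _ _ ≫ u) x b
    (by rw [inc_fst_assoc, hx]) (by rw [hb, Category.assoc]) hb0.symm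
  refine ⟨inc 1 ≫ H, ?_, by rw [Category.assoc, h3, hb1]⟩
  rw [← inc_comp_assoc, h1, inc_fst_assoc]

/-- The union of a sequence of subcomplexes. -/
lemma of_iSup {X : SSet.{u}} (F : ℕ → X.Subcomplex) (hF : ∀ n, F n ≤ F (n + 1))
    (hA : ∀ n, IsKanAnodyne (Subcomplex.homOfLE (hF n))) (hX : ∀ n (x : X.obj n), ∃ k, x ∈ (F k).obj n) :
    IsKanAnodyne (F 0).ι := by
  refine of_exists inferInstance fun E B p _ _ _ u v huv ↦ ?_
  let S (k : ℕ) := {w : (F k : SSet.{u}) ⟶ E // w ≫ p = (F k).ι ≫ v}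
  have step (k : ℕ) (w : S k) : ∃ w' : S (k + 1), Subcomplex.homOfLE (hF k) ≫ w'.1 = w.1 := by
    obtain ⟨w', h1, h2⟩ := (hA k).exists_lift p w.1 ((F (k + 1)).ι ≫ v) w.2
    exact ⟨⟨w', h2⟩, h1⟩
  choose next hnext using step
  let w : ∀ k, S k := Nat.rec ⟨u, huv⟩ next
  have hmono : Monotone F := monotone_nat_of_le_succ hF
  have key : ∀ k l (h : k ≤ l), Subcomplex.homOfLE (hmono h) ≫ (w l).1 = (w k).1 := by
    intro k l h
    induction l, h using Nat.le_induction with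
    | base => rfl
    | succ l hl ih =>
      rw [← ih, ← hnext l (w l)]
      rfl
  have key' : ∀ n k l (a : (F k).obj n) (b : (F l).obj n), k ≤ l → a.1 = b.1 →
      (w k).1.app n a = (w l).1.app n b := by
    intro n k l a b hkl hab
    rw [← key k l hkl]
    exact congrArg ((w l).1.app n) (Subtype.ext hab)
  obtain ⟨d, hd⟩ := exists_desc (fun k ↦ (F k).ι) (fun k ↦ (w k).1) (fun n x ↦ by
    obtain ⟨k, hk⟩ := hX n x
    exact ⟨k, ⟨x, hk⟩, rfl⟩) (fun n k l a b hab ↦ by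
      rcases le_total k l with h | h
      · exact key' n k l a b h hab
      · exact (key' n l k b a h hab.symm).symm)
  refine ⟨d, hd 0, hom_eq_of_jointly_surjective (fun k ↦ (F k).ι) (fun n x ↦ by
    obtain ⟨k, hk⟩ := hX n x
    exact ⟨k, ⟨x, hk⟩, rfl⟩) fun k ↦ ?_⟩
  rw [← Category.assoc, hd, (w k).2]

end IsKanAnodyne

/-! ### Mapping cylinders and relative lifting along maps of Kan equivalences -/

/-- Simplices of the mapping cylinder. -/
structure MapCyl {A A' : SSet.{u}} (f : A ⟶ A') (n : SimplexCategoryᵒᵖ) : Type u where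
  /-- the image in the target -/
  base : A'.obj n
  /-- the position in the cylinder -/
  pos : (Δ[1] : SSet.{u}).obj n
  /-- the lift to the source -/
  lft : pos ≠ stdSimplex.const 1 1 n → A.obj n
  lft_base : ∀ h, f.app n (lft h) = base

lemma MapCyl.ext {A A' : SSet.{u}} {f : A ⟶ A'} {n : SimplexCategoryᵒᵖ} {c c' : MapCyl f n}
    (hb : c.base = c'.base) (hp : c.pos = c'.pos) (hl : ∀ h h', c.lft h = c'.lft h') :
    c = c' := by
  obtain ⟨b, p, l, _⟩ := c
  obtain ⟨b', p', l', _⟩ := c'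
  obtain rfl : b = b' := hb
  obtain rfl : p = p' := hp
  obtain rfl : l = l' := funext fun h ↦ hl h h
  rfl

/-- The mapping cylinder of a map of simplicial sets. -/
def mapCyl {A A' : SSet.{u}} (f : A ⟶ A') : SSet.{u} where
  obj n := MapCyl f n
  map {m n} α := ↾fun c ↦
    { base := A'.map α c.base
      pos := (Δ[1] : SSet.{u}).map α c.pos
      lft := fun h ↦ A.map α (c.lft fun e ↦ h (by rw [e]; rfl))
      lft_base := fun h ↦ by rw [NatTrans.naturality_apply, c.lft_base] }
  map_id n := by
    ext c
    exact MapCyl.ext (ConcreteCategory.congr_hom (A'.map_id n) c.base)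
      (ConcreteCategory.congr_hom ((Δ[1] : SSet.{u}).map_id n) c.pos)
      fun _ _ ↦ ConcreteCategory.congr_hom (A.map_id n) _
  map_comp α β := by
    ext c
    exact MapCyl.ext (ConcreteCategory.congr_hom (A'.map_comp α β) c.base)
      (ConcreteCategory.congr_hom ((Δ[1] : SSet.{u}).map_comp α β) c.pos)
      fun _ _ ↦ ConcreteCategory.congr_hom (A.map_comp α β) _

namespace mapCyl

variable {A A' B B' : SSet.{u}} (f : A ⟶ A')

/-- The map from the cylinder to the mapping cylinder. -/
def cyl : A ⊗ Δ[1] ⟶ mapCyl f where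
  app n := ↾fun a ↦ (⟨f.app n a.1, a.2, fun _ ↦ a.1, fun _ ↦ rfl⟩ : MapCyl f n)
  naturality m n α := by
    ext ⟨a, t⟩
    have h : f.app n (A.map α a) = A'.map α (f.app m a) := NatTrans.naturality_apply f α a
    exact MapCyl.ext h rfl fun _ _ ↦ rfl

/-- The inclusion of the target in the mapping cylinder. -/
def inr : A' ⟶ mapCyl f where
  app n := ↾fun a ↦ (⟨a, stdSimplex.const 1 1 n, fun h ↦ (h rfl).elim, fun h ↦ (h rfl).elim⟩ :
    MapCyl f n)
  naturality m n α := by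
    ext a
    exact MapCyl.ext rfl rfl fun h _ ↦ (h rfl).elim

lemma inc_one_cyl : inc 1 ≫ cyl f = f ≫ inr f := by
  ext n a
  exact MapCyl.ext rfl rfl fun h _ ↦ (h rfl).elim

lemma cover (n) (x : (mapCyl f).obj n) :
    (∃ a, (cyl f).app n a = x) ∨ ∃ a, (inr f).app n a = x := by
  by_cases h : MapCyl.pos x = stdSimplex.const 1 1 n
  · exact Or.inr ⟨MapCyl.base x, MapCyl.ext rfl h.symm fun h' _ ↦ (h' rfl).elim⟩
  · exact Or.inl ⟨(MapCyl.lft x h, MapCyl.pos x),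
      MapCyl.ext (MapCyl.lft_base x h) rfl fun _ _ ↦ rfl⟩

variable {f} in
lemma exists_desc {Z : SSet.{u}} (h : A ⊗ Δ[1] ⟶ Z) (v : A' ⟶ Z) (e : inc 1 ≫ h = f ≫ v) :
    ∃ d : mapCyl f ⟶ Z, cyl f ≫ d = h ∧ inr f ≫ d = v := by
  have top : ∀ n (a : (A ⊗ Δ[1]).obj n), a.2 = stdSimplex.const 1 1 n →
      h.app n a = v.app n (f.app n a.1) := by
    intro n a ha
    have : a = (inc 1).app n a.1 := Prod.ext rfl ha
    rw [this]
    exact ConcreteCategory.congr_hom (NatTrans.congr_app e n) a.1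
  refine exists_desc_of_cover (cyl f) (inr f) h v (cover f) ?_ ?_ ?_
  · intro n a b hab
    have h1 : f.app n a.1 = f.app n b.1 := congrArg MapCyl.base hab
    have h2 : a.2 = b.2 := congrArg MapCyl.pos hab
    by_cases hp : a.2 = stdSimplex.const 1 1 n
    · rw [top n a hp, top n b (h2 ▸ hp), h1]
    · have key : ∀ c d : MapCyl f n, c = d → ∀ p p', c.lft p = d.lft p' := by
        rintro c _ rfl p p'; rfl
      have h3 : a.1 = b.1 := key _ _ hab hp (fun h' ↦ hp (h2.trans h'))
      rw [show a = b from Prod.ext h3 h2]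
  · intro n a b hab
    have h1 : f.app n a.1 = b := congrArg MapCyl.base hab
    have h2 : a.2 = stdSimplex.const 1 1 n := congrArg MapCyl.pos hab
    rw [top n a h2, h1]
  · intro n a b hab
    rw [show a = b from congrArg MapCyl.base hab]

lemma hom_ext {Z : SSet.{u}} {d d' : mapCyl f ⟶ Z} (h₁ : cyl f ≫ d = cyl f ≫ d')
    (h₂ : inr f ≫ d = inr f ≫ d') : d = d' :=
  hom_eq_of_cover _ _ (cover f) h₁ h₂

instance : Mono (inr f) := mono_of_app_injective _ fun _ _ _ h ↦ congrArg MapCyl.base h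

instance : Mono (inc 0 ≫ cyl f) := mono_of_app_injective _ fun n a b h ↦ by
  have key : ∀ c d : MapCyl f n, c = d → ∀ p p', c.lft p = d.lft p' := by
    rintro c _ rfl p p'; rfl
  have ne : stdSimplex.const 1 0 n ≠ (stdSimplex.const 1 1 n : (Δ[1] : SSet.{u}).obj n) := by
    intro e
    have := congrArg (fun z : (Δ[1] : SSet.{u}).obj n ↦ (stdSimplex.objEquiv z).toOrderHom 0) e
    exact absurd this (by change ¬ ((0 : Fin 2) = 1); decide)
  exact key _ _ h ne ne

/-- Homotopy lifting from the end `1` of the cylinder on `A` descends to the mapping cylinder, since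
that end is glued to `A'`. -/
lemma isKanAnodyne_inr : IsKanAnodyne (inr f) := by
  refine IsKanAnodyne.of_exists inferInstance fun E B p _ _ _ u v huv ↦ ?_
  obtain ⟨H, h1, h2⟩ := exists_lift_homotopy p 1 (f ≫ u) (cyl f ≫ v) (by
    rw [Category.assoc, huv, ← Category.assoc, ← inc_one_cyl, Category.assoc])
  obtain ⟨d, d1, d2⟩ := exists_desc H u h1
  refine ⟨d, d2, hom_ext f ?_ ?_⟩
  · rw [← Category.assoc, d1, h2]
  · rw [← Category.assoc, d2, huv]

/-- The front end is homotopic to `f ≫ inr f` through the cylinder itself. -/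
lemma isKanAnodyne_inl {f : A ⟶ A'} (hf : IsKanEquivalence f) : IsKanAnodyne (inc 0 ≫ cyl f) := by
  apply IsKanAnodyne.of_isKanEquivalence
  refine IsKanEquivalence.of_htpy' (f' := f ≫ inr f) (hf.comp (isKanAnodyne_inr f).isKanEquivalence)
    ⟨cyl f, rfl, inc_one_cyl f⟩

lemma lft_congr {f : A ⟶ A'} {n} {c d : MapCyl f n} (h : c = d) (p p') : c.lft p = d.lft p' := by
  subst h
  rfl

/-- Relative lifting for a map of Kan equivalences. -/
lemma exists_extension (i : A ⟶ B) [Mono i] (i' : A' ⟶ B') [Mono i'] {f : A ⟶ A'} {g : B ⟶ B'}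
    (comm : i ≫ g = f ≫ i') (hf : IsKanEquivalence f) (hg : IsKanEquivalence g)
    {E E₀ : SSet.{u}} (p : E ⟶ E₀) [Fibration p] [KanComplex E] [KanComplex E₀]
    (u : B ⟶ E) (v : A' ⟶ E) (h : A ⊗ Δ[1] ⟶ E) (h0 : inc 0 ≫ h = i ≫ u)
    (h1 : inc 1 ≫ h = f ≫ v) (v₀ : B' ⟶ E₀) (k : B ⊗ Δ[1] ⟶ E₀) (k0 : inc 0 ≫ k = u ≫ p)
    (k1 : inc 1 ≫ k = g ≫ v₀) (hv : v ≫ p = i' ≫ v₀) (hk : h ≫ p = i ▷ _ ≫ k) :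
    ∃ (v' : B' ⟶ E) (h' : B ⊗ Δ[1] ⟶ E), inc 0 ≫ h' = u ∧ inc 1 ≫ h' = g ≫ v' ∧
      i' ≫ v' = v ∧ i ▷ _ ≫ h' = h ∧ v' ≫ p = v₀ ∧ h' ≫ p = k := by
  obtain ⟨c, hc1, hc2⟩ := exists_desc (f := f) (i ▷ _ ≫ cyl g) (i' ≫ inr g) (by
    rw [inc_comp_assoc, inc_one_cyl, reassoc_of% comm])
  have capp : ∀ n (x : MapCyl f n), MapCyl.base (f := g) (c.app n x) = i'.app n x.base ∧
      MapCyl.pos (f := g) (c.app n x) = x.pos ∧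
      ∀ e e', MapCyl.lft (f := g) (c.app n x) e = i.app n (x.lft e') := by
    intro n x
    obtain ⟨a, rfl⟩ | ⟨a, rfl⟩ := cover f n x
    · have : c.app n ((cyl f).app n a) = (cyl g).app n ((i ▷ _).app n a) :=
        ConcreteCategory.congr_hom (NatTrans.congr_app hc1 n) a
      rw [this]
      obtain ⟨a, t⟩ := a
      have h : g.app n (i.app n a) = i'.app n (f.app n a) :=
        ConcreteCategory.congr_hom (NatTrans.congr_app comm n) a
      exact ⟨h, rfl, fun _ _ ↦ rfl⟩
    · have : c.app n ((inr f).app n a) = (inr g).app n (i'.app n a) :=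
        ConcreteCategory.congr_hom (NatTrans.congr_app hc2 n) a
      rw [this]
      exact ⟨rfl, rfl, fun e ↦ (e rfl).elim⟩
  have cinj : ∀ n (x y : MapCyl f n), c.app n x = c.app n y → x = y := by
    intro n x y e
    obtain ⟨x1, x2, x3⟩ := capp n x
    obtain ⟨y1, y2, y3⟩ := capp n y
    refine MapCyl.ext (app_injective_of_mono i' n ?_) ?_ fun e1 e2 ↦ app_injective_of_mono i n ?_
    · rw [← x1, ← y1, e]
    · rw [← x2, ← y2, e]
    · rw [← x3 (x2 ▸ e1) e1, ← y3 (y2 ▸ e2) e2]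
      exact lft_congr e _ _
  let b : B ⟶ mapCyl g := inc 0 ≫ cyl g
  -- The data `u`, `h`, `v` are a map on this union of the front end `B` with the mapping cylinder
  -- of `f`, while `k` and `v₀` are a map from the whole mapping cylinder of `g` to the base. The
  -- claim is a lift against `p` from the union to the whole.
  let S : (mapCyl g).Subcomplex := Subcomplex.range b ⊔ Subcomplex.range c
  let sb : B ⟶ S := Subcomplex.lift b le_sup_left
  let sc : mapCyl f ⟶ S := Subcomplex.lift c le_sup_right
  have scov : ∀ n (x : (S : SSet.{u}).obj n), (∃ a, sb.app n a = x) ∨ ∃ a, sc.app n a = x := by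
    rintro n ⟨x, ⟨y, hy⟩ | ⟨y, hy⟩⟩
    · exact Or.inl ⟨y, Subtype.ext hy⟩
    · exact Or.inr ⟨y, Subtype.ext hy⟩
  have ne : ∀ n, stdSimplex.const 1 0 n ≠ (stdSimplex.const 1 1 n : (Δ[1] : SSet.{u}).obj n) := by
    intro n e
    have := congrArg (fun z : (Δ[1] : SSet.{u}).obj n ↦ (stdSimplex.objEquiv z).toOrderHom 0) e
    exact absurd this (by change ¬ ((0 : Fin 2) = 1); decide)
  have ibc : i ≫ b = (inc 0 ≫ cyl f) ≫ c := by
    rw [Category.assoc, hc1, inc_comp_assoc]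
  have glue : ∀ {Z : SSet.{u}} (x : B ⟶ Z) (y : mapCyl f ⟶ Z), i ≫ x = (inc 0 ≫ cyl f) ≫ y →
      ∃ d : (S : SSet.{u}) ⟶ Z, sb ≫ d = x ∧ sc ≫ d = y := by
    intro Z x y hxy
    refine exists_desc_of_cover sb sc x y scov ?_ ?_ ?_
    · intro n a a' e
      rw [show a = a' from app_injective_of_mono (inc 0 ≫ cyl g) n (congrArg Subtype.val e)]
    · intro n a y' e
      have e' : b.app n a = c.app n y' := congrArg Subtype.val e
      obtain ⟨y1, y2, y3⟩ := capp n y'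
      have p1 : y'.pos = stdSimplex.const 1 0 n := by
        rw [← y2, ← e']; rfl
      have q1 : y'.pos ≠ stdSimplex.const 1 1 n := p1 ▸ ne n
      have q2 := y3 (by rw [y2]; exact q1) q1
      have a1 : a = i.app n (y'.lft q1) := by
        rw [← q2]; exact lft_congr (c := (cyl g).app n ((inc 0).app n a)) e' (ne n) _
      have y4 : y' = (inc 0 ≫ cyl f).app n (y'.lft q1) :=
        MapCyl.ext (y'.lft_base q1).symm p1 fun _ _ ↦ rfl
      rw [a1]
      conv_rhs => rw [y4]
      exact ConcreteCategory.congr_hom (NatTrans.congr_app hxy n) _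
    · intro n a a' e
      rw [cinj n a a' (congrArg Subtype.val e)]
  -- The inclusion of `B` in the union is a pushout of the front inclusion of the mapping cylinder
  -- of `f`.
  have sbA : IsKanAnodyne sb := by
    have : Mono sb := mono_of_mono_fac (show sb ≫ S.ι = b from rfl)
    refine IsKanAnodyne.of_exists this fun E B p _ _ _ u v huv ↦ ?_
    obtain ⟨w, w1, w2⟩ := (isKanAnodyne_inl hf).exists_lift p (i ≫ u) (sc ≫ v) (by
      rw [Category.assoc, huv]
      exact congrArg (· ≫ v) (show i ≫ sb = (inc 0 ≫ cyl f) ≫ sc from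
        (cancel_mono S.ι).1 ibc))
    obtain ⟨d, d1, d2⟩ := glue u w w1.symm
    refine ⟨d, d1, hom_eq_of_cover sb sc scov ?_ ?_⟩
    · rw [reassoc_of% d1, huv]
    · rw [reassoc_of% d2, w2]
  -- Two out of three: the front end `B` is Kan equivalent both to the union and to the mapping
  -- cylinder of `g`.
  have hS : IsKanAnodyne S.ι := IsKanAnodyne.of_isKanEquivalence
    (sbA.isKanEquivalence.of_comp_left (isKanAnodyne_inl hg).isKanEquivalence)
  obtain ⟨y, y1, y2⟩ := exists_desc (f := f) h v h1
  obtain ⟨d, d1, d2⟩ := glue u y (by rw [Category.assoc, y1, h0])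
  obtain ⟨z, z1, z2⟩ := exists_desc (f := g) k v₀ k1
  obtain ⟨w, w1, w2⟩ := hS.exists_lift p d z (by
    refine hom_eq_of_cover sb sc scov ?_ ?_
    · rw [reassoc_of% d1, ← k0, ← z1]
      rfl
    · rw [reassoc_of% d2]
      change _ = c ≫ z
      refine hom_ext f ?_ ?_
      · rw [reassoc_of% y1, reassoc_of% hc1, z1, hk]
      · rw [reassoc_of% y2, reassoc_of% hc2, z2, hv])
  have cw : c ≫ w = y := by
    rw [← d2, ← w1]; rfl
  refine ⟨inr g ≫ w, cyl g ≫ w, ?_, ?_, ?_, ?_, ?_, ?_⟩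
  · rw [← d1, ← w1]; rfl
  · rw [← Category.assoc, inc_one_cyl, Category.assoc]
  · rw [← Category.assoc, ← hc2, Category.assoc, cw, y2]
  · rw [← Category.assoc, ← hc1, Category.assoc, cw, y1]
  · rw [Category.assoc, w2, z2]
  · rw [Category.assoc, w2, z1]

end mapCyl

/-! ### Path spaces, and extension along equivalences of Kan complexes -/

section paths

variable {X Y Z : SSet.{u}}

/-- Evaluation of paths at an end. -/
noncomputable def pathEval (Z : SSet.{u}) (e : Fin 2) : (ihom Δ[1]).obj Z ⟶ Z :=
  lift (const (stdSimplex.obj₀Equiv.{u}.symm e)) (𝟙 _) ≫ (ihom.ev Δ[1]).app Z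

/-- The map to the path space which is adjoint to a homotopy. -/
noncomputable def pathCurry (k : X ⊗ Δ[1] ⟶ Z) : X ⟶ (ihom Δ[1]).obj Z :=
  MonoidalClosed.curry ((β_ Δ[1] X).hom ≫ k)

/-- The homotopy which is adjoint to a map to the path space. -/
noncomputable def pathUncurry (w : X ⟶ (ihom Δ[1]).obj Z) : X ⊗ Δ[1] ⟶ Z :=
  (β_ X Δ[1]).hom ≫ MonoidalClosed.uncurry w

lemma pathUncurry_curry (k : X ⊗ Δ[1] ⟶ Z) : pathUncurry (pathCurry k) = k := by
  rw [pathUncurry, pathCurry, MonoidalClosed.uncurry_curry]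
  rfl

lemma pathCurry_uncurry (w : X ⟶ (ihom Δ[1]).obj Z) : pathCurry (pathUncurry w) = w := by
  rw [pathUncurry, pathCurry]
  exact MonoidalClosed.curry_uncurry w

lemma inc_pathUncurry (w : X ⟶ (ihom Δ[1]).obj Z) (e : Fin 2) :
    inc e ≫ pathUncurry w = w ≫ pathEval Z e := by
  rw [pathUncurry, MonoidalClosed.uncurry_eq]
  rfl

lemma pathCurry_eval (k : X ⊗ Δ[1] ⟶ Z) (e : Fin 2) :
    pathCurry k ≫ pathEval Z e = inc e ≫ k := by
  rw [← inc_pathUncurry, pathUncurry_curry]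

lemma comp_pathCurry (i : Y ⟶ X) (k : X ⊗ Δ[1] ⟶ Z) :
    i ≫ pathCurry k = pathCurry (i ▷ _ ≫ k) := by
  rw [pathCurry, ← MonoidalClosed.curry_natural_left]
  rfl

lemma pathUncurry_comp (i : Y ⟶ X) (w : X ⟶ (ihom Δ[1]).obj Z) :
    pathUncurry (i ≫ w) = i ▷ _ ≫ pathUncurry w := by
  obtain ⟨k, rfl⟩ : ∃ k, w = pathCurry k := ⟨_, (pathCurry_uncurry w).symm⟩
  rw [comp_pathCurry, pathUncurry_curry, pathUncurry_curry]

end paths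

/-- Extension of homotopy lifts along a homotopy equivalence of Kan complexes. -/
lemma IsKanEquivalence.exists_extension {E E₀ : SSet.{u}} [KanComplex E] [KanComplex E₀]
    {φ : E ⟶ E₀} (hφ : IsKanEquivalence φ) {A X : SSet.{u}} (i : A ⟶ X) [Mono i]
    (c : A ⟶ E) (d : X ⟶ E₀) (k : A ⊗ Δ[1] ⟶ E₀) (k0 : inc 0 ≫ k = c ≫ φ)
    (k1 : inc 1 ≫ k = i ≫ d) :
    ∃ (c' : X ⟶ E) (k' : X ⊗ Δ[1] ⟶ E₀), i ≫ c' = c ∧ i ▷ _ ≫ k' = k ∧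
      inc 0 ≫ k' = c' ≫ φ ∧ inc 1 ≫ k' = d := by
  -- The mapping path space factors `φ` as a section `t` of the trivial fibration `r`, followed by
  -- the endpoint map `q`. A lift against `q` consists of the extension `c'` and the homotopy `k'`
  -- at once.
  let N := pullback φ (pathEval E₀ 0)
  let r : N ⟶ E := pullback.fst _ _
  let l : N ⟶ (ihom Δ[1]).obj E₀ := pullback.snd _ _
  let q : N ⟶ E₀ := l ≫ pathEval E₀ 1
  have hrl : r ≫ φ = l ≫ pathEval E₀ 0 := pullback.condition
  have ext {T : SSet.{u}} {a b : T ⟶ N} (h1 : a ≫ r = b ≫ r) (h2 : a ≫ l = b ≫ l) : a = b :=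
    pullback.hom_ext h1 h2
  have mk {T : SSet.{u}} (a : T ⟶ E) (k : T ⊗ Δ[1] ⟶ E₀) (h : inc 0 ≫ k = a ≫ φ) :
      ∃ b : T ⟶ N, b ≫ r = a ∧ b ≫ l = pathCurry k :=
    ⟨pullback.lift a (pathCurry k) (by rw [pathCurry_eval, h]), pullback.lift_fst _ _ _,
      pullback.lift_snd _ _ _⟩
  have hr : IsTrivialFib r := by
    intro A X i hi
    refine hasLiftingProperty_of_exists fun u v huv ↦ ?_
    obtain ⟨H, h1, h2⟩ := exists_extend_cylinder i 0 (pathUncurry (u ≫ l)) (v ≫ φ) (by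
      rw [inc_pathUncurry, Category.assoc, ← hrl, reassoc_of% huv])
    obtain ⟨w, w1, w2⟩ := mk v H h2
    refine ⟨w, ext ?_ ?_, w1⟩
    · rw [Category.assoc, w1, huv]
    · rw [Category.assoc, w2, comp_pathCurry, h1, pathCurry_uncurry]
  have : Fibration r := by
    rw [modelCategoryQuillen.fibration_iff]
    exact fun A X i hi ↦ hr i (modelCategoryQuillen.J_le_monomorphisms i hi)
  have : KanComplex N := isFibrant_of_fibration r
  have : Fibration q := by
    rw [modelCategoryQuillen.fibration_iff]
    intro A X i hi
    have hm : Mono i := modelCategoryQuillen.J_le_monomorphisms i hi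
    have ha : IsKanAnodyne i := IsKanAnodyne.of_anodyneExtensions (by
      rw [anodyneExtensions_eq_llp_rlp]
      exact MorphismProperty.le_llp_rlp _ _ hi)
    refine hasLiftingProperty_of_exists fun u v huv ↦ ?_
    obtain ⟨c, hc⟩ := ha.exists_extension (u ≫ r)
    obtain ⟨H, h1, h2⟩ := ha.exists_extension_homotopy (Fin.cons (c ≫ φ) fun _ ↦ v)
      (pathUncurry (u ≫ l)) (Fin.forall_fin_two.2 ⟨by
        rw [inc_pathUncurry, Category.assoc, ← hrl, ← Category.assoc, ← hc]
        exact Category.assoc _ _ _, by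
        rw [inc_pathUncurry, Category.assoc]; exact huv⟩)
    obtain ⟨w, w1, w2⟩ := mk c H (h2 0)
    refine ⟨w, ext ?_ ?_, ?_⟩
    · rw [Category.assoc, w1, hc]
    · rw [Category.assoc, w2, comp_pathCurry, h1, pathCurry_uncurry]
    · rw [← Category.assoc, w2, pathCurry_eval, h2]; rfl
  obtain ⟨t, t1, t2⟩ := mk (𝟙 E) (fst _ _ ≫ φ) (by rw [inc_fst_assoc, Category.id_comp])
  have ht : IsKanEquivalence t := hr.isKanEquivalence.of_comp_right (by
    rw [t1]; exact IsKanEquivalence.id E)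
  -- Since `t` and `t ≫ q = φ` are Kan equivalences, so is the fibration `q`.
  have hq : IsTrivialFib q := IsTrivialFib.of_fibration (ht.of_comp_left (by
    rwa [show t ≫ q = φ by rw [← Category.assoc, t2, pathCurry_eval, inc_fst_assoc]]))
  obtain ⟨a, a1, a2⟩ := mk c k k0
  obtain ⟨w, w1, w2⟩ := exists_lift_of_hasLiftingProperty (hq i inferInstance) a d (by
    rw [← Category.assoc, a2, pathCurry_eval, k1])
  refine ⟨w ≫ r, pathUncurry (w ≫ l), ?_, ?_, ?_, ?_⟩
  · rw [reassoc_of% w1, a1]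
  · rw [← pathUncurry_comp, reassoc_of% w1, a2, pathUncurry_curry]
  · rw [inc_pathUncurry, Category.assoc, ← hrl, Category.assoc]
  · rw [inc_pathUncurry, Category.assoc, w2]

end SSet

/-! ### Nerves of preorders, labelled simplices, and the last vertex map -/

namespace SSet
open HomotopicalAlgebra Opposite Limits
open scoped SSet.modelCategoryQuillen

/-- The nerve of a preorder. -/
def ordNerve (P : Type u) [Preorder P] : SSet.{u} where
  obj m := Fin (m.unop.len + 1) →o P
  map α := ↾fun c ↦ c.comp α.unop.toOrderHom
  map_id _ := by rfl
  map_comp _ _ := by rfl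

namespace ordNerve

variable {P Q R : Type u} [Preorder P] [Preorder Q] [Preorder R]

/-- The map of nerves induced by a monotone map. -/
def map (f : P →o Q) : ordNerve P ⟶ ordNerve Q where
  app _ := ↾fun c ↦ f.comp c
  naturality _ _ _ := rfl

lemma map_comp (f : P →o Q) (g : Q →o R) : map (g.comp f) = map f ≫ map g := rfl

/-- The chain underlying a simplex of the nerve. -/
def seq {n : SimplexCategoryᵒᵖ} (x : (ordNerve P).obj n) :
    Fin (n.unop.len + 1) →o P := x

lemma simplex_ext {n} {x y : (ordNerve P).obj n} (h : ∀ i, seq x i = seq y i) : x = y :=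
  OrderHom.ext _ _ (funext h)

lemma hom_app_ext {X : SSet.{u}} {f g : X ⟶ ordNerve P}
    (h : ∀ n (x : X.obj n) i, seq (f.app n x) i = seq (g.app n x) i) : f = g := by
  ext n x
  exact simplex_ext (h n x)

/-- Apply `f` at vertices over `0` and `g` at vertices over `1`. The last clause, that the whole
homotopy stays above `f`, is what lets `isKanEquivalence_of_frontPairs_fst` lift such a homotopy to
`frontPairs`. -/
lemma exists_homotopy_of_le {f g : P →o Q} (h : ∀ x, f x ≤ g x) :
    ∃ H : ordNerve P ⊗ Δ[1] ⟶ ordNerve Q, inc 0 ≫ H = map f ∧ inc 1 ≫ H = map g ∧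
      ∀ n (c : (ordNerve P ⊗ Δ[1] : SSet.{u}).obj n) i, f (seq c.1 i) ≤ seq (H.app n c) i := by
  let H : ordNerve P ⊗ Δ[1] ⟶ ordNerve Q :=
    { app := fun _ ↦ ↾fun c ↦
        ({ toFun := fun i ↦ if (stdSimplex.objEquiv c.2).toOrderHom i = 0 then f (seq c.1 i)
              else g (seq c.1 i)
           monotone' := by
            intro i j hij
            have h1 := (seq c.1).monotone hij
            have h2 := (stdSimplex.objEquiv c.2).toOrderHom.monotone hij
            dsimp only
            split_ifs with h3 h4 h4
            · exact f.monotone h1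
            · exact (f.monotone h1).trans (h _)
            · rw [h4] at h2
              exact absurd (le_antisymm h2 (Fin.zero_le _)) h3
            · exact g.monotone h1 } : Fin _ →o Q)
      naturality := fun _ _ _ ↦ rfl }
  refine ⟨H, hom_app_ext fun n x i ↦ rfl, hom_app_ext fun n x i ↦ rfl, fun n c i ↦ ?_⟩
  change f (seq c.1 i) ≤ if _ then _ else _
  split_ifs
  · exact le_rfl
  · exact h _

lemma htpy_of_le {f g : P →o Q} (h : ∀ x, f x ≤ g x) : Htpy (map f) (map g) := by
  obtain ⟨H, h0, h1, -⟩ := exists_homotopy_of_le h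
  exact ⟨H, h0, h1⟩

end ordNerve

lemma isKanEquivalence_const_of_htpy {X : SSet.{u}} (x : X _⦋0⦌)
    (h : IsKanEquivalence (const x : X ⟶ X)) (f : X ⟶ Δ[0]) : IsKanEquivalence f := by
  have e : f ≫ (const x : Δ[0] ⟶ X) = const x := rfl
  refine IsKanEquivalence.of_inverse (g := const x) (e ▸ h) ?_
  rw [stdSimplex.isTerminalObj₀.hom_ext (const x ≫ f) (𝟙 _)]
  exact IsKanEquivalence.id _

lemma stdSimplex.isKanEquivalence_toPoint (n : ℕ) (f : (Δ[n] : SSet.{u}) ⟶ Δ[0]) :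
    IsKanEquivalence f := by
  refine isKanEquivalence_const_of_htpy (stdSimplex.obj₀Equiv.symm (Fin.last n)) ?_ f
  refine (IsKanEquivalence.id _).of_htpy ?_
  let H : (Δ[n] : SSet.{u}) ⊗ Δ[1] ⟶ Δ[n] :=
    { app := fun m ↦ ↾fun c ↦ stdSimplex.objMk
        ({ toFun := fun i ↦ if (stdSimplex.objEquiv c.2).toOrderHom i = 0 then
              (stdSimplex.objEquiv c.1).toOrderHom i else Fin.last n
           monotone' := by
            intro i j hij
            have h1 := (stdSimplex.objEquiv c.1).toOrderHom.monotone hij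
            have h2 := (stdSimplex.objEquiv c.2).toOrderHom.monotone hij
            dsimp only
            split_ifs with h3 h4 h4
            · exact h1
            · exact Fin.le_last _
            · rw [h4] at h2
              exact absurd (le_antisymm h2 (Fin.zero_le _)) h3
            · exact le_rfl })
      naturality := fun _ _ _ ↦ rfl }
  refine ⟨H, ?_, ?_⟩
  · ext m x
    refine stdSimplex.objEquiv.injective ?_
    ext i : 3
    rfl
  · ext m x
    refine stdSimplex.objEquiv.injective ?_
    ext i : 3
    rfl

/-- Simplices with vertices labelled increasingly by natural numbers. -/
structure LabSimplex (X : SSet.{u}) : Type u where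
  /-- the dimension -/
  dim : ℕ
  /-- the labels -/
  lab : Fin (dim + 1) → ℕ
  strictMono : StrictMono lab
  /-- the simplex -/
  val : X _⦋dim⦌

namespace LabSimplex

variable {X Y : SSet.{u}}

lemma map_op_id {d : ℕ} (v : X _⦋d⦌) : X.map (𝟙 ⦋d⦌ : ⦋d⦌ ⟶ ⦋d⦌).op v = v :=
  ConcreteCategory.congr_hom (X.map_id _) v

/-- A morphism of labelled simplices. -/
structure IsHom (x y : LabSimplex X) (β : ⦋x.dim⦌ ⟶ ⦋y.dim⦌) : Prop where
  lab : ∀ i, x.lab i = y.lab (β.toOrderHom i)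
  val : X.map β.op y.val = x.val

/-- Labels increase strictly, so they determine the operator. For this reason labelled simplices
form a poset, and not merely a category, even when a simplex has repeated or degenerate faces. -/
lemma IsHom.eq {x y : LabSimplex X} {β β' : ⦋x.dim⦌ ⟶ ⦋y.dim⦌} (h : IsHom x y β)
    (h' : ∀ i, x.lab i = y.lab (β'.toOrderHom i)) : β = β' := by
  ext i : 3
  exact y.strictMono.injective ((h.lab i).symm.trans (h' i))

lemma IsHom.id (x : LabSimplex X) : IsHom x x (𝟙 _) :=
  ⟨fun _ ↦ rfl, ConcreteCategory.congr_hom (X.map_id _) _⟩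

lemma IsHom.comp {x y z : LabSimplex X} {β : ⦋x.dim⦌ ⟶ ⦋y.dim⦌} {γ : ⦋y.dim⦌ ⟶ ⦋z.dim⦌}
    (h : IsHom x y β) (h' : IsHom y z γ) : IsHom x z (β ≫ γ) :=
  ⟨fun i ↦ (h.lab i).trans (h'.lab _), by
    rw [op_comp, Functor.map_comp_apply, h'.val, h.val]⟩

lemma IsHom.injective {x y : LabSimplex X} {β : ⦋x.dim⦌ ⟶ ⦋y.dim⦌} (h : IsHom x y β) :
    Function.Injective β.toOrderHom := fun i j e ↦
  x.strictMono.injective (by rw [h.lab, h.lab, e])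

lemma IsHom.mono {x y : LabSimplex X} {β : ⦋x.dim⦌ ⟶ ⦋y.dim⦌} (h : IsHom x y β) : Mono β :=
  SimplexCategory.mono_iff_injective.2 h.injective

instance : PartialOrder (LabSimplex X) where
  le x y := ∃ β, IsHom x y β
  le_refl x := ⟨_, IsHom.id x⟩
  le_trans _ _ _ := fun ⟨_, h⟩ ⟨_, h'⟩ ↦ ⟨_, h.comp h'⟩
  le_antisymm x y := by
    rintro ⟨β, h⟩ ⟨γ, h'⟩
    have := h.mono
    have := h'.mono
    obtain ⟨d, l, hl, v⟩ := x
    obtain ⟨d', l', hl', v'⟩ := y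
    obtain rfl : d = d' := le_antisymm (SimplexCategory.len_le_of_mono β)
      (SimplexCategory.len_le_of_mono γ)
    obtain rfl : β = 𝟙 _ := SimplexCategory.eq_id_of_mono β
    obtain rfl : l = l' := funext h.lab
    obtain rfl : v' = v := (map_op_id v').symm.trans h.val
    rfl

lemma dim_strictMono : StrictMono (LabSimplex.dim : LabSimplex X → ℕ) := by
  intro x y hxy
  obtain ⟨β, h⟩ := hxy.le
  have := h.mono
  refine lt_of_le_of_ne (SimplexCategory.len_le_of_mono β) fun e ↦ hxy.ne ?_
  obtain ⟨d, l, hl, v⟩ := x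
  obtain ⟨d', l', hl', v'⟩ := y
  obtain rfl : d = d' := e
  obtain rfl : β = 𝟙 _ := SimplexCategory.eq_id_of_mono β
  obtain rfl : l = l' := funext h.lab
  obtain rfl : v' = v := (map_op_id v').symm.trans h.val
  rfl

/-- The operator witnessing that a labelled simplex is a face of another one. -/
noncomputable def hom {x y : LabSimplex X} (h : x ≤ y) : ⦋x.dim⦌ ⟶ ⦋y.dim⦌ := h.choose

lemma isHom_hom {x y : LabSimplex X} (h : x ≤ y) : IsHom x y (hom h) := h.choose_spec

lemma hom_eq {x y : LabSimplex X} (h : x ≤ y) {β : ⦋x.dim⦌ ⟶ ⦋y.dim⦌}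
    (hβ : ∀ i, x.lab i = y.lab (β.toOrderHom i)) : hom h = β := (isHom_hom h).eq hβ

lemma hom_comp {x y z : LabSimplex X} (h : x ≤ y) (h' : y ≤ z) :
    hom h ≫ hom h' = hom (h.trans h') :=
  ((isHom_hom h).comp (isHom_hom h')).eq (isHom_hom _).lab

/-- Functoriality of labelled simplices. -/
def map (f : X ⟶ Y) : LabSimplex X →o LabSimplex Y where
  toFun x := ⟨x.dim, x.lab, x.strictMono, f.app _ x.val⟩
  monotone' := by
    rintro x y ⟨β, h⟩
    refine ⟨β, h.lab, ?_⟩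
    change Y.map β.op (f.app _ y.val) = f.app _ x.val
    rw [← NatTrans.naturality_apply, h.val]

end LabSimplex

/-- The nerve of the poset of labelled simplices. -/
noncomputable def labNerve : SSet.{u} ⥤ SSet.{u} where
  obj X := ordNerve (LabSimplex X)
  map {X Y} f := ordNerve.map (P := LabSimplex X) (Q := LabSimplex Y) (LabSimplex.map f)
  map_id _ := rfl
  map_comp _ _ := rfl

namespace labNerve

variable {X Y : SSet.{u}}

/-- The last vertex operator of a chain. -/
noncomputable def lastOp {m : ℕ} (c : Fin (m + 1) →o LabSimplex X) :
    ⦋m⦌ ⟶ ⦋(c (Fin.last m)).dim⦌ :=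
  SimplexCategory.Hom.mk
    { toFun := fun i ↦ (LabSimplex.hom (c.monotone (Fin.le_last i))).toOrderHom (Fin.last _)
      monotone' := by
        intro i j hij
        dsimp only
        rw [← LabSimplex.hom_comp (c.monotone hij) (c.monotone (Fin.le_last j))]
        exact (LabSimplex.hom (c.monotone (Fin.le_last j))).toOrderHom.monotone (Fin.le_last _) }

lemma lab_lastOp {m : ℕ} (c : Fin (m + 1) →o LabSimplex X) (i : Fin (m + 1)) :
    (c (Fin.last m)).lab ((lastOp c).toOrderHom i) = (c i).lab (Fin.last _) :=
  ((LabSimplex.isHom_hom (c.monotone (Fin.le_last i))).lab _).symm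

lemma lastOp_eq {m : ℕ} (c : Fin (m + 1) →o LabSimplex X) (β : ⦋m⦌ ⟶ ⦋(c (Fin.last m)).dim⦌)
    (h : ∀ i, (c (Fin.last m)).lab (β.toOrderHom i) = (c i).lab (Fin.last _)) : lastOp c = β := by
  ext i : 3
  exact (c (Fin.last m)).strictMono.injective ((lab_lastOp c i).trans (h i).symm)

/-- The last vertex map. -/
noncomputable def last (X : SSet.{u}) : labNerve.obj X ⟶ X where
  app n := ↾fun (c : Fin (n.unop.len + 1) →o LabSimplex X) ↦
    X.map (lastOp c).op (c (Fin.last _)).val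
  naturality n n' α := by
    ext (c : Fin (n.unop.len + 1) →o LabSimplex X)
    let c' : Fin (n'.unop.len + 1) →o LabSimplex X := c.comp α.unop.toOrderHom
    change X.map (lastOp c').op (c' (Fin.last _)).val = X.map α (X.map (lastOp c).op _)
    have hle : c' (Fin.last _) ≤ c (Fin.last _) := c.monotone (Fin.le_last _)
    have e : lastOp c' ≫ LabSimplex.hom hle = α.unop ≫ lastOp c := by
      ext i : 3
      apply (c (Fin.last _)).strictMono.injective
      change (c (Fin.last _)).lab ((LabSimplex.hom hle).toOrderHom ((lastOp c').toOrderHom i)) =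
        (c (Fin.last _)).lab ((lastOp c).toOrderHom (α.unop.toOrderHom i))
      rw [lab_lastOp, ← (LabSimplex.isHom_hom hle).lab, lab_lastOp]
      rfl
    rw [← (LabSimplex.isHom_hom hle).val, ← Functor.map_comp_apply, ← op_comp, e, op_comp,
      Functor.map_comp_apply]
    rfl

lemma last_naturality (f : X ⟶ Y) : labNerve.map f ≫ last Y = last X ≫ f := by
  ext n (c : Fin (n.unop.len + 1) →o LabSimplex X)
  let c' : Fin (n.unop.len + 1) →o LabSimplex Y := (LabSimplex.map f).comp c
  change Y.map (lastOp c').op (f.app _ (c (Fin.last _)).val) =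
    f.app n (X.map (lastOp c).op (c (Fin.last _)).val)
  have e : lastOp c' = lastOp c := lastOp_eq c' _ (lab_lastOp c)
  rw [e]
  exact (NatTrans.naturality_apply f (lastOp c).op _).symm

instance mono_map (f : X ⟶ Y) [Mono f] : Mono (labNerve.map f) := by
  have inj : Function.Injective (LabSimplex.map f) := by
    rintro ⟨d, l, hl, v⟩ ⟨d', l', hl', v'⟩ h
    obtain rfl : d = d' := congrArg LabSimplex.dim h
    obtain rfl : l = l' := eq_of_heq (LabSimplex.mk.inj h).2.1
    obtain rfl : v = v' := app_injective_of_mono f _ (eq_of_heq (LabSimplex.mk.inj h).2.2)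
    rfl
  refine mono_of_app_injective _ fun n c c' h ↦ ordNerve.simplex_ext fun i ↦ inj ?_
  exact congrArg (fun z : Fin (n.unop.len + 1) →o LabSimplex Y ↦ z i) h

end labNerve

end SSet

/-! ### Cellular lifting, and functors determined by their values on simplices -/

namespace SSet
open HomotopicalAlgebra Opposite Limits
open scoped SSet.modelCategoryQuillen

section cells

variable {X T T' : SSet.{u}}

/-- Lifting over a simplicial set of bounded dimension. -/
lemma exists_lift_of_hasDimensionLT (q : T ⟶ T') (n : ℕ) [X.HasDimensionLT n]
    (hq : ∀ d < n, HasLiftingProperty (boundary.{u} d).ι q) (v : X ⟶ T') :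
    ∃ w : X ⟶ T, w ≫ q = v := by
  let i := (⊥ : X.Subcomplex).ι
  -- Induction over the skeleta relative to the empty subcomplex. Passing from `d` to `d + 1`
  -- attaches cells of dimension `d`, so only boundaries in dimensions below `n` occur.
  have key : ∀ d ≤ n, ∃ w : (skeletonOfMono i d : SSet.{u}) ⟶ T,
      w ≫ q = (skeletonOfMono i d).ι ≫ v := by
    intro d
    induction d with
    | zero =>
      intro _
      have h0 : skeletonOfMono i 0 = ⊥ := by
        rw [skeletonOfMono_zero]
        exact Subfunctor.range_ι _
      have f : (skeletonOfMono i 0 : SSet.{u}) ⟶ ((⊥ : X.Subcomplex) : SSet.{u}) :=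
        Subcomplex.homOfLE h0.le
      exact ⟨f ≫ Subcomplex.isInitialBot.to _, hom_bot_eq f _ _⟩
    | succ d ih =>
      intro hd
      obtain ⟨w, hw⟩ := ih (by omega)
      have hc (c : relativeCellComplexOfMono.Cell i d) :=
        exists_lift_of_hasLiftingProperty (hq d (by omega))
          (c.ιSigmaBoundary ≫ relativeCellComplexOfMono.t i d ≫ w) (c.map ≫ v) (by
            have := c.ι_t_ι_eq_ι_l_b_ι
            rw [c.ι_b_ι] at this
            rw [Category.assoc, Category.assoc, hw, ← Category.assoc, ← Category.assoc,
              Category.assoc c.ιSigmaBoundary, this, Category.assoc])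
      choose z hz1 hz2 using hc
      have po := relativeCellComplexOfMono.isPushout i d
      have comm : relativeCellComplexOfMono.t i d ≫ w =
          relativeCellComplexOfMono.l i d ≫ Sigma.desc z := by
        refine Sigma.hom_ext _ _ fun c ↦ ?_
        rw [← Category.assoc c.ιSigmaBoundary (relativeCellComplexOfMono.l i d), c.ι_l,
          Category.assoc, Sigma.ι_desc, hz1]
      refine ⟨po.desc w (Sigma.desc z) comm, po.hom_ext ?_ ?_⟩
      · rw [po.inl_desc_assoc, hw]
        rfl
      · rw [po.inr_desc_assoc]
        refine Sigma.hom_ext _ _ fun c ↦ ?_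
        rw [Sigma.ι_desc_assoc, hz2, ← c.ι_b_ι]
        simp only [Category.assoc]
  obtain ⟨w, hw⟩ := key n le_rfl
  have htop : skeletonOfMono i n = ⊤ := by
    rw [Subcomplex.eq_top_iff_of_hasDimensionLT _ n]
    intro d hd x hx
    rw [skeletonOfMono_obj_eq_top i hd]
    trivial
  let f : X ⟶ (skeletonOfMono i n : SSet.{u}) :=
    Subcomplex.lift (𝟙 X) (by rw [htop]; exact le_top)
  refine ⟨f ≫ w, ?_⟩
  rw [Category.assoc, hw]
  rfl

end cells

/-- A functor on simplicial sets which is determined by its values on simplices: each simplex of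
`Φ X` has an initial presentation. -/
def IsDense (Φ : SSet.{u} ⥤ SSet.{u}) : Prop :=
  ∀ (X : SSet.{u}) (m : SimplexCategoryᵒᵖ) (c : (Φ.obj X).obj m),
    ∃ (n : SimplexCategory) (x : X.obj (op n)) (a : (Φ.obj (stdSimplex.obj n)).obj m),
      (Φ.map (yonedaEquiv.symm x)).app m a = c ∧
      ∀ (n' : SimplexCategory) (x' : X.obj (op n')) (a' : (Φ.obj (stdSimplex.obj n')).obj m),
        (Φ.map (yonedaEquiv.symm x')).app m a' = c → ∃ β : n ⟶ n', X.map β.op x' = x ∧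
          (Φ.map (SSet.stdSimplex.map β)).app m a = a'

namespace IsDense

variable {Φ : SSet.{u} ⥤ SSet.{u}}

/-- Any presentation of a simplex of `Φ X` is the image of the initial one under an operator. By
compatibility, all presentations then give the same value. -/
lemma exists_desc (h : IsDense Φ) {X Z : SSet.{u}}
    (φ : ∀ (n : SimplexCategory) (_ : X.obj (op n)), Φ.obj (stdSimplex.obj n) ⟶ Z)
    (hφ : ∀ {m n : SimplexCategory} (α : m ⟶ n) (x : X.obj (op n)),
      φ m (X.map α.op x) = Φ.map (SSet.stdSimplex.map α) ≫ φ n x) :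
    ∃ d : Φ.obj X ⟶ Z, ∀ n x, Φ.map (yonedaEquiv.symm x) ≫ d = φ n x := by
  obtain ⟨d, hd⟩ := SSet.exists_desc (κ := Σ n : SimplexCategory, X.obj (op n))
    (fun k ↦ Φ.map (yonedaEquiv.symm k.2)) (fun k ↦ φ k.1 k.2)
    (fun m c ↦ by
      obtain ⟨n, x, a, e, -⟩ := h X m c
      exact ⟨⟨n, x⟩, a, e⟩) (by
      have key : ∀ m c, ∃ v : Z.obj m, ∀ (n : SimplexCategory) (x : X.obj (op n))
          (a : (Φ.obj (SSet.stdSimplex.obj n)).obj m),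
          (Φ.map (yonedaEquiv.symm x)).app m a = c → (φ n x).app m a = v := by
        intro m c
        obtain ⟨n₀, x₀, a₀, e₀, hu⟩ := h X m c
        refine ⟨(φ n₀ x₀).app m a₀, fun n x a e ↦ ?_⟩
        obtain ⟨β, rfl, rfl⟩ := hu n x a e
        rw [hφ]
        rfl
      rintro m ⟨n, x⟩ ⟨n', x'⟩ a b e
      obtain ⟨v, hv⟩ := key m ((Φ.map (yonedaEquiv.symm x')).app m b)
      exact (hv n x a e).trans (hv n' x' b rfl).symm)
  exact ⟨d, fun n x ↦ hd ⟨n, x⟩⟩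

lemma hom_ext (h : IsDense Φ) {X Z : SSet.{u}} {d d' : Φ.obj X ⟶ Z}
    (e : ∀ (n : SimplexCategory) (x : X.obj (op n)),
      Φ.map (yonedaEquiv.symm x) ≫ d = Φ.map (yonedaEquiv.symm x) ≫ d') : d = d' :=
  hom_eq_of_jointly_surjective (κ := Σ n : SimplexCategory, X.obj (op n))
    (fun k ↦ Φ.map (yonedaEquiv.symm k.2))
    (fun m c ↦ by
      obtain ⟨n, x, a, e, -⟩ := h X m c
      exact ⟨⟨n, x⟩, a, e⟩) fun k ↦ e k.1 k.2

lemma id : IsDense (𝟭 SSet.{u}) := by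
  intro X m c
  refine ⟨m.unop, c, stdSimplex.objEquiv.symm (𝟙 _), ?_, ?_⟩
  · change X.map (𝟙 m) c = c
    rw [X.map_id]
    rfl
  · intro n' x' a' h
    refine ⟨stdSimplex.objEquiv a', h, ?_⟩
    have e : 𝟙 m.unop ≫ stdSimplex.objEquiv a' = stdSimplex.objEquiv a' := Category.id_comp _
    exact stdSimplex.objEquiv.injective e

lemma tensor (h : IsDense Φ) (J : SSet.{u}) : IsDense (Φ ⋙ MonoidalCategory.tensorRight J) := by
  rintro X m ⟨c, j⟩
  obtain ⟨n, x, a, e, h⟩ := h X m c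
  refine ⟨n, x, (a, j), Prod.ext e rfl, fun n' x' ⟨a', j'⟩ e' ↦ ?_⟩
  obtain ⟨β, h1, h2⟩ := h n' x' a' (congrArg (fun z ↦ z.1) e')
  exact ⟨β, h1, Prod.ext h2 (congrArg (fun z ↦ z.2) e').symm⟩

/-- All members of a chain of labelled simplices are faces of its largest member, and that simplex
carries the initial presentation of the chain. -/
lemma labNerve : IsDense SSet.labNerve.{u} := by
  rintro X m (c : Fin (m.unop.len + 1) →o LabSimplex X)
  have hc := fun i ↦ LabSimplex.isHom_hom (c.monotone (Fin.le_last i))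
  let a : Fin (m.unop.len + 1) →o LabSimplex (Δ[(c (Fin.last _)).dim]) :=
    { toFun := fun i ↦ ⟨(c i).dim, (c i).lab, (c i).strictMono,
        stdSimplex.objEquiv.symm (LabSimplex.hom (c.monotone (Fin.le_last i)))⟩
      monotone' := fun i j hij ↦ by
        refine ⟨LabSimplex.hom (X := X) (c.monotone hij), (LabSimplex.isHom_hom (c.monotone hij)).lab, ?_⟩
        exact stdSimplex.objEquiv.injective
          (LabSimplex.hom_comp (c.monotone hij) (c.monotone (Fin.le_last j))) }
  refine ⟨⦋(c (Fin.last _)).dim⦌, (c (Fin.last _)).val, a, ?_, ?_⟩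
  · refine ordNerve.simplex_ext fun i ↦ ?_
    have : X.map (LabSimplex.hom (c.monotone (Fin.le_last i))).op (c (Fin.last _)).val =
      (c i).val := (hc i).val
    change LabSimplex.mk _ _ _ (X.map (LabSimplex.hom (c.monotone (Fin.le_last i))).op
      (c (Fin.last _)).val) = c i
    congr
  · intro n' x' (a' : Fin (m.unop.len + 1) →o LabSimplex (stdSimplex.obj n')) e
    obtain rfl : (LabSimplex.map (yonedaEquiv.symm x')).comp a' = c := e
    refine ⟨stdSimplex.objEquiv (a' (Fin.last _)).val, rfl, ?_⟩
    refine ordNerve.simplex_ext fun i ↦ ?_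
    have h1 := LabSimplex.isHom_hom (a'.monotone (Fin.le_last i))
    have h2 := (hc i).eq h1.lab
    have h3 : stdSimplex.objEquiv.symm (LabSimplex.hom (a'.monotone (Fin.le_last i)) ≫
      stdSimplex.objEquiv (a' (Fin.last _)).val) = (a' i).val := h1.val
    exact congrArg (LabSimplex.mk (a' i).dim (a' i).lab (a' i).strictMono) ((congrArg (fun β ↦
      stdSimplex.objEquiv.symm (β ≫ stdSimplex.objEquiv (a' (Fin.last _)).val)) h2).trans h3)

end IsDense

end SSet

/-! ### The universal lifting problem for the last vertex map -/

namespace SSet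
open HomotopicalAlgebra Opposite Limits
open scoped SSet.modelCategoryQuillen

lemma fibration_of_exists {E B : SSet.{u}} {p : E ⟶ B}
    (h : ∀ ⦃A X : SSet.{u}⦄ (i : A ⟶ X) (_ : anodyneExtensions i) (_ : Mono i) (u : A ⟶ E) (v : X ⟶ B),
      u ≫ p = i ≫ v → ∃ w : X ⟶ E, i ≫ w = u ∧ w ≫ p = v) : Fibration p := by
  rw [modelCategoryQuillen.fibration_iff]
  intro A X i hi
  refine hasLiftingProperty_of_exists fun u v huv ↦ h i ?_ ?_ u v huv
  · rw [anodyneExtensions_eq_llp_rlp]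
    exact MorphismProperty.le_llp_rlp _ _ hi
  · exact modelCategoryQuillen.J_le_monomorphisms i hi

lemma kanComplex_of_exists {Z : SSet.{u}}
    (h : ∀ ⦃A X : SSet.{u}⦄ (i : A ⟶ X) (_ : anodyneExtensions i) (_ : Mono i) (u : A ⟶ Z),
      ∃ w : X ⟶ Z, i ≫ w = u) : KanComplex Z := by
  refine (isFibrant_iff _).2 (fibration_of_exists fun A X i hi hm u v _ ↦ ?_)
  obtain ⟨w, hw⟩ := h i hi hm u
  exact ⟨w, hw, terminal.hom_ext _ _⟩

instance kanComplex_tensor (Z Z' : SSet.{u}) [KanComplex Z] [KanComplex Z'] :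
    KanComplex (Z ⊗ Z') := by
  refine kanComplex_of_exists fun A X i hi hm u ↦ ?_
  have ha := IsKanAnodyne.of_anodyneExtensions hi
  obtain ⟨a, ha1⟩ := ha.exists_extension (u ≫ fst _ _)
  obtain ⟨b, hb1⟩ := ha.exists_extension (u ≫ snd _ _)
  refine ⟨lift a b, ?_⟩
  rw [comp_lift, ha1, hb1, lift_comp_fst_snd]

/-- The endpoints of paths. -/
noncomputable def pathEnds (Z : SSet.{u}) : (ihom Δ[1]).obj Z ⟶ Z ⊗ Z :=
  lift (pathEval Z 0) (pathEval Z 1)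

instance fibration_pathEnds (Z : SSet.{u}) [KanComplex Z] : Fibration (pathEnds Z) := by
  refine fibration_of_exists fun A X i hi hm u v huv ↦ ?_
  have e0 : u ≫ pathEval Z 0 = i ≫ v ≫ fst _ _ := by
    have := huv =≫ fst _ _
    rwa [Category.assoc, Category.assoc, pathEnds, lift_fst] at this
  have e1 : u ≫ pathEval Z 1 = i ≫ v ≫ snd _ _ := by
    have := huv =≫ snd _ _
    rwa [Category.assoc, Category.assoc, pathEnds, lift_snd] at this
  obtain ⟨H, h1, h2⟩ := (IsKanAnodyne.of_anodyneExtensions hi).exists_extension_homotopy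
    (Fin.cons (v ≫ fst _ _) fun _ ↦ v ≫ snd _ _) (pathUncurry u) (Fin.forall_fin_two.2
      ⟨by rw [inc_pathUncurry]; exact e0, by rw [inc_pathUncurry]; exact e1⟩)
  refine ⟨pathCurry H, ?_, ?_⟩
  · rw [comp_pathCurry, h1, pathCurry_uncurry]
  · rw [pathEnds, comp_lift, pathCurry_eval, pathCurry_eval, h2, h2]
    exact lift_comp_fst_snd v

namespace labNerve

/-- Relative solvability of lifting problems up to the last vertex map. -/
def IsSolvable {A X E E₀ : SSet.{u}} (i : A ⟶ X) (p : E ⟶ E₀) : Prop :=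
  ∀ (u : labNerve.obj X ⟶ E) (v : A ⟶ E) (h : labNerve.obj A ⊗ Δ[1] ⟶ E) (v₀ : X ⟶ E₀)
    (k : labNerve.obj X ⊗ Δ[1] ⟶ E₀), inc 0 ≫ h = labNerve.map i ≫ u → inc 1 ≫ h = last A ≫ v →
    inc 0 ≫ k = u ≫ p → inc 1 ≫ k = last X ≫ v₀ → v ≫ p = i ≫ v₀ →
    h ≫ p = labNerve.map i ▷ _ ≫ k →
    ∃ (v' : X ⟶ E) (h' : labNerve.obj X ⊗ Δ[1] ⟶ E), inc 0 ≫ h' = u ∧ inc 1 ≫ h' = last X ≫ v' ∧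
      i ≫ v' = v ∧ labNerve.map i ▷ _ ≫ h' = h ∧ v' ≫ p = v₀ ∧ h' ≫ p = k

lemma map_stdSimplex_map_id (n : SimplexCategory) :
    labNerve.map (SSet.stdSimplex.map (𝟙 n)) = 𝟙 (labNerve.obj (SSet.stdSimplex.obj n)) :=
  (congrArg labNerve.map (SSet.stdSimplex.map_id n)).trans (labNerve.map_id _)

lemma whiskerRight_map_stdSimplex_map_id (n : SimplexCategory) (J : SSet.{u}) :
    labNerve.map (SSet.stdSimplex.map (𝟙 n)) ▷ J = 𝟙 (labNerve.obj (SSet.stdSimplex.obj n) ⊗ J) :=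
  (congrArg (· ▷ J) (map_stdSimplex_map_id n)).trans (id_whiskerRight _ _)

/-- Simplices of the simplicial set of maps up to the last vertex map. -/
@[ext]
structure Cocyl (E : SSet.{u}) (n : SimplexCategory) : Type u where
  /-- the strict map -/
  v : stdSimplex.obj n ⟶ E
  /-- the homotopy -/
  h : labNerve.obj (stdSimplex.obj n) ⊗ Δ[1] ⟶ E
  eq : inc 1 ≫ h = last _ ≫ v

/-- The simplicial set of maps with a homotopy from a map on labelled simplices. -/
noncomputable def cocyl (E : SSet.{u}) : SSet.{u} where
  obj n := Cocyl E n.unop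
  map α := ↾fun t ↦ (⟨SSet.stdSimplex.map α.unop ≫ t.v,
    labNerve.map (SSet.stdSimplex.map α.unop) ▷ _ ≫ t.h, by
      rw [inc_comp_assoc, t.eq, ← Category.assoc, last_naturality, Category.assoc]⟩ : Cocyl E _)
  map_id n := by
    refine ConcreteCategory.hom_ext _ _ fun t ↦ Cocyl.ext ?_ ?_
    · exact (congrArg (· ≫ t.v) (SSet.stdSimplex.map_id n.unop)).trans (Category.id_comp _)
    · exact (congrArg (· ≫ t.h) (whiskerRight_map_stdSimplex_map_id n.unop _)).trans
        (Category.id_comp _)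
  map_comp α β := by rfl

/-- Simplices of the base of the universal lifting problem. -/
@[ext]
structure CocylBase {E E₀ : SSet.{u}} (p : E ⟶ E₀) (n : SimplexCategory) : Type u where
  /-- the map on labelled simplices -/
  u : labNerve.obj (stdSimplex.obj n) ⟶ E
  /-- the strict map to the base -/
  v : stdSimplex.obj n ⟶ E₀
  /-- the homotopy in the base -/
  k : labNerve.obj (stdSimplex.obj n) ⊗ Δ[1] ⟶ E₀
  eq₀ : inc 0 ≫ k = u ≫ p
  eq₁ : inc 1 ≫ k = last _ ≫ v

/-- The base of the universal lifting problem. -/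
noncomputable def cocylBase {E E₀ : SSet.{u}} (p : E ⟶ E₀) : SSet.{u} where
  obj n := CocylBase p n.unop
  map α := ↾fun t ↦ (⟨labNerve.map (SSet.stdSimplex.map α.unop) ≫ t.u,
    SSet.stdSimplex.map α.unop ≫ t.v,
    labNerve.map (SSet.stdSimplex.map α.unop) ▷ _ ≫ t.k, by
      rw [inc_comp_assoc, t.eq₀, Category.assoc], by
      rw [inc_comp_assoc, t.eq₁, ← Category.assoc, last_naturality, Category.assoc]⟩ :
        CocylBase p _)
  map_id n := by
    refine ConcreteCategory.hom_ext _ _ fun t ↦ CocylBase.ext ?_ ?_ ?_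
    · exact (congrArg (· ≫ t.u) (map_stdSimplex_map_id n.unop)).trans (Category.id_comp _)
    · exact (congrArg (· ≫ t.v) (SSet.stdSimplex.map_id n.unop)).trans (Category.id_comp _)
    · exact (congrArg (· ≫ t.k) (whiskerRight_map_stdSimplex_map_id n.unop _)).trans
        (Category.id_comp _)
  map_comp α β := by rfl

/-- The universal lifting problem. -/
noncomputable def cocylMap {E E₀ : SSet.{u}} (p : E ⟶ E₀) : cocyl E ⟶ cocylBase p where
  app n := ↾fun (t : Cocyl E n.unop) ↦ (⟨inc 0 ≫ t.h, t.v ≫ p, t.h ≫ p, by rw [Category.assoc], by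
    rw [← Category.assoc, t.eq, Category.assoc]⟩ : CocylBase p n.unop)
  naturality n m α := by rfl

lemma whiskerRight_hom_ext {X Z J : SSet.{u}} {d d' : labNerve.obj X ⊗ J ⟶ Z}
    (e : ∀ (n : SimplexCategory) (x : X.obj (op n)),
      labNerve.map (yonedaEquiv.symm x) ▷ J ≫ d = labNerve.map (yonedaEquiv.symm x) ▷ J ≫ d') :
    d = d' :=
  (IsDense.labNerve.tensor J).hom_ext e

lemma yonedaEquiv_symm_map {X : SSet.{u}} {m n : SimplexCategory} (α : m ⟶ n) (x : X.obj (op n)) :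
    yonedaEquiv.symm (X.map α.op x) = SSet.stdSimplex.map α ≫ yonedaEquiv.symm x := by
  ext k t
  change X.map t.down.op (X.map α.op x) = X.map (t.down ≫ α).op x
  rw [op_comp, Functor.map_comp_apply]

lemma exists_of_hom_cocyl {X E : SSet.{u}} (τ : X ⟶ cocyl E) :
    ∃ (v : X ⟶ E) (h : labNerve.obj X ⊗ Δ[1] ⟶ E), inc 1 ≫ h = last X ≫ v ∧
      ∀ (n : SimplexCategory) (x : X.obj (op n)),
        Cocyl.v (τ.app _ x) = yonedaEquiv.symm x ≫ v ∧
        Cocyl.h (τ.app _ x) = labNerve.map (yonedaEquiv.symm x) ▷ _ ≫ h := by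
  have nat {m n : SimplexCategory} (α : m ⟶ n) (x : X.obj (op n)) :
      τ.app _ (X.map α.op x) = (cocyl E).map α.op (τ.app _ x) := NatTrans.naturality_apply _ _ _
  obtain ⟨v, hv⟩ := IsDense.id.exists_desc (X := X) (fun n x ↦ Cocyl.v (τ.app _ x))
    (fun α x ↦ by rw [nat]; rfl)
  obtain ⟨h, hh⟩ := (IsDense.labNerve.tensor Δ[1]).exists_desc (X := X)
    (fun n x ↦ Cocyl.h (τ.app _ x)) (fun α x ↦ by rw [nat]; rfl)
  refine ⟨v, h, IsDense.labNerve.hom_ext fun n x ↦ ?_, fun n x ↦ ⟨(hv n x).symm, (hh n x).symm⟩⟩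
  have h1 : labNerve.map (yonedaEquiv.symm x) ▷ Δ[1] ≫ h = Cocyl.h (τ.app _ x) := hh n x
  have h2 : yonedaEquiv.symm x ≫ v = Cocyl.v (τ.app _ x) := hv n x
  have h3 : inc 1 ≫ Cocyl.h (τ.app _ x) = last _ ≫ Cocyl.v (τ.app _ x) := Cocyl.eq _
  rw [← inc_comp_assoc, h1, h3, ← Category.assoc, last_naturality, Category.assoc, h2]

lemma exists_of_hom_cocylBase {X E E₀ : SSet.{u}} {p : E ⟶ E₀} (τ : X ⟶ cocylBase p) :
    ∃ (u : labNerve.obj X ⟶ E) (v : X ⟶ E₀) (k : labNerve.obj X ⊗ Δ[1] ⟶ E₀),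
      inc 0 ≫ k = u ≫ p ∧ inc 1 ≫ k = last X ≫ v ∧
      ∀ (n : SimplexCategory) (x : X.obj (op n)),
        CocylBase.u (τ.app _ x) = labNerve.map (yonedaEquiv.symm x) ≫ u ∧
        CocylBase.v (τ.app _ x) = yonedaEquiv.symm x ≫ v ∧
        CocylBase.k (τ.app _ x) = labNerve.map (yonedaEquiv.symm x) ▷ _ ≫ k := by
  have nat {m n : SimplexCategory} (α : m ⟶ n) (x : X.obj (op n)) :
      τ.app _ (X.map α.op x) = (cocylBase p).map α.op (τ.app _ x) := NatTrans.naturality_apply _ _ _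
  obtain ⟨u, hu⟩ := IsDense.labNerve.exists_desc (X := X) (fun n x ↦ CocylBase.u (τ.app _ x))
    (fun α x ↦ by rw [nat]; rfl)
  obtain ⟨v, hv⟩ := IsDense.id.exists_desc (X := X) (fun n x ↦ CocylBase.v (τ.app _ x))
    (fun α x ↦ by rw [nat]; rfl)
  obtain ⟨k, hk⟩ := (IsDense.labNerve.tensor Δ[1]).exists_desc (X := X)
    (fun n x ↦ CocylBase.k (τ.app _ x)) (fun α x ↦ by rw [nat]; rfl)
  have h1 (n) (x : X.obj (op n)) :
    labNerve.map (yonedaEquiv.symm x) ▷ Δ[1] ≫ k = CocylBase.k (τ.app _ x) := hk n x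
  have h2 (n) (x : X.obj (op n)) : yonedaEquiv.symm x ≫ v = CocylBase.v (τ.app _ x) := hv n x
  refine ⟨u, v, k, IsDense.labNerve.hom_ext fun n x ↦ ?_, IsDense.labNerve.hom_ext fun n x ↦ ?_,
    fun n x ↦ ⟨(hu n x).symm, (hv n x).symm, (hk n x).symm⟩⟩
  · have h3 : inc 0 ≫ CocylBase.k (τ.app _ x) = CocylBase.u (τ.app _ x) ≫ p := CocylBase.eq₀ _
    rw [← inc_comp_assoc, h1, h3, ← Category.assoc, hu]
  · have h3 : inc 1 ≫ CocylBase.k (τ.app _ x) = last _ ≫ CocylBase.v (τ.app _ x) :=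
      CocylBase.eq₁ _
    rw [← inc_comp_assoc, h1, h3, ← Category.assoc, last_naturality, Category.assoc, h2]

/-- A compatible pair as a map to the universal object. -/
noncomputable def toCocyl {X E : SSet.{u}} (v : X ⟶ E) (h : labNerve.obj X ⊗ Δ[1] ⟶ E)
    (e : inc 1 ≫ h = last X ≫ v) : X ⟶ cocyl E where
  app n := ↾fun x ↦ (⟨yonedaEquiv.symm x ≫ v, labNerve.map (yonedaEquiv.symm x) ▷ _ ≫ h, by
    rw [inc_comp_assoc, e, ← Category.assoc, last_naturality, Category.assoc]⟩ : Cocyl E n.unop)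
  naturality n m α := by
    ext x
    refine Cocyl.ext ?_ ?_
    · change yonedaEquiv.symm (X.map α.unop.op x) ≫ v = _
      rw [yonedaEquiv_symm_map]
      rfl
    · change labNerve.map (yonedaEquiv.symm (X.map α.unop.op x)) ▷ _ ≫ h = _
      rw [yonedaEquiv_symm_map]
      rfl

/-- A compatible triple as a map to the base of the universal lifting problem. -/
noncomputable def toCocylBase {X E E₀ : SSet.{u}} {p : E ⟶ E₀} (u : labNerve.obj X ⟶ E)
    (v : X ⟶ E₀) (k : labNerve.obj X ⊗ Δ[1] ⟶ E₀) (e₀ : inc 0 ≫ k = u ≫ p)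
    (e₁ : inc 1 ≫ k = last X ≫ v) : X ⟶ cocylBase p where
  app n := ↾fun x ↦ (⟨labNerve.map (yonedaEquiv.symm x) ≫ u, yonedaEquiv.symm x ≫ v,
    labNerve.map (yonedaEquiv.symm x) ▷ _ ≫ k, by rw [inc_comp_assoc, e₀, Category.assoc], by
    rw [inc_comp_assoc, e₁, ← Category.assoc, last_naturality, Category.assoc]⟩ :
      CocylBase p n.unop)
  naturality n m α := by
    ext x
    refine CocylBase.ext ?_ ?_ ?_
    · change labNerve.map (yonedaEquiv.symm (X.map α.unop.op x)) ≫ u = _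
      rw [yonedaEquiv_symm_map]
      rfl
    · change yonedaEquiv.symm (X.map α.unop.op x) ≫ v = _
      rw [yonedaEquiv_symm_map]
      rfl
    · change labNerve.map (yonedaEquiv.symm (X.map α.unop.op x)) ▷ _ ≫ k = _
      rw [yonedaEquiv_symm_map]
      rfl

/-- By density, maps into `cocyl E` and `cocylBase p` are the same as pairs `(v, h)` and triples
`(u, v₀, k)` on the source. A relative problem about the last vertex map thus becomes an ordinary
lifting problem, which can be treated cell by cell. The way back is needed only in the absolute
case, `exists_of_exists_lift`. -/
lemma hasLiftingProperty_of_isSolvable {A X E E₀ : SSet.{u}} {i : A ⟶ X} {p : E ⟶ E₀}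
    (hi : IsSolvable i p) : HasLiftingProperty i (cocylMap p) := by
  refine hasLiftingProperty_of_exists fun a b hab ↦ ?_
  obtain ⟨v, h, e, ha⟩ := exists_of_hom_cocyl a
  obtain ⟨u, v₀, k, e₀, e₁, hb⟩ := exists_of_hom_cocylBase b
  have hs (n) (x : A.obj (op n)) : (cocylMap p).app _ (a.app _ x) = b.app _ (i.app _ x) :=
    ConcreteCategory.congr_hom (NatTrans.congr_app hab (op n)) x
  have ys (n) (x : A.obj (op n)) : yonedaEquiv.symm (i.app _ x) = yonedaEquiv.symm x ≫ i :=
    (yonedaEquiv_symm_comp _ _).symm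
  have s1 (n) (x : A.obj (op n)) : inc 0 ≫ Cocyl.h (a.app _ x) =
    CocylBase.u (b.app _ (i.app _ x)) := congrArg CocylBase.u (hs n x)
  have s2 (n) (x : A.obj (op n)) : Cocyl.v (a.app _ x) ≫ p =
    CocylBase.v (b.app _ (i.app _ x)) := congrArg CocylBase.v (hs n x)
  have s3 (n) (x : A.obj (op n)) : Cocyl.h (a.app _ x) ≫ p =
    CocylBase.k (b.app _ (i.app _ x)) := congrArg CocylBase.k (hs n x)
  obtain ⟨v', h', t1, t2, t3, t4, t5, t6⟩ := hi u v h v₀ k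
    (IsDense.labNerve.hom_ext fun n x ↦ by
      have := s1 n x
      rw [(ha n x).2, (hb n _).1, ys, inc_comp_assoc, Functor.map_comp, Category.assoc] at this
      exact this) e e₀ e₁
    (IsDense.id.hom_ext fun n x ↦ by
      have := s2 n x
      rw [(ha n x).1, (hb n _).2.1, ys, Category.assoc, Category.assoc] at this
      exact this)
    (whiskerRight_hom_ext fun n x ↦ by
      have := s3 n x
      rw [(ha n x).2, (hb n _).2.2, ys, Functor.map_comp, comp_whiskerRight, Category.assoc,
        Category.assoc] at this
      exact this)
  refine ⟨toCocyl v' h' t2, ?_, ?_⟩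
  · ext n x
    refine Cocyl.ext ?_ ?_
    · refine Eq.trans ?_ (ha n.unop x).1.symm
      change yonedaEquiv.symm (i.app _ x) ≫ v' = _
      rw [← t3, ← Category.assoc, ← ys]
    · refine Eq.trans ?_ (ha n.unop x).2.symm
      change labNerve.map (yonedaEquiv.symm (i.app _ x)) ▷ _ ≫ h' = _
      rw [← t4, ys, Functor.map_comp, comp_whiskerRight, Category.assoc]
  · ext n x
    refine CocylBase.ext ?_ ?_ ?_
    · refine Eq.trans ?_ (hb n.unop x).1.symm
      change inc 0 ≫ labNerve.map (yonedaEquiv.symm x) ▷ _ ≫ h' = _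
      rw [inc_comp_assoc, t1]
    · refine Eq.trans ?_ (hb n.unop x).2.1.symm
      change (yonedaEquiv.symm x ≫ v') ≫ p = _
      rw [Category.assoc, t5]
    · refine Eq.trans ?_ (hb n.unop x).2.2.symm
      change (labNerve.map (yonedaEquiv.symm x) ▷ _ ≫ h') ≫ p = _
      rw [Category.assoc, t6]

lemma exists_of_exists_lift {X E E₀ : SSet.{u}} {p : E ⟶ E₀}
    (hX : ∀ v : X ⟶ cocylBase p, ∃ w : X ⟶ cocyl E, w ≫ cocylMap p = v)
    (u : labNerve.obj X ⟶ E) (v₀ : X ⟶ E₀) (k : labNerve.obj X ⊗ Δ[1] ⟶ E₀)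
    (e₀ : inc 0 ≫ k = u ≫ p) (e₁ : inc 1 ≫ k = last X ≫ v₀) :
    ∃ (v' : X ⟶ E) (h' : labNerve.obj X ⊗ Δ[1] ⟶ E), inc 0 ≫ h' = u ∧
      inc 1 ≫ h' = last X ≫ v' ∧ v' ≫ p = v₀ := by
  obtain ⟨w, hw⟩ := hX (toCocylBase u v₀ k e₀ e₁)
  obtain ⟨v, h, e, hv⟩ := exists_of_hom_cocyl w
  have hs (n) (x : X.obj (op n)) : (cocylMap p).app _ (w.app _ x) =
      (toCocylBase u v₀ k e₀ e₁).app _ x :=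
    ConcreteCategory.congr_hom (NatTrans.congr_app hw (op n)) x
  have s1 (n) (x : X.obj (op n)) : inc 0 ≫ Cocyl.h (w.app _ x) =
    labNerve.map (yonedaEquiv.symm x) ≫ u := congrArg CocylBase.u (hs n x)
  have s2 (n) (x : X.obj (op n)) : Cocyl.v (w.app _ x) ≫ p =
    yonedaEquiv.symm x ≫ v₀ := congrArg CocylBase.v (hs n x)
  refine ⟨v, h, IsDense.labNerve.hom_ext fun n x ↦ ?_, e, IsDense.id.hom_ext fun n x ↦ ?_⟩
  · rw [← s1, (hv n x).2, inc_comp_assoc]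
  · have := s2 n x
    rw [(hv n x).1, Category.assoc] at this
    exact this

/-- Surjectivity on homotopy classes is the case where the base is terminal. Injectivity is the case
of the fibration from the path space of `Z` to pairs of endpoints, where a lift is a homotopy
between the two given maps. -/
lemma isKanEquivalence_last_of_exists_lift {X : SSet.{u}}
    (hX : ∀ {E E₀ : SSet.{u}} (p : E ⟶ E₀) [Fibration p] [KanComplex E] [KanComplex E₀]
      (v : X ⟶ cocylBase p), ∃ w : X ⟶ cocyl E, w ≫ cocylMap p = v) :
    IsKanEquivalence (last X) := by
  rw [isKanEquivalence_iff]
  refine fun Z _ ↦ ⟨fun h h' ⟨a, ha0, ha1⟩ ↦ ?_, fun g ↦ ?_⟩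
  · obtain ⟨v', -, -, -, e⟩ := exists_of_exists_lift (hX (pathEnds Z)) (pathCurry a) (lift h h')
      (fst _ _ ≫ pathCurry a ≫ pathEnds Z) (by rw [inc_fst_assoc]) (by
        rw [inc_fst_assoc, pathEnds, comp_lift, pathCurry_eval, pathCurry_eval, ha0, ha1,
          comp_lift])
    refine ⟨pathUncurry v', ?_, ?_⟩
    · rw [inc_pathUncurry]
      have := e =≫ fst _ _
      rwa [lift_fst, pathEnds, Category.assoc, lift_fst] at this
    · rw [inc_pathUncurry]
      have := e =≫ snd _ _
      rwa [lift_snd, pathEnds, Category.assoc, lift_snd] at this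
  · obtain ⟨v', h', e1, e2, -⟩ := exists_of_exists_lift (hX (terminal.from Z)) g (terminal.from X)
      (terminal.from _) (terminal.hom_ext _ _) (terminal.hom_ext _ _)
    exact ⟨v', Htpy.symm ⟨h', e1, e2⟩⟩

end labNerve

end SSet

/-! ### The last vertex map is a Kan equivalence -/

namespace SSet
open HomotopicalAlgebra Opposite Limits
open scoped SSet.modelCategoryQuillen

namespace ordNerve

variable {P Q : Type u} [Preorder P] [Preorder Q]

/-- The conical contraction: inequalities of monotone maps are homotopies of nerves, so the identity
and the constant map at `p` are both homotopic to `c`. -/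
lemma isKanEquivalence_toPoint (c : P →o P) (p : P) (h : ∀ x, x ≤ c x) (hp : ∀ x, p ≤ c x)
    (f : ordNerve P ⟶ Δ[0]) : IsKanEquivalence f := by
  let x : (ordNerve P) _⦋0⦌ := (OrderHom.const _ p : Fin 1 →o P)
  refine isKanEquivalence_const_of_htpy x ?_ f
  have e : (const x : ordNerve P ⟶ ordNerve P) = map (OrderHom.const P p) := rfl
  rw [e]
  have h1 : IsKanEquivalence (map c) :=
    (IsKanEquivalence.id _).of_htpy (htpy_of_le (f := OrderHom.id) h)
  exact h1.of_htpy' (htpy_of_le hp)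

/-- The subcomplex of chains in a subset. -/
def sub (S : Set P) : (ordNerve P).Subcomplex where
  obj _ := {c | ∀ i, seq c i ∈ S}
  map _ _ hc _ := hc _

/-- The nerve of a subset is the subcomplex of chains. -/
def subIso (S : Set P) : ordNerve S ≅ (sub S : SSet.{u}) where
  hom := { app := fun _ ↦ ↾fun c ↦ ⟨OrderHom.comp (OrderHom.Subtype.val (· ∈ S)) c, fun i ↦ (seq c i).2⟩
           naturality := fun _ _ _ ↦ rfl }
  inv := { app := fun _ ↦ ↾fun c ↦
            ({ toFun := fun i ↦ ⟨seq c.1 i, c.2 i⟩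
               monotone' := fun _ _ h ↦ (seq c.1).monotone h } : Fin _ →o S)
           naturality := fun _ _ _ ↦ rfl }
  hom_inv_id := rfl
  inv_hom_id := rfl

lemma isKanEquivalence_sub_toPoint {S : Set P} (c : S →o S) (p : S) (h : ∀ x, x ≤ c x)
    (hp : ∀ x, p ≤ c x) (f : (sub S : SSet.{u}) ⟶ Δ[0]) : IsKanEquivalence f :=
  (IsKanEquivalence.of_isIso (subIso S).hom).of_comp_left (isKanEquivalence_toPoint c p h hp _)

lemma isKanEquivalence_toPoint_of_iSup (S : ℕ → Set P) (hS : ∀ n, S n ⊆ S (n + 1))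
    (hP : ∀ x, ∃ n, x ∈ S n)
    (h : ∀ n (f : (sub (S n) : SSet.{u}) ⟶ Δ[0]), IsKanEquivalence f)
    (f : ordNerve P ⟶ Δ[0]) : IsKanEquivalence f := by
  have hle (n : ℕ) : sub (S n) ≤ sub (S (n + 1)) := fun _ _ hc i ↦ hS n (hc i)
  have hm : Monotone S := monotone_nat_of_le_succ hS
  have h1 := IsKanAnodyne.of_iSup (fun n ↦ sub (S n)) hle (fun n ↦ by
    refine IsKanAnodyne.of_isKanEquivalence (IsKanEquivalence.of_comp_right (h (n + 1) ?_)
      (h n _))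
    exact const (stdSimplex.obj₀Equiv.symm 0)) (fun n x ↦ by
    choose k hk using hP
    refine ⟨Finset.univ.sup fun i ↦ k (seq x i), fun i ↦ hm ?_ (hk _)⟩
    exact Finset.le_sup (f := fun i ↦ k (seq x i)) (Finset.mem_univ i))
  exact h1.isKanEquivalence.of_comp_left (h 0 _)

end ordNerve

namespace LabSimplex

variable {P : Type u} [PartialOrder P]

lemma ordNerve_le_iff {x y : LabSimplex (ordNerve P)} :
    x ≤ y ↔ ∀ i, ∃ j, x.lab i = y.lab j ∧ ordNerve.seq x.val i = ordNerve.seq y.val j := by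
  constructor
  · rintro ⟨β, h1, h2⟩ i
    exact ⟨β.toOrderHom i, h1 i, by rw [← h2]; rfl⟩
  · intro h
    choose β h1 h2 using h
    refine ⟨SimplexCategory.Hom.mk ⟨β, fun i j hij ↦ ?_⟩, h1,
      ordNerve.simplex_ext fun i ↦ (h2 i).symm⟩
    rw [← y.strictMono.le_iff_le, ← h1, ← h1]
    exact x.strictMono.monotone hij

variable [OrderTop P]

/-- Add a top vertex with a large label. -/
def snocTop (x : LabSimplex (ordNerve P)) (N : ℕ) (hN : ∀ i, x.lab i < N) :
    LabSimplex (ordNerve P) where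
  dim := x.dim + 1
  lab := Fin.snoc (α := fun _ ↦ ℕ) x.lab N
  strictMono := by
    intro i j
    induction i using Fin.lastCases with
    | last => exact fun h ↦ absurd h (Fin.le_last j).not_gt
    | cast i =>
      induction j using Fin.lastCases with
      | last => simp [hN]
      | cast j => simp [x.strictMono.lt_iff_lt]
  val := (⟨Fin.snoc (α := fun _ ↦ P) (ordNerve.seq x.val) ⊤, by
    intro i j
    induction j using Fin.lastCases with
    | last => simp
    | cast j =>
      induction i using Fin.lastCases with
      | last => exact fun h ↦ absurd h (Fin.castSucc_lt_last j).not_ge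
      | cast i =>
        intro h
        simpa using (ordNerve.seq x.val).monotone (Fin.castSucc_le_castSucc_iff.1 h)⟩ :
      Fin (x.dim + 1 + 1) →o P)

lemma snocTop_castSucc (x : LabSimplex (ordNerve P)) (N : ℕ) (hN : ∀ i, x.lab i < N) (i) :
    (x.snocTop N hN).lab (Fin.castSucc i) = x.lab i ∧
      ordNerve.seq (x.snocTop N hN).val (Fin.castSucc i) = ordNerve.seq x.val i :=
  ⟨Fin.snoc_castSucc (α := fun _ ↦ ℕ) N x.lab i,
    Fin.snoc_castSucc (α := fun _ ↦ P) ⊤ (ordNerve.seq x.val) i⟩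

lemma snocTop_last (x : LabSimplex (ordNerve P)) (N : ℕ) (hN : ∀ i, x.lab i < N) :
    (x.snocTop N hN).lab (Fin.last _) = N ∧
      ordNerve.seq (x.snocTop N hN).val (Fin.last _) = ⊤ :=
  ⟨Fin.snoc_last (α := fun _ ↦ ℕ) N x.lab,
    Fin.snoc_last (α := fun _ ↦ P) ⊤ (ordNerve.seq x.val)⟩

/-- Labels are at most `N`, and the label `N` occurs only at the top. -/
def bounded (P : Type u) [PartialOrder P] [OrderTop P] (N : ℕ) : Set (LabSimplex (ordNerve P)) :=
  {x | ∀ i, x.lab i ≤ N ∧ (x.lab i = N → ordNerve.seq x.val i = ⊤)}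

/-- If the label `N` is missing, a vertex `⊤` with label `N` can be appended, as `⊤` lies above all
vertices and `N` above all labels. Minimality of the result makes this choice monotone in `x`. -/
lemma exists_cone {N : ℕ} {x : LabSimplex (ordNerve P)} (hx : x ∈ bounded P N) :
    ∃ y ∈ bounded P N, x ≤ y ∧ (∃ j, y.lab j = N) ∧
      ∀ z ∈ bounded P N, x ≤ z → (∃ j, z.lab j = N) → y ≤ z := by
  by_cases h : ∃ j, x.lab j = N
  · exact ⟨x, hx, le_rfl, h, fun z _ h _ ↦ h⟩
  · have hN (i) : x.lab i < N := lt_of_le_of_ne (hx i).1 fun e ↦ h ⟨i, e⟩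
    refine ⟨x.snocTop N hN, fun i ↦ ?_, ?_, ⟨Fin.last _, (x.snocTop_last N hN).1⟩, ?_⟩
    · induction i using Fin.lastCases with
      | last => exact ⟨(x.snocTop_last N hN).1.le, fun _ ↦ (x.snocTop_last N hN).2⟩
      | cast i =>
        rw [(x.snocTop_castSucc N hN i).1, (x.snocTop_castSucc N hN i).2]
        exact hx i
    · exact ordNerve_le_iff.2 fun i ↦ ⟨_, (x.snocTop_castSucc N hN i).1.symm,
        (x.snocTop_castSucc N hN i).2.symm⟩
    · intro z hz hxz ⟨j, hj⟩
      refine ordNerve_le_iff.2 fun i ↦ ?_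
      induction i using Fin.lastCases with
      | last => exact ⟨j, (x.snocTop_last N hN).1.trans hj.symm,
          (x.snocTop_last N hN).2.trans ((hz j).2 hj).symm⟩
      | cast i =>
        rw [(x.snocTop_castSucc N hN i).1, (x.snocTop_castSucc N hN i).2]
        exact ordNerve_le_iff.1 hxz i

end LabSimplex

/-- Adding the top vertex with label `N` is a conical contraction of `bounded P N` onto the vertex
`⊤` labelled `N`. These sets increase with `N` and exhaust all labelled simplices. -/
lemma labNerve.isKanEquivalence_toPoint_ordNerve (P : Type u) [PartialOrder P] [OrderTop P]
    (f : labNerve.obj (ordNerve P) ⟶ Δ[0]) : IsKanEquivalence f := by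
  refine ordNerve.isKanEquivalence_toPoint_of_iSup (LabSimplex.bounded P) (fun N x hx i ↦
    ⟨(hx i).1.trans (Nat.le_succ _), fun h ↦ absurd (hx i).1 (by omega)⟩) (fun x ↦
    ⟨x.lab (Fin.last _) + 1, fun i ↦ ?_⟩) (fun N ↦ ?_) f
  · have := x.strictMono.monotone (Fin.le_last i)
    exact ⟨by omega, by omega⟩
  · choose c h1 h2 h3 h4 using fun x : LabSimplex.bounded P N ↦ LabSimplex.exists_cone x.2
    let p : LabSimplex (ordNerve P) := ⟨0, fun _ ↦ N, Subsingleton.strictMono (α := Fin 1) _,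
      (OrderHom.const _ ⊤ : Fin 1 →o P)⟩
    refine ordNerve.isKanEquivalence_sub_toPoint
      ⟨fun x ↦ ⟨c x, h1 x⟩, fun x y hxy ↦ h4 x _ (h1 y) (le_trans hxy (h2 y)) (h3 y)⟩
      ⟨p, fun _ ↦ ⟨le_rfl, fun _ ↦ rfl⟩⟩ h2 fun x ↦ ?_
    refine LabSimplex.ordNerve_le_iff.2 fun _ ↦ ?_
    obtain ⟨j, hj⟩ := h3 x
    exact ⟨j, hj.symm, ((h1 x j).2 hj).symm⟩

/-- The standard simplex as a nerve. -/
noncomputable def stdSimplex.isoOrdNerve (n : ℕ) : (Δ[n] : SSet.{u}) ≅ ordNerve (ULift.{u} (Fin (n + 1))) where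
  hom := { app := fun _ ↦ ↾fun x ↦
            ({ toFun := fun i ↦ ⟨(stdSimplex.objEquiv x).toOrderHom i⟩
               monotone' := fun _ _ h ↦ (stdSimplex.objEquiv x).toOrderHom.monotone h } : Fin _ →o ULift.{u} (Fin (n + 1)))
           naturality := fun _ _ _ ↦ rfl }
  inv := { app := fun _ ↦ ↾fun c ↦ stdSimplex.objMk
            { toFun := fun i ↦ (ordNerve.seq c i).down
              monotone' := fun _ _ h ↦ (ordNerve.seq c).monotone h }
           naturality := fun _ _ _ ↦ rfl }
  hom_inv_id := by
    ext m x
    refine stdSimplex.objEquiv.injective ?_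
    ext i : 3
    rfl
  inv_hom_id := rfl

namespace labNerve

lemma isKanEquivalence_last_stdSimplex (n : ℕ) : IsKanEquivalence (last (Δ[n] : SSet.{u})) := by
  let t : (Δ[n] : SSet.{u}) ⟶ Δ[0] := const (stdSimplex.obj₀Equiv.symm 0)
  let e := labNerve.mapIso (stdSimplex.isoOrdNerve.{u} n)
  refine (stdSimplex.isKanEquivalence_toPoint n t).of_comp_right ?_
  have h := isKanEquivalence_toPoint_ordNerve (ULift.{u} (Fin (n + 1))) (e.inv ≫ last _ ≫ t)
  have := (IsKanEquivalence.of_isIso e.hom).comp h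
  rwa [Iso.hom_inv_id_assoc] at this

/-- The boundary of `Δ[n]` has dimension below `n`, so by induction its last vertex map is a Kan
equivalence. That of `Δ[n]` is one because both sides are contractible. The mapping cylinder
argument solves the relative problem. -/
lemma hasLiftingProperty_boundary (n : ℕ) : ∀ {E E₀ : SSet.{u}} (p : E ⟶ E₀) [Fibration p]
    [KanComplex E] [KanComplex E₀], HasLiftingProperty (boundary.{u} n).ι (cocylMap p) := by
  induction n using Nat.strong_induction_on with
  | _ n ih =>
    intro E E₀ p _ _ _
    have hb : IsKanEquivalence (last (boundary.{u} n : SSet.{u})) :=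
      isKanEquivalence_last_of_exists_lift fun p _ _ _ v ↦
        exists_lift_of_hasDimensionLT _ n (fun d hd ↦ ih d hd p) v
    refine hasLiftingProperty_of_isSolvable fun u v h v₀ k h0 h1 k0 k1 hv hk ↦ ?_
    obtain ⟨v', h', e⟩ := mapCyl.exists_extension (labNerve.map (boundary.{u} n).ι) (boundary n).ι
      (last_naturality _) hb (isKanEquivalence_last_stdSimplex n) p u v h h0 h1 v₀ k k0 k1 hv hk
    exact ⟨v', h', e⟩

/-- The last vertex map is an equivalence. -/
theorem isKanEquivalence_last (X : SSet.{u}) : IsKanEquivalence (last X) := by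
  refine isKanEquivalence_last_of_exists_lift fun p _ _ _ v ↦ ?_
  exact (isTrivialFib_of_boundary fun n ↦ hasLiftingProperty_boundary n p).exists_lift v

end labNerve

end SSet

/-! ### The poset of finite chains -/

namespace SSet
open HomotopicalAlgebra Opposite Limits
open scoped SSet.modelCategoryQuillen

section chains

variable (P : Type u) [PartialOrder P]

/-- Nonempty finite chains. -/
def FinChain : Type u := {s : Finset P // s.Nonempty ∧ IsChain (· ≤ ·) (s : Set P)}

instance : PartialOrder (FinChain P) := inferInstanceAs (PartialOrder (Subtype _))

variable {P}

lemma exists_orderIso_fin (s : Finset P) (hs : IsChain (· ≤ ·) (s : Set P)) {k : ℕ}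
    (hk : s.card = k) : Nonempty (Fin k ≃o s) := by
  classical
  let _ : LinearOrder s :=
    { (inferInstance : PartialOrder s) with
      le_total := fun a b ↦ hs.total a.2 b.2
      toDecidableLE := Classical.decRel _ }
  exact ⟨Fintype.orderIsoFinOfCardEq s (by rw [Fintype.card_coe, hk])⟩

lemma isChain_range_orderHom {n : ℕ} (c : Fin (n + 1) →o P) : IsChain (· ≤ ·) (Set.range c) := by
  rintro _ ⟨i, rfl⟩ _ ⟨j, rfl⟩ -
  exact (le_total i j).imp (fun h ↦ c.monotone h) fun h ↦ c.monotone h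

namespace FinChain

lemma exists_isGreatest (s : FinChain P) : ∃ p ∈ s.1, ∀ q ∈ s.1, q ≤ p := by
  obtain ⟨p, hp⟩ := s.1.exists_maximal s.2.1
  refine ⟨p, hp.1, fun q hq ↦ ?_⟩
  exact (s.2.2.total hq hp.1).elim (fun h ↦ h) fun h ↦ hp.2 hq h

/-- The largest element of a chain. -/
noncomputable def max : FinChain P →o P where
  toFun s := s.exists_isGreatest.choose
  monotone' _ t h := t.exists_isGreatest.choose_spec.2 _ (h (exists_isGreatest _).choose_spec.1)

lemma max_mem (s : FinChain P) : max s ∈ s.1 := s.exists_isGreatest.choose_spec.1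

lemma le_max (s : FinChain P) {q : P} (h : q ∈ s.1) : q ≤ max s :=
  s.exists_isGreatest.choose_spec.2 q h

lemma max_eq (s : FinChain P) {p : P} (hp : p ∈ s.1) (h : ∀ q ∈ s.1, q ≤ p) : max s = p :=
  le_antisymm (h _ s.max_mem) (s.le_max hp)

open Classical in
/-- The image of a chain. -/
noncomputable def range {n : ℕ} (c : Fin (n + 1) →o P) : FinChain P :=
  ⟨Finset.univ.image c, ⟨c 0, Finset.mem_image_of_mem _ (Finset.mem_univ _)⟩, by
    rw [Finset.coe_image, Finset.coe_univ, Set.image_univ]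
    exact isChain_range_orderHom c⟩

lemma mem_range {n : ℕ} {c : Fin (n + 1) →o P} {p : P} : p ∈ (range c).1 ↔ ∃ i, c i = p := by
  simp [range]

lemma exists_orderHom (s : FinChain P) :
    ∃ (n : ℕ) (c : Fin (n + 1) →o P), StrictMono c ∧ range c = s := by
  obtain ⟨n, hn⟩ : ∃ n, s.1.card = n + 1 := Nat.exists_eq_succ_of_ne_zero s.2.1.card_pos.ne'
  obtain ⟨e⟩ := exists_orderIso_fin s.1 s.2.2 hn
  refine ⟨n, ⟨fun i ↦ (e i).1, fun i j h ↦ e.monotone h⟩, fun i j h ↦ e.strictMono h, ?_⟩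
  refine Subtype.ext (Finset.ext fun p ↦ mem_range.trans ⟨?_, fun hp ↦ ⟨e.symm ⟨p, hp⟩, ?_⟩⟩)
  · rintro ⟨i, rfl⟩
    exact (e i).2
  · change (e (e.symm ⟨p, hp⟩)).1 = p
    rw [e.apply_symm_apply]

/-- The set of vertices of a labelled simplex of a nerve. -/
noncomputable def ofLabSimplex : LabSimplex (ordNerve P) →o FinChain P where
  toFun x := range (ordNerve.seq x.val)
  monotone' x y h p hp := by
    obtain ⟨i, rfl⟩ := mem_range.1 hp
    obtain ⟨j, -, hj⟩ := LabSimplex.ordNerve_le_iff.1 h i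
    exact mem_range.2 ⟨j, hj.symm⟩

lemma map_max_eq_last :
    ordNerve.map (ofLabSimplex (P := P)) ≫ ordNerve.map max = labNerve.last (ordNerve P) := by
  refine ordNerve.hom_app_ext fun n (c : Fin (n.unop.len + 1) →o LabSimplex (ordNerve P)) i ↦ ?_
  have h := (LabSimplex.isHom_hom (c.monotone (Fin.le_last i))).val
  have h' : ordNerve.seq (c i).val (Fin.last _) = ordNerve.seq (c (Fin.last _)).val
      ((labNerve.lastOp c).toOrderHom i) := by
    rw [← h]
    rfl
  refine Eq.trans ?_ h'
  refine max_eq _ (mem_range.2 ⟨_, rfl⟩) fun q hq ↦ ?_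
  obtain ⟨j, rfl⟩ := mem_range.1 hq
  exact (ordNerve.seq (c i).val).monotone (Fin.le_last j)

/-- Label a chain by a strictly monotone function. -/
lemma exists_section {d : P → ℕ} (hd : StrictMono d) :
    ∃ a : FinChain P →o LabSimplex (ordNerve P), ∀ s, ofLabSimplex (a s) = s := by
  choose n c hc hr using exists_orderHom (P := P)
  let a (s : FinChain P) : LabSimplex (ordNerve P) := ⟨n s, d ∘ c s, hd.comp (hc s), c s⟩
  refine ⟨⟨a, fun s t h ↦ LabSimplex.ordNerve_le_iff.2 fun i ↦ ?_⟩, hr⟩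
  have h1 : c s i ∈ (range (c s)).1 := mem_range.2 ⟨i, rfl⟩
  rw [hr s] at h1
  have h2 := h h1
  rw [← hr t] at h2
  obtain ⟨j, hj⟩ := mem_range.1 h2
  exact ⟨j, congrArg d hj.symm, hj.symm⟩

/-- The last vertex map of the nerve of `P` factors through chains as `ofLabSimplex` followed by
`max`. Labelling by `d` provides a section of `ofLabSimplex`, so two out of six applies. -/
lemma isKanEquivalence_map_max {d : P → ℕ} (hd : StrictMono d) :
    IsKanEquivalence (ordNerve.map (max (P := P))) := by
  obtain ⟨a, ha⟩ := exists_section hd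
  have h1 : IsKanEquivalence (ordNerve.map a ≫ ordNerve.map (ofLabSimplex (P := P))) := by
    have : (ofLabSimplex (P := P)).comp a = OrderHom.id := OrderHom.ext _ _ (funext ha)
    rw [← ordNerve.map_comp, this]
    exact IsKanEquivalence.id _
  have h2 : IsKanEquivalence (ordNerve.map (ofLabSimplex (P := P)) ≫ ordNerve.map max) := by
    rw [map_max_eq_last]
    exact labNerve.isKanEquivalence_last _
  exact (IsKanEquivalence.two_of_six h1 h2).of_comp_left h2

end FinChain

end chains

end SSet

/-! ### Points and barycentric coordinates of the realization -/

namespace SSet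
open HomotopicalAlgebra Opposite Limits
open scoped SSet.modelCategoryQuillen

/-- The topological simplex. -/
abbrev TopSimplex (n : ℕ) : Type := _root_.stdSimplex ℝ (Fin (n + 1))

section sing

variable {T T' : TopCat.{u}} {n m : SimplexCategoryᵒᵖ}

/-- A singular simplex as a continuous map. -/
noncomputable def ev (x : (TopCat.toSSet.obj T).obj n) : C(TopSimplex n.unop.len, T) :=
  TopCat.toSSetObjEquiv T n x

/-- A continuous map as a singular simplex. -/
noncomputable def mkSing (g : C(TopSimplex n.unop.len, T)) : (TopCat.toSSet.obj T).obj n :=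
  (TopCat.toSSetObjEquiv T n).symm g

@[simp]
lemma ev_mkSing (g : C(TopSimplex n.unop.len, T)) : ev (mkSing g) = g :=
  (TopCat.toSSetObjEquiv T n).apply_symm_apply g

lemma ev_ext {x y : (TopCat.toSSet.obj T).obj n} (h : ∀ z, ev x z = ev y z) : x = y :=
  (TopCat.toSSetObjEquiv T n).injective (ContinuousMap.ext h)

lemma ev_map (α : n ⟶ m) (x : (TopCat.toSSet.obj T).obj n) (z) :
    ev ((TopCat.toSSet.obj T).map α x) z = ev x (stdSimplex.map α.unop.toOrderHom z) := rfl

lemma ev_app (f : T ⟶ T') (x : (TopCat.toSSet.obj T).obj n) (z) :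
    ev ((TopCat.toSSet.map f).app n x) z = f.hom (ev x z) := rfl

variable {X Y : SSet.{u}}

lemma hom_sing_ext {f g : X ⟶ TopCat.toSSet.obj T}
    (h : ∀ n (s : X.obj n) z, ev (f.app n s) z = ev (g.app n s) z) : f = g := by
  ext n s
  exact ev_ext (h n s)

/-- A compatible family of maps on topological simplices as a map to the singular simplicial
set. -/
noncomputable def toSing (φ : ∀ n (_ : X.obj n), C(TopSimplex n.unop.len, T))
    (h : ∀ {n m} (α : n ⟶ m) (s : X.obj n) z,
      φ m (X.map α s) z = φ n s (stdSimplex.map α.unop.toOrderHom z)) :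
    X ⟶ TopCat.toSSet.obj T where
  app n := ↾fun s ↦ mkSing (φ n s)
  naturality n m α := by
    ext s
    refine ev_ext fun z ↦ ?_
    change ev (mkSing (φ m (X.map α s))) z = ev ((TopCat.toSSet.obj T).map α (mkSing (φ n s))) z
    rw [ev_map, ev_mkSing, ev_mkSing]
    exact h α s z

lemma ev_toSing (φ : ∀ n (_ : X.obj n), C(TopSimplex n.unop.len, T)) (h) (n) (s : X.obj n) :
    ev ((toSing φ h).app n s) = φ n s := ev_mkSing _

/-- The unit of the adjunction between realization and singular simplices. -/
noncomputable abbrev toSingTop (X : SSet.{u}) : X ⟶ TopCat.toSSet.obj |X| := sSetTopAdj.unit.app X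

/-- The points of the realization given by a simplex. -/
noncomputable def pt (s : X.obj n) : C(TopSimplex n.unop.len, |X|) :=
  ev ((toSingTop X).app n s)

lemma pt_map (α : n ⟶ m) (s : X.obj n) (z) :
    pt (X.map α s) z = pt s (stdSimplex.map α.unop.toOrderHom z) := by
  rw [pt, NatTrans.naturality_apply, ev_map]
  rfl

lemma toTop_map_pt (f : X ⟶ Y) (s : X.obj n) (z) :
    (toTop.map f).hom (pt s z) = pt (f.app n s) z := by
  have h : f ≫ toSingTop Y = toSingTop X ≫ TopCat.toSSet.map (toTop.map f) :=
    sSetTopAdj.unit.naturality f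
  have h' := ConcreteCategory.congr_hom (NatTrans.congr_app h n) s
  exact (congrArg (fun x ↦ ev x z) h').symm

/-- The continuous map on the realization given by a map to a singular simplicial set. -/
noncomputable def realize (τ : X ⟶ TopCat.toSSet.obj T) : |X| ⟶ T :=
  (sSetTopAdj.homEquiv X T).symm τ

lemma toSingTop_realize (τ : X ⟶ TopCat.toSSet.obj T) :
    toSingTop X ≫ TopCat.toSSet.map (realize τ) = τ := by
  have := (sSetTopAdj.homEquiv X T).apply_symm_apply τ
  rwa [Adjunction.homEquiv_unit] at this

lemma realize_pt (τ : X ⟶ TopCat.toSSet.obj T) (s : X.obj n) (z) :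
    (realize τ).hom (pt s z) = ev (τ.app n s) z := by
  conv_rhs => rw [← toSingTop_realize τ]
  rfl

lemma hom_realization_ext {f g : |X| ⟶ T}
    (h : ∀ n (s : X.obj n) z, f.hom (pt s z) = g.hom (pt s z)) : f = g := by
  refine (sSetTopAdj.homEquiv X T).injective ?_
  rw [Adjunction.homEquiv_unit, Adjunction.homEquiv_unit]
  exact hom_sing_ext h

/-- Truth values with the indiscrete topology. -/
def IndiscreteProp : Type u := ULift.{u} Prop

instance : TopologicalSpace IndiscreteProp.{u} := ⊤

/-- Maps out of the realization are determined by their values on points of simplices. This applies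
to the indicator of the set of such points and to the constant `True`, which are continuous because
the target is indiscrete. -/
lemma exists_pt (y : |X|) : ∃ (n : SimplexCategoryᵒᵖ) (s : X.obj n) (z : _), pt s z = y := by
  let f : |X| ⟶ TopCat.of IndiscreteProp.{u} := TopCat.ofHom
    ⟨fun y ↦ ⟨∃ n, ∃ (s : X.obj n) (z : _), pt s z = y⟩, continuous_top⟩
  let g : |X| ⟶ TopCat.of IndiscreteProp.{u} := TopCat.ofHom ⟨fun _ ↦ ⟨True⟩, continuous_top⟩
  have : f = g := hom_realization_ext fun n s z ↦ ULift.ext _ _ (eq_true ⟨n, s, z, rfl⟩)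
  have h : f.hom y = g.hom y := by rw [this]
  exact of_eq_true (congrArg ULift.down h)

lemma continuous_of_pt' {f : |X| → T} (h : ∀ n (s : X.obj n), Continuous fun z ↦ f (pt s z)) :
    Continuous f := by
  let τ : X ⟶ TopCat.toSSet.obj T := toSing (fun n s ↦ ⟨_, h n s⟩) fun α s z ↦ by
    change f _ = f _
    rw [pt_map]
  have : f = (realize τ).hom := by
    ext y
    obtain ⟨n, s, z, rfl⟩ := exists_pt y
    rw [realize_pt, ev_toSing]
    rfl
  rw [this]
  exact (realize τ).hom.continuous

/-- Open sets are the maps to the Sierpiński space, so this follows from the corresponding statement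
on continuity. -/
lemma isOpen_of_pt {U : Set |X|} (h : ∀ n (s : X.obj n), IsOpen {z | pt s z ∈ U}) : IsOpen U := by
  have : Continuous fun y ↦ (⟨y ∈ U⟩ : ULift.{u} Prop) :=
    continuous_of_pt' (T := TopCat.of (ULift.{u} Prop)) fun n s ↦
      continuous_uliftUp.comp (continuous_Prop.2 (h n s))
  exact continuous_Prop.1 (continuous_uliftDown.comp this)

end sing

section coord

variable {P : Type u} [PartialOrder P] {X : SSet.{u}} {n m : SimplexCategoryᵒᵖ}

open Classical in
/-- Push forward of barycentric coordinates. -/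
noncomputable def push {Q ι : Type*} [Fintype ι] (c : ι → Q) (z : ι → ℝ) (q : Q) : ℝ :=
  ∑ i, if c i = q then z i else 0

lemma push_nonneg {Q ι : Type*} [Fintype ι] (c : ι → Q) {z : ι → ℝ} (hz : ∀ i, 0 ≤ z i) (q : Q) :
    0 ≤ push c z q := by
  classical
  exact Finset.sum_nonneg fun i _ ↦ by split_ifs <;> simp [hz]

lemma push_comp {Q ι κ : Type*} [Fintype ι] [Fintype κ] (c : κ → Q) (a : ι → κ) (z : ι → ℝ) :
    push (c ∘ a) z = push c (push a z) := by
  classical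
  ext q
  simp only [push, Function.comp_apply]
  simp_rw [← Finset.sum_filter]
  rw [Finset.sum_filter]
  simp_rw [Finset.sum_filter]
  have : ∀ k, (if c k = q then ∑ i, if a i = k then z i else 0 else 0) =
      ∑ i, if a i = k then (if c k = q then z i else 0) else 0 := by
    intro k
    split_ifs <;> simp
  simp_rw [this]
  rw [Finset.sum_comm]
  refine Finset.sum_congr rfl fun i _ ↦ ?_
  rw [Finset.sum_ite_eq]
  simp

lemma push_apply_of_injective {Q ι : Type*} [Fintype ι] {c : ι → Q} (hc : Function.Injective c)
    (z : ι → ℝ) (i : ι) : push c z (c i) = z i := by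
  classical
  rw [push, Finset.sum_eq_single i]
  · simp
  · intro j _ hj
    rw [if_neg fun h ↦ hj (hc h)]
  · simp

lemma push_eq_zero {Q ι : Type*} [Fintype ι] {c : ι → Q} (z : ι → ℝ) {q : Q}
    (h : ∀ i, c i = q → z i = 0) : push c z q = 0 :=
  Finset.sum_eq_zero fun i _ ↦ by split_ifs with hi <;> simp [h i, *]

lemma exists_of_push_ne_zero {Q ι : Type*} [Fintype ι] {c : ι → Q} {z : ι → ℝ} {q : Q}
    (h : push c z q ≠ 0) : ∃ i, c i = q ∧ z i ≠ 0 := by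
  by_contra! h'
  exact h (push_eq_zero z h')

lemma sum_push {Q ι : Type*} [Fintype ι] [Fintype Q] (c : ι → Q) (z : ι → ℝ) :
    ∑ q, push c z q = ∑ i, z i := by
  classical
  simp only [push]
  rw [Finset.sum_comm]
  simp

lemma coe_map_eq_push {ι κ : Type*} [Fintype ι] [Fintype κ] (a : ι → κ)
    (z : _root_.stdSimplex ℝ ι) : ((stdSimplex.map a z : _root_.stdSimplex ℝ κ) : κ → ℝ) =
      push a z := by
  classical
  ext k
  rw [stdSimplex.map_coe, FunOnFinite.linearMap_apply_apply, push, Finset.sum_filter]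

lemma continuous_push {Q ι : Type*} [Fintype ι] (c : ι → Q) : Continuous (push c) := by
  classical
  refine continuous_pi fun q ↦ continuous_finsetSum _ fun i _ ↦ ?_
  split_ifs <;> fun_prop

/-- Barycentric coordinates as a map to a singular simplicial set. -/
noncomputable def coordSing (i : X ⟶ ordNerve P) :
    X ⟶ TopCat.toSSet.obj (TopCat.of (ULift.{u} (P → ℝ))) :=
  toSing (fun n s ↦ ⟨fun z ↦ ⟨push (ordNerve.seq (i.app n s)) z⟩, continuous_uliftUp.comp
    ((continuous_push _).comp continuous_subtype_val)⟩) fun {n m} α s z ↦ ULift.ext _ _ (by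
      have h : i.app m (X.map α s) = (ordNerve P).map α (i.app n s) :=
        NatTrans.naturality_apply _ _ _
      change push (ordNerve.seq (i.app m (X.map α s))) z = push (ordNerve.seq (i.app n s)) _
      rw [h, coe_map_eq_push, ← push_comp]
      rfl)

/-- Barycentric coordinates on the realization. -/
noncomputable def coord (i : X ⟶ ordNerve P) : C(|X|, P → ℝ) :=
  ContinuousMap.comp ⟨ULift.down, continuous_uliftDown⟩ (realize (coordSing i)).hom

lemma coord_pt (i : X ⟶ ordNerve P) (s : X.obj n) (z) :
    coord i (pt s z) = push (ordNerve.seq (i.app n s)) z := by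
  refine (congrArg ULift.down (realize_pt (coordSing i) s z)).trans ?_
  rw [coordSing, ev_toSing]
  rfl

lemma exists_monotone_factor {k l : ℕ} {c : Fin (k + 1) →o P} {e : Fin (l + 1) →o P}
    (he : StrictMono e) (h : ∀ i, ∃ j, c j = e i) : ∃ b : Fin (l + 1) →o Fin (k + 1), c.comp b = e := by
  choose b hb using h
  refine ⟨⟨b, fun i j hij ↦ ?_⟩, OrderHom.ext _ _ (funext hb)⟩
  by_contra! hlt
  have := c.monotone hlt.le
  rw [hb, hb] at this
  rw [le_antisymm hij (he.le_iff_le.1 this)] at hlt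
  exact lt_irrefl _ hlt

lemma exists_monotone_factor' {k l : ℕ} {c : Fin (k + 1) →o P} {e : Fin (l + 1) →o P}
    (he : StrictMono e) (h : ∀ i, ∃ j, e j = c i) : ∃ b : Fin (k + 1) →o Fin (l + 1), e.comp b = c := by
  choose b hb using h
  refine ⟨⟨b, fun i j hij ↦ he.le_iff_le.1 ?_⟩, OrderHom.ext _ _ (funext hb)⟩
  rw [hb, hb]
  exact c.monotone hij

/-- The operator of a monotone map. -/
def op' {k l : ℕ} (b : Fin (l + 1) →o Fin (k + 1)) : (op ⦋k⦌ : SimplexCategoryᵒᵖ) ⟶ op ⦋l⦌ :=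
  Quiver.Hom.op (SimplexCategory.Hom.mk b : ⦋l⦌ ⟶ ⦋k⦌)

lemma app_map_op' (i : X ⟶ ordNerve P) {k l : ℕ} (b : Fin (l + 1) →o Fin (k + 1)) (s : X _⦋k⦌) :
    (i.app _ (X.map (op' b) s) : Fin (l + 1) →o P) =
      (i.app (op ⦋k⦌) s : Fin (k + 1) →o P).comp b :=
  NatTrans.naturality_apply i (op' b) s

variable (i : X ⟶ ordNerve P) [Mono i]

/-- Removing repetitions from the vertices of `s` exhibits `s` as a degeneracy of a face with
distinct vertices, because `i` is injective. For distinct vertices the coordinates determine the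
point. -/
lemma pt_eq_of_push_eq {k : ℕ} (s : X _⦋k⦌) {z z' : TopSimplex k}
    (h : push (ordNerve.seq (i.app _ s)) z = push (ordNerve.seq (i.app _ s)) z') :
    pt s z = pt s z' := by
  obtain ⟨l, e, he, hr⟩ := (FinChain.range (ordNerve.seq (i.app _ s))).exists_orderHom
  have hr' (p : P) : (∃ j, ordNerve.seq (i.app _ s) j = p) ↔ ∃ j, e j = p :=
    FinChain.mem_range.symm.trans (hr ▸ FinChain.mem_range)
  obtain ⟨b, hb⟩ := exists_monotone_factor (c := ordNerve.seq (i.app _ s)) he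
    fun j ↦ (hr' _).2 ⟨j, rfl⟩
  obtain ⟨a, ha⟩ := exists_monotone_factor' (c := ordNerve.seq (i.app _ s)) he
    fun j ↦ (hr' _).1 ⟨j, rfl⟩
  have hs : X.map (op' a) (X.map (op' b) s) = s := by
    refine app_injective_of_mono i _ ?_
    refine (app_map_op' i a _).trans ?_
    rw [app_map_op' i b s]
    exact (congrArg (OrderHom.comp · a) hb).trans ha
  have hp (z : TopSimplex k) : pt s z = pt (X.map (op' b) s) (stdSimplex.map a z) :=
    (congrArg (fun s ↦ pt s z) hs.symm).trans (pt_map _ _ _)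
  rw [hp, hp]
  refine congrArg (pt (X.map (op' b) s)) (_root_.stdSimplex.ext ?_ :
    (stdSimplex.map a z : TopSimplex l) = stdSimplex.map a z')
  rw [coe_map_eq_push, coe_map_eq_push]
  have key (z : TopSimplex k) : push (ordNerve.seq (i.app _ s)) z = push e (push a z) := by
    rw [← push_comp]
    exact congrArg (fun f : Fin (k + 1) →o P ↦ push f z) ha.symm
  rw [key, key] at h
  ext j
  have := congrFun h (e j)
  rwa [push_apply_of_injective he.injective, push_apply_of_injective he.injective] at this

/-- Normal form of the points of the realization. -/
lemma pt_eq_of_enumeration {k l : ℕ} (s : X _⦋k⦌) (z : TopSimplex k) (e : Fin (l + 1) →o P)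
    (he : StrictMono e) (h : ∀ p, push (ordNerve.seq (i.app _ s)) z p ≠ 0 ↔ ∃ j, e j = p) :
    ∃ (s' : X _⦋l⦌) (z' : TopSimplex l), i.app _ s' = e ∧
      (∀ j, z' j = push (ordNerve.seq (i.app _ s)) z (e j)) ∧ pt s z = pt s' z' := by
  obtain ⟨b, hb⟩ := exists_monotone_factor (c := ordNerve.seq (i.app _ s)) he
    fun j ↦ by
      obtain ⟨i', h1, -⟩ := exists_of_push_ne_zero ((h (e j)).2 ⟨j, rfl⟩)
      exact ⟨i', h1⟩
  have hpush : push e (fun j ↦ push (ordNerve.seq (i.app _ s)) z (e j)) =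
      push (ordNerve.seq (i.app _ s)) z := by
    ext p
    by_cases hp : push (ordNerve.seq (i.app _ s)) z p = 0
    · rw [hp]
      refine push_eq_zero _ fun j hj ↦ ?_
      rw [hj, hp]
    · obtain ⟨j, rfl⟩ := (h p).1 hp
      rw [push_apply_of_injective he.injective]
  -- As `P` may be infinite, total mass cannot be summed over `P`. It is compared on the finite list
  -- `e'` of all vertices of `s`.
  have hsum : ∑ j, push (ordNerve.seq (i.app _ s)) z (e j) = 1 := by
    obtain ⟨l', e', he', hr⟩ := (FinChain.range (ordNerve.seq (i.app _ s))).exists_orderHom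
    have hr' (p : P) : (∃ j, ordNerve.seq (i.app _ s) j = p) ↔ ∃ j, e' j = p :=
      FinChain.mem_range.symm.trans (hr ▸ FinChain.mem_range)
    obtain ⟨a, ha⟩ := exists_monotone_factor' (c := ordNerve.seq (i.app _ s)) he'
      fun j ↦ (hr' _).1 ⟨j, rfl⟩
    obtain ⟨a', ha'⟩ := exists_monotone_factor' (c := e) he'
      fun j ↦ by
        rw [← hr']
        obtain ⟨i', h1, -⟩ := exists_of_push_ne_zero ((h (e j)).2 ⟨j, rfl⟩)
        exact ⟨i', h1⟩
    have e1 : push (ordNerve.seq (i.app _ s)) z = push e' (push a z) := by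
      rw [← push_comp]
      exact congrArg (fun f : Fin (k + 1) →o P ↦ push f z) ha.symm
    have e2 : push e (fun j ↦ push (ordNerve.seq (i.app _ s)) z (e j)) =
        push e' (push a' fun j ↦ push (ordNerve.seq (i.app _ s)) z (e j)) := by
      rw [← push_comp]
      exact congrArg (fun f : Fin (l + 1) →o P ↦ push f fun j ↦
        push (ordNerve.seq (i.app _ s)) z (e j)) ha'.symm
    have e3 : push a z = push a' fun j ↦ push (ordNerve.seq (i.app _ s)) z (e j) := by
      ext j
      have := congrFun ((e2.symm.trans hpush).trans e1) (e' j)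
      rw [push_apply_of_injective he'.injective, push_apply_of_injective he'.injective] at this
      exact this.symm
    rw [← sum_push a', ← e3, sum_push]
    exact z.2.2
  let z' : TopSimplex l := ⟨fun j ↦ push (ordNerve.seq (i.app _ s)) z (e j),
    fun j ↦ push_nonneg _ z.2.1 _, hsum⟩
  refine ⟨X.map (op' b) s, z', (app_map_op' i b s).trans hb, fun _ ↦ rfl, ?_⟩
  rw [pt_map]
  refine pt_eq_of_push_eq i s ?_
  rw [coe_map_eq_push]
  refine Eq.trans hpush.symm (Eq.trans ?_ (push_comp _ b z'))
  exact congrArg (fun f : Fin (l + 1) →o P ↦ push f fun j ↦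
        push (ordNerve.seq (i.app _ s)) z (e j)) hb.symm

lemma exists_enumeration {k : ℕ} (c : Fin (k + 1) →o P) (z : TopSimplex k) :
    ∃ (l : ℕ) (e : Fin (l + 1) →o P), StrictMono e ∧ ∀ p, push c z p ≠ 0 ↔ ∃ j, e j = p := by
  classical
  let S : Finset P := (Finset.univ.image c).filter fun p ↦ push c z p ≠ 0
  have hS (p : P) : p ∈ S ↔ push c z p ≠ 0 := by
    simp only [S, Finset.mem_filter, Finset.mem_image, Finset.mem_univ, true_and,
      and_iff_right_iff_imp]
    intro h
    obtain ⟨i, hi, -⟩ := exists_of_push_ne_zero h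
    exact ⟨i, hi⟩
  have hne : S.Nonempty := by
    by_contra h
    have h0 (p : P) : push c z p = 0 := by
      by_contra h'
      exact h ⟨p, (hS p).2 h'⟩
    obtain ⟨j, hj⟩ : ∃ j, 0 < z j := by
      by_contra! hz
      have h1 : ∑ j, z j = 1 := z.2.2
      have : ∑ j, z j ≤ 0 := Finset.sum_nonpos fun j _ ↦ hz j
      linarith
    have : z j ≤ push c z (c j) := by
      have := Finset.single_le_sum (f := fun i ↦ if c i = c j then z i else 0)
        (fun i _ ↦ by split_ifs; exacts [z.2.1 i, le_rfl]) (Finset.mem_univ j)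
      simpa [push] using this
    rw [h0] at this
    linarith
  have hc : IsChain (· ≤ ·) (S : Set P) := (isChain_range_orderHom c).mono fun p hp ↦ by
    obtain ⟨i, hi, -⟩ := exists_of_push_ne_zero ((hS p).1 hp)
    exact ⟨i, hi⟩
  obtain ⟨l, e, he, hr⟩ := FinChain.exists_orderHom ⟨S, hne, hc⟩
  refine ⟨l, e, he, fun p ↦ (hS p).symm.trans ?_⟩
  rw [← FinChain.mem_range, hr]

/-- The support of the coordinates is a chain, and both points have a normal form on this chain
determined by the coordinates. -/
lemma coord_injective : Function.Injective (coord i) := by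
  intro y y' h
  obtain ⟨⟨⟨k⟩⟩, s, z, rfl⟩ := exists_pt y
  obtain ⟨⟨⟨k'⟩⟩, s', z', rfl⟩ := exists_pt y'
  rw [coord_pt, coord_pt] at h
  obtain ⟨l, e, he, hl⟩ := exists_enumeration (ordNerve.seq (i.app _ s)) z
  obtain ⟨s₁, z₁, h1, h2, h3⟩ := pt_eq_of_enumeration i s z e he hl
  rw [h] at hl
  obtain ⟨s₂, z₂, h1', h2', h3'⟩ := pt_eq_of_enumeration i s' z' e he hl
  obtain rfl : s₁ = s₂ := app_injective_of_mono i _ (h1.trans h1'.symm)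
  obtain rfl : z₁ = z₂ := _root_.stdSimplex.ext (funext fun j ↦ by rw [h2, h2', h])
  exact h3.trans h3'.symm

lemma compactSpace_realization (i : X ⟶ ordNerve P) [Mono i] [Finite P] : CompactSpace |X| := by
  have hf (k : ℕ) : Finite (X _⦋k⦌) :=
    Finite.of_injective (β := Fin (k + 1) → P) (fun s ↦ ordNerve.seq (i.app _ s)) fun s s' h ↦
      app_injective_of_mono i _ (ordNerve.simplex_ext (congrFun h))
  have hK : IsCompact (⋃ k : Fin (Nat.card P + 1), ⋃ s : X _⦋k⦌, Set.range (pt s)) :=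
    isCompact_iUnion fun k ↦ isCompact_iUnion fun s ↦ isCompact_range (pt s).continuous
  refine ⟨hK.of_isClosed_subset isClosed_univ fun y _ ↦ ?_⟩
  obtain ⟨⟨⟨k⟩⟩, s, z, rfl⟩ := exists_pt y
  obtain ⟨l, e, he, hl⟩ := exists_enumeration (ordNerve.seq (i.app _ s)) z
  obtain ⟨s₁, z₁, h1, h2, h3⟩ := pt_eq_of_enumeration i s z e he hl
  have hcard : l + 1 ≤ Nat.card P := by
    simpa using Nat.card_le_card_of_injective e he.injective
  exact Set.mem_iUnion.2 ⟨⟨l, by omega⟩, Set.mem_iUnion.2 ⟨s₁, z₁, h3.symm⟩⟩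

lemma isClosedEmbedding_coord [Finite P] : Topology.IsClosedEmbedding (coord i) := by
  have := compactSpace_realization i
  exact (coord i).continuous.isClosedEmbedding (coord_injective i)

end coord

end SSet

/-! ### Singular simplicial sets are Kan -/

namespace SSet
open HomotopicalAlgebra Opposite Limits
open scoped SSet.modelCategoryQuillen

section simplexCoord

variable {A : SSet.{u}} {n : ℕ}

/-- The monotone map underlying a simplex of a standard simplex. -/
def vert {m : SimplexCategoryᵒᵖ} (s : (Δ[n] : SSet.{u}).obj m) : Fin (m.unop.len + 1) →o Fin (n + 1) :=
  (stdSimplex.objEquiv s).toOrderHom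

lemma vert_injective {m : SimplexCategoryᵒᵖ} :
    Function.Injective (vert : (Δ[n] : SSet.{u}).obj m → _) := fun s t h ↦
  stdSimplex.objEquiv.injective (by ext i : 3; exact congrFun (congrArg DFunLike.coe h) i)

/-- Barycentric coordinates on a simplicial set over a standard simplex. -/
noncomputable def simplexCoord (i : A ⟶ Δ[n]) : C(|A|, Fin (n + 1) → ℝ) :=
  ContinuousMap.comp ⟨fun w j ↦ w ⟨j⟩, by fun_prop⟩ (coord (i ≫ (stdSimplex.isoOrdNerve.{u} n).hom))

lemma simplexCoord_pt (i : A ⟶ Δ[n]) {m} (s : A.obj m) (z) :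
    simplexCoord i (pt s z) = push (vert (i.app m s)) z := by
  ext j
  change coord _ (pt s z) _ = _
  rw [coord_pt]
  exact push_apply_of_injective (ULift.up_injective (α := Fin (n + 1))) (push (vert (i.app m s)) z) j ▸
    congrFun (push_comp (ULift.up (α := Fin (n + 1))) (vert (i.app m s)) z) ⟨j⟩

lemma isClosedEmbedding_simplexCoord (i : A ⟶ Δ[n]) [Mono i] :
    Topology.IsClosedEmbedding (simplexCoord i) := by
  have h1 := isClosedEmbedding_coord (i ≫ (stdSimplex.isoOrdNerve.{u} n).hom)
  have h2 : Topology.IsClosedEmbedding fun (w : ULift.{u} (Fin (n + 1)) → ℝ) (j : Fin (n + 1)) ↦ w ⟨j⟩ :=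
    (Homeomorph.piCongrLeft (Y := fun _ ↦ ℝ) (Equiv.ulift.{u} (α := Fin (n + 1)))).isClosedEmbedding
  exact h2.comp h1

/-- Extension of maps to a singular simplicial set along a subcomplex of a simplex which is a
retract. -/
lemma exists_extension_of_retract (i : A ⟶ Δ[n]) [Mono i] (r : TopSimplex n → TopSimplex n)
    (hr : Continuous r) (h1 : ∀ w, ∃ (m : SimplexCategoryᵒᵖ) (s : A.obj m) (z : TopSimplex m.unop.len),
      push (vert (i.app m s)) z = (r w : Fin (n + 1) → ℝ))
    (h2 : ∀ (m : SimplexCategoryᵒᵖ) (s : A.obj m) (w : TopSimplex n) (z : TopSimplex m.unop.len),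
      (w : Fin (n + 1) → ℝ) = push (vert (i.app m s)) z → r w = w)
    {T : TopCat.{u}} (f : A ⟶ TopCat.toSSet.obj T) :
    ∃ g : Δ[n] ⟶ TopCat.toSSet.obj T, i ≫ g = f := by
  have emb := isClosedEmbedding_simplexCoord i
  have h3 (w : TopSimplex n) : ∃ y : |A|, simplexCoord i y = r w := by
    obtain ⟨m, s, z, h⟩ := h1 w
    exact ⟨pt s z, (simplexCoord_pt i s z).trans h⟩
  choose ρ hρ using h3
  have hc : Continuous ρ := by
    refine emb.isInducing.continuous_iff.2 ?_
    rw [show ⇑(simplexCoord i) ∘ ρ = fun w ↦ (r w : Fin (n + 1) → ℝ) from funext hρ]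
    exact continuous_subtype_val.comp hr
  let x : (TopCat.toSSet.obj T).obj (op ⦋n⦌) := mkSing ⟨fun w ↦ (realize f).hom (ρ w),
    (realize f).hom.continuous.comp hc⟩
  refine ⟨yonedaEquiv.symm x, hom_sing_ext fun m s z ↦ ?_⟩
  change ev ((TopCat.toSSet.obj T).map (stdSimplex.objEquiv (i.app m s)).op x) z = _
  rw [ev_map, ev_mkSing, ← realize_pt]
  change (realize f).hom (ρ _) = _
  refine congrArg _ (emb.injective ?_)
  rw [hρ, simplexCoord_pt, h2 m s _ z]
  all_goals exact coe_map_eq_push _ _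

end simplexCoord

section kan

variable {n : ℕ} (i : Fin (n + 2))

lemma erase_nonempty : (Finset.univ.erase i).Nonempty := by
  obtain ⟨j, hj⟩ := exists_ne i
  exact ⟨j, by simp [hj]⟩

/-- The smallest coordinate apart from a given one. -/
noncomputable def minCoord (z : Fin (n + 2) → ℝ) : ℝ :=
  (Finset.univ.erase i).inf' (erase_nonempty i) z

lemma minCoord_le (z : Fin (n + 2) → ℝ) {j : Fin (n + 2)} (hj : j ≠ i) : minCoord i z ≤ z j :=
  Finset.inf'_le _ (by simp [hj])

lemma exists_minCoord_eq (z : Fin (n + 2) → ℝ) : ∃ j, j ≠ i ∧ minCoord i z = z j := by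
  obtain ⟨j, hj, h⟩ := Finset.exists_mem_eq_inf' (erase_nonempty i) z
  exact ⟨j, by simpa using hj, h⟩

lemma minCoord_nonneg {z : Fin (n + 2) → ℝ} (hz : ∀ j, 0 ≤ z j) : 0 ≤ minCoord i z := by
  obtain ⟨j, -, hj⟩ := exists_minCoord_eq i z
  rw [hj]
  exact hz j

lemma continuous_minCoord : Continuous (minCoord i) := by
  unfold minCoord
  exact Continuous.finset_inf'_apply _ fun j _ ↦ continuous_apply j

/-- The retraction of a topological simplex onto a horn. -/
noncomputable def hornRetraction (z : TopSimplex (n + 1)) : TopSimplex (n + 1) :=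
  -- The `n + 1` coordinates other than `i` each give up their minimum, and `i` receives the total.
  -- Some coordinate other than `i` then vanishes. On the horn the minimum is `0`, so its points are
  -- fixed.
  ⟨fun j ↦ if j = i then z i + (n + 1) * minCoord i z else z j - minCoord i z, by
    intro j
    have h0 := minCoord_nonneg i z.2.1
    have h1 := z.2.1 i
    dsimp only
    split_ifs with h
    · positivity
    · exact sub_nonneg.2 (minCoord_le i z h), by
    have h1 : ∑ j, z j = 1 := z.2.2
    rw [← Finset.add_sum_erase _ _ (Finset.mem_univ i)] at h1 ⊢
    rw [if_pos rfl, Finset.sum_congr rfl (g := fun j ↦ z j - minCoord i z) (fun j hj ↦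
      if_neg (Finset.ne_of_mem_erase hj)), Finset.sum_sub_distrib, Finset.sum_const,
      Finset.card_erase_of_mem (Finset.mem_univ i), Finset.card_univ, Fintype.card_fin]
    simp only [Nat.add_one_sub_one, nsmul_eq_mul]
    push_cast
    linarith⟩

lemma continuous_hornRetraction : Continuous (hornRetraction i) := by
  have h : Continuous fun z : TopSimplex (n + 1) ↦ minCoord i z :=
    (continuous_minCoord i).comp continuous_subtype_val
  have hz (j) : Continuous fun z : TopSimplex (n + 1) ↦ z j :=
    (continuous_apply j).comp continuous_subtype_val
  refine Continuous.subtype_mk (continuous_pi fun j ↦ ?_) _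
  split_ifs
  · exact (hz i).add (continuous_const.mul h)
  · exact (hz j).sub h

/-- A point of a face of a topological simplex. -/
lemma exists_push_succAbove {j : Fin (n + 2)} (w : TopSimplex (n + 1)) (hw : w j = 0) :
    ∃ z : TopSimplex n, push j.succAbove z = (w : Fin (n + 2) → ℝ) := by
  have hs : ∑ k, w (j.succAbove k) = 1 := by
    have := Fin.sum_univ_succAbove w j
    rw [hw, zero_add] at this
    rw [← this]
    exact w.2.2
  refine ⟨⟨fun k ↦ w (j.succAbove k), fun k ↦ w.2.1 _, hs⟩, ?_⟩
  ext k
  obtain rfl | ⟨k, rfl⟩ := Fin.eq_self_or_eq_succAbove j k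
  · rw [push_eq_zero _ fun k h ↦ absurd h (Fin.succAbove_ne _ _)]
    exact hw.symm
  · rw [push_apply_of_injective Fin.succAbove_right_injective]
    rfl

lemma vert_δ (j : Fin (n + 2)) :
    ⇑(vert (stdSimplex.objEquiv.symm (SimplexCategory.δ j) : (Δ[n + 1] : SSet.{u}) _⦋n⦌)) =
      j.succAbove := by
  ext k
  rfl

lemma exists_horn_filler {T : TopCat.{u}} (f : (horn.{u} (n + 1) i : SSet.{u}) ⟶ TopCat.toSSet.obj T) :
    ∃ g : Δ[n + 1] ⟶ TopCat.toSSet.obj T, (horn (n + 1) i).ι ≫ g = f := by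
  refine exists_extension_of_retract _ (hornRetraction i) (continuous_hornRetraction i) ?_ ?_ f
  · intro w
    obtain ⟨j, hj, h⟩ := exists_minCoord_eq i w
    obtain ⟨z, hz⟩ := exists_push_succAbove (j := j) (hornRetraction i w) (by
      change ite _ _ _ = _
      rw [if_neg hj, h]
      exact sub_self _)
    refine ⟨op ⦋n⦌, ⟨stdSimplex.objEquiv.symm (SimplexCategory.δ j),
      (objEquiv_symm_δ_mem_horn_iff _ _).2 hj⟩, z, ?_⟩
    rw [← hz, ← vert_δ.{u}]
    rfl
  · intro m s w z hw
    have hs := s.2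
    rw [mem_horn_iff] at hs
    obtain ⟨j, hj⟩ : ∃ j, j ∉ Set.range (vert s.1) ∪ {i} := by
      by_contra! h
      exact hs (Set.eq_univ_of_forall h)
    rw [Set.mem_union, not_or] at hj
    have h0 : w j = 0 := by
      refine (congrFun hw j).trans ?_
      exact push_eq_zero _ fun k hk ↦ (hj.1 ⟨k, hk⟩).elim
    have hm : minCoord i w = 0 := le_antisymm ((minCoord_le i w hj.2).trans_eq h0)
      (minCoord_nonneg i w.2.1)
    ext k
    change ite _ _ _ = _
    rw [hm]
    split_ifs with h
    · rw [h, mul_zero, add_zero]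
    · rw [sub_zero]

instance kanComplex_sing (T : TopCat.{u}) : KanComplex (TopCat.toSSet.obj T) := by
  refine (isFibrant_iff _).2 ((modelCategoryQuillen.fibration_iff _).2 fun A X j hj ↦ ?_)
  simp only [modelCategoryQuillen.J, MorphismProperty.iSup_iff] at hj
  obtain ⟨n, ⟨i⟩⟩ := hj
  refine hasLiftingProperty_of_exists fun f v _ ↦ ?_
  obtain ⟨g, hg⟩ := exists_horn_filler i f
  exact ⟨g, hg, terminal.hom_ext _ _⟩

end kan

end SSet

/-! ### The product of a topological simplex with the interval -/

namespace SSet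
open HomotopicalAlgebra Opposite Limits
open scoped SSet.modelCategoryQuillen

section existence

variable {Q : Type u} [PartialOrder Q] [Fintype Q]

lemma exists_coord_eq (w : Q → ℝ) (h0 : ∀ q, 0 ≤ w q) (h1 : ∑ q, w q = 1)
    (hc : IsChain (· ≤ ·) {q | w q ≠ 0}) : ∃ y : |ordNerve Q|, coord (𝟙 (ordNerve Q)) y = w := by
  classical
  let S : Finset Q := Finset.univ.filter fun q ↦ w q ≠ 0
  have hS (q : Q) : q ∈ S ↔ w q ≠ 0 := by simp [S]
  have hne : S.Nonempty := by
    by_contra h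
    have : ∑ q, w q = 0 := Finset.sum_eq_zero fun q _ ↦ by
      by_contra h'
      exact h ⟨q, (hS q).2 h'⟩
    rw [h1] at this
    exact one_ne_zero this
  obtain ⟨l, e, he, hr⟩ := FinChain.exists_orderHom ⟨S, hne, hc.mono fun q hq ↦ (hS q).1 hq⟩
  have hr' (q : Q) : w q ≠ 0 ↔ ∃ j, e j = q := by
    rw [← hS, ← FinChain.mem_range, hr]
  have hp : push e (fun j ↦ w (e j)) = w := by
    ext q
    by_cases hq : w q = 0
    · rw [hq]
      exact push_eq_zero _ fun j hj ↦ by rw [hj, hq]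
    · obtain ⟨j, rfl⟩ := (hr' q).1 hq
      rw [push_apply_of_injective he.injective]
  let z : TopSimplex l := ⟨fun j ↦ w (e j), fun j ↦ h0 _, by rw [← sum_push e, hp, h1]⟩
  exact ⟨pt (X := ordNerve Q) (n := op ⦋l⦌) e z, (coord_pt _ _ _).trans hp⟩

end existence

section prism

variable {m n : ℕ}

/-- The vertices of a prism. -/
abbrev PrismVertex (n : ℕ) : Type u := ULift.{u} (Fin (n + 1) × Fin 2)

/-- Portion of a coordinate below a given level. -/
noncomputable def lowPart (z : Fin (n + 1) → ℝ) (s : ℝ) (i : Fin (n + 1)) : ℝ :=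
  min (∑ j ∈ Finset.Iic i, z j) s - min (∑ j ∈ Finset.Iio i, z j) s

lemma sum_Iic_eq (z : Fin (n + 1) → ℝ) (i : Fin (n + 1)) :
    ∑ j ∈ Finset.Iic i, z j = z i + ∑ j ∈ Finset.Iio i, z j := by
  rw [← Finset.Iio_insert, Finset.sum_insert (by simp)]

lemma lowPart_nonneg {z : Fin (n + 1) → ℝ} (hz : ∀ i, 0 ≤ z i) (s : ℝ) (i) : 0 ≤ lowPart z s i := by
  rw [lowPart, sub_nonneg, sum_Iic_eq]
  exact min_le_min_right _ (le_add_of_nonneg_left (hz i))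

lemma lowPart_le {z : Fin (n + 1) → ℝ} (hz : ∀ i, 0 ≤ z i) (s : ℝ) (i) : lowPart z s i ≤ z i := by
  rw [lowPart, sum_Iic_eq]
  have := hz i
  rcases min_cases (z i + ∑ j ∈ Finset.Iio i, z j) s with h | h <;>
    rcases min_cases (∑ j ∈ Finset.Iio i, z j) s with h' | h' <;> linarith

lemma sum_lowPart (z : Fin (n + 1) → ℝ) {s : ℝ} (hs : 0 ≤ s) (D : Finset (Fin (n + 1)))
    (hD : IsLowerSet (D : Set (Fin (n + 1)))) :
    ∑ i ∈ D, lowPart z s i = min (∑ i ∈ D, z i) s := by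
  classical
  induction D using Finset.induction_on_max with
  | empty => simp [hs]
  | insert a D ha ih =>
    have hD' : D = Finset.Iio a := by
      ext i
      rw [Finset.mem_Iio]
      refine ⟨ha i, fun hi ↦ ?_⟩
      have : i ∈ insert a D := hD hi.le (Finset.mem_insert_self _ _)
      exact (Finset.mem_insert.1 this).resolve_left hi.ne
    have hn : a ∉ D := fun h ↦ lt_irrefl _ (ha a h)
    rw [Finset.sum_insert hn, Finset.sum_insert hn, ih (by
      rw [hD', Finset.coe_Iio]
      exact isLowerSet_Iio a), lowPart, sum_Iic_eq, hD']
    ring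

/-- Sums of `lowPart` over lower sets are truncated sums of `z`, and preimages of lower sets under
the monotone map `a` are lower sets. Single values are differences of two such sums. -/
lemma lowPart_push (a : Fin (m + 1) →o Fin (n + 1)) (z : Fin (m + 1) → ℝ) {s : ℝ} (hs : 0 ≤ s) :
    lowPart (push a z) s = push a (lowPart z s) := by
  classical
  have key (E : Finset (Fin (n + 1))) (w : Fin (m + 1) → ℝ) :
      ∑ k ∈ E, push a w k = ∑ i with a i ∈ E, w i := by
    simp only [push]
    rw [Finset.sum_comm, Finset.sum_filter]
    refine Finset.sum_congr rfl fun i _ ↦ ?_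
    split_ifs with h
    · exact (Finset.sum_eq_single_of_mem _ h fun k _ hk ↦ if_neg hk.symm).trans (if_pos rfl)
    · exact Finset.sum_eq_zero fun k hk ↦ if_neg fun e : a i = k ↦ h (e ▸ hk)
  have low (E : Finset (Fin (n + 1))) (hE : IsLowerSet (E : Set (Fin (n + 1)))) :
      ∑ k ∈ E, push a (lowPart z s) k = min (∑ k ∈ E, push a z k) s := by
    rw [key, key, sum_lowPart z hs]
    intro i j hij hi
    simp only [Finset.coe_filter, Finset.mem_univ, true_and, Set.mem_ofPred_eq] at hi ⊢
    exact hE (a.monotone hij) hi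
  ext k
  have h1 := low (Finset.Iic k) (by rw [Finset.coe_Iic]; exact isLowerSet_Iic k)
  have h2 := low (Finset.Iio k) (by rw [Finset.coe_Iio]; exact isLowerSet_Iio k)
  rw [sum_Iic_eq] at h1
  rw [lowPart, ← h1, ← h2]
  ring

/-- Barycentric coordinates of a point of a prism. -/
noncomputable def prismCoord (z : Fin (n + 1) → ℝ) (t : ℝ) (q : PrismVertex.{u} n) : ℝ :=
  if q.down.2 = 0 then lowPart z (1 - t) q.down.1 else z q.down.1 - lowPart z (1 - t) q.down.1

lemma sum_prismVertex (f : PrismVertex.{u} n → ℝ) :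
    ∑ q, f q = ∑ i, (f ⟨(i, 0)⟩ + f ⟨(i, 1)⟩) := by
  rw [← Equiv.ulift.symm.sum_comp f, Fintype.sum_prod_type]
  exact Finset.sum_congr rfl fun i _ ↦ Fin.sum_univ_two _

lemma continuous_prismCoord : Continuous fun p : TopSimplex n × unitInterval ↦
    (prismCoord p.1 p.2 : PrismVertex.{u} n → ℝ) := by
  have hz (j) : Continuous fun p : TopSimplex n × unitInterval ↦ p.1 j :=
    (continuous_apply j).comp (continuous_subtype_val.comp continuous_fst)
  have hl (i : Fin (n + 1)) : Continuous fun p : TopSimplex n × unitInterval ↦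
      lowPart p.1 (1 - p.2) i := by
    unfold lowPart
    fun_prop
  refine continuous_pi fun q ↦ ?_
  unfold prismCoord
  split_ifs
  · exact hl _
  · exact (hz _).sub (hl _)

lemma exists_prism (z : TopSimplex n) (t : unitInterval) :
    ∃ y : |ordNerve (PrismVertex.{u} n)|, coord (𝟙 _) y = prismCoord z t := by
  refine exists_coord_eq _ (fun q ↦ ?_) ?_ ?_
  · unfold prismCoord
    split_ifs
    · exact lowPart_nonneg z.2.1 _ _
    · exact sub_nonneg.2 (lowPart_le z.2.1 _ _)
  · rw [sum_prismVertex]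
    refine Eq.trans (Finset.sum_congr rfl fun i _ ↦ ?_) z.2.2
    simp only [prismCoord]
    exact add_sub_cancel _ _
  -- With the masses of the vertices stacked in order, a vertex with mass below the level `1 - t`
  -- cannot come after one with mass above it. Hence the support is a chain of the prism.
  · have key (i j : Fin (n + 1)) (hi : lowPart z (1 - t) i ≠ 0)
        (hj : z j - lowPart z (1 - t) j ≠ 0) : i ≤ j := by
      by_contra! hij
      have h1 : ∑ k ∈ Finset.Iic j, z k ≤ ∑ k ∈ Finset.Iio i, z k :=
        Finset.sum_le_sum_of_subset_of_nonneg (fun k hk ↦ Finset.mem_Iio.2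
          ((Finset.mem_Iic.1 hk).trans_lt hij)) fun k _ _ ↦ z.2.1 k
      have h2 := sum_Iic_eq z i
      have h3 := sum_Iic_eq z j
      have h4 := z.2.1 i
      have h5 := z.2.1 j
      unfold lowPart at hi hj
      by_cases h6 : ∑ k ∈ Finset.Iic j, z k ≤ 1 - t
      · refine hj ?_
        rw [min_eq_left h6, min_eq_left (by change 0 ≤ z j at h5; linarith)]
        linarith
      · refine hi ?_
        rw [min_eq_right (by change 0 ≤ z i at h4; linarith), min_eq_right (by linarith), sub_self]
    rintro ⟨⟨i, e⟩⟩ hi ⟨⟨j, e'⟩⟩ hj -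
    have hij := le_total i j
    match e, e', hi, hj with
    | 0, 0, _, _ => exact hij.imp (fun h ↦ ⟨h, le_rfl⟩) fun h ↦ ⟨h, le_rfl⟩
    | 1, 1, _, _ => exact hij.imp (fun h ↦ ⟨h, le_rfl⟩) fun h ↦ ⟨h, le_rfl⟩
    | 0, 1, hi, hj => exact Or.inl ⟨key i j hi hj, Fin.zero_le _⟩
    | 1, 0, hi, hj => exact Or.inr ⟨key j i hj hi, Fin.zero_le _⟩

/-- The product of a topological simplex and the interval maps to the realization of the prism. -/
noncomputable def prism (n : ℕ) : C(TopSimplex n × unitInterval, |ordNerve (PrismVertex.{u} n)|) where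
  toFun p := (exists_prism p.1 p.2).choose
  continuous_toFun := by
    refine (isClosedEmbedding_coord (𝟙 (ordNerve (PrismVertex.{u} n)))).isInducing.continuous_iff.2 ?_
    refine continuous_prismCoord.congr fun p ↦ ?_
    exact (exists_prism p.1 p.2).choose_spec.symm

lemma coord_prism (z : TopSimplex n) (t : unitInterval) :
    coord (𝟙 _) (prism.{u} n (z, t)) = prismCoord z t := (exists_prism z t).choose_spec

lemma coord_toTop_map {P Q : Type u} [PartialOrder P] [Fintype P] [PartialOrder Q] (f : P →o Q)
    (y : |ordNerve P|) :
    coord (𝟙 _) ((toTop.map (ordNerve.map f)).hom y) = push f (coord (𝟙 _) y) := by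
  obtain ⟨n, s, z, rfl⟩ := exists_pt y
  rw [toTop_map_pt, coord_pt, coord_pt, ← push_comp]
  rfl

lemma prism_naturality (a : Fin (m + 1) →o Fin (n + 1)) (f : PrismVertex.{u} m →o PrismVertex.{u} n)
    (hf : ∀ q, f q = ⟨(a q.down.1, q.down.2)⟩) (z : TopSimplex m) (t : unitInterval) :
    (toTop.map (ordNerve.map f)).hom (prism m (z, t)) = prism n (stdSimplex.map a z, t) := by
  refine coord_injective (𝟙 _) ?_
  rw [coord_toTop_map, coord_prism, coord_prism, coe_map_eq_push]
  have hs : (0 : ℝ) ≤ 1 - t := sub_nonneg.2 t.2.2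
  have hf' : ⇑f = fun q ↦ ⟨(a q.down.1, q.down.2)⟩ := funext hf
  ext ⟨⟨j, e⟩⟩
  unfold push
  rw [sum_prismVertex]
  have h1 := congrFun (lowPart_push a z hs) j
  fin_cases e
  · refine Eq.trans (Finset.sum_congr rfl fun i _ ↦ ?_) h1.symm
    simp [hf', prismCoord]
  · have h2 : (push a z j - push a (lowPart z (1 - t)) j) =
        ∑ i, (if a i = j then z i - lowPart z (1 - t) i else 0) := by
      rw [push, push, ← Finset.sum_sub_distrib]
      refine Finset.sum_congr rfl fun i _ ↦ ?_
      split_ifs <;> simp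
    have h3 : prismCoord (push a z) t (⟨(j, 1)⟩ : PrismVertex.{u} n) =
        push a z j - lowPart (push a z) (1 - t) j := rfl
    refine Eq.trans (Finset.sum_congr rfl fun i _ ↦ ?_) (h2.symm.trans (h1 ▸ h3.symm))
    simp [hf', prismCoord]

end prism

end SSet

/-! ### Comparison of cylinders, and realization of homotopies -/

namespace SSet
open HomotopicalAlgebra Opposite Limits
open scoped SSet.modelCategoryQuillen

lemma hom_ext_app {X Y : SSet.{u}} {f g : X ⟶ Y} (h : ∀ n (x : X.obj n), f.app n x = g.app n x) :
    f = g := by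
  ext n x
  exact h n x

section cylinder

variable {X Y : SSet.{u}} {n m : SimplexCategoryᵒᵖ}

/-- The prism on a simplex. -/
noncomputable def prismMap (s : X.obj n) : ordNerve (PrismVertex.{u} n.unop.len) ⟶ X ⊗ Δ[1] where
  app m := ↾fun (c : Fin (m.unop.len + 1) →o PrismVertex.{u} n.unop.len) ↦
    (X.map (Quiver.Hom.op (SimplexCategory.Hom.mk
      ⟨fun i ↦ (c i).down.1, fun _ _ h ↦ (c.monotone h).1⟩ : m.unop ⟶ n.unop)) s,
      stdSimplex.objMk ⟨fun i ↦ (c i).down.2, fun _ _ h ↦ (c.monotone h).2⟩)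
  naturality m m' α := by
    ext (c : Fin (m.unop.len + 1) →o PrismVertex.{u} n.unop.len)
    refine Prod.ext ?_ rfl
    exact Functor.map_comp_apply X (Quiver.Hom.op (SimplexCategory.Hom.mk
      ⟨fun i ↦ (c i).down.1, fun _ _ h ↦ (c.monotone h).1⟩ : m.unop ⟶ n.unop)) α s

/-- The map of prisms induced by an operator. -/
def prismOp {k l : ℕ} (a : Fin (k + 1) →o Fin (l + 1)) : PrismVertex.{u} k →o PrismVertex.{u} l where
  toFun q := ⟨(a q.down.1, q.down.2)⟩
  monotone' _ _ h := ⟨a.monotone h.1, h.2⟩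

lemma prismMap_map (α : n ⟶ m) (s : X.obj n) :
    prismMap (X.map α s) = ordNerve.map (prismOp α.unop.toOrderHom) ≫ prismMap s := by
  refine hom_ext_app (fun k (c : Fin (k.unop.len + 1) →o PrismVertex.{u} m.unop.len) ↦ Prod.ext ?_ rfl)
  exact (Functor.map_comp_apply X α (Quiver.Hom.op (SimplexCategory.Hom.mk
      ⟨fun i ↦ (c i).down.1, fun _ _ h ↦ (c.monotone h).1⟩ : k.unop ⟶ m.unop)) s).symm

lemma prismMap_app (f : X ⟶ Y) (s : X.obj n) :
    prismMap (f.app n s) = prismMap s ≫ f ▷ _ := by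
  refine hom_ext_app (fun k (c : Fin (k.unop.len + 1) →o PrismVertex.{u} n.unop.len) ↦ Prod.ext ?_ rfl)
  exact (NatTrans.naturality_apply f (Quiver.Hom.op (SimplexCategory.Hom.mk
      ⟨fun i ↦ (c i).down.1, fun _ _ h ↦ (c.monotone h).1⟩ : k.unop ⟶ n.unop)) s).symm

/-- The comparison map of cylinders, curried and on simplices. -/
noncomputable def cylSing (X : SSet.{u}) :
    X ⟶ TopCat.toSSet.obj (TopCat.of C(unitInterval, |X ⊗ Δ[1]|)) :=
  -- Currying turns a map out of `|X| × I` into a map out of `|X|` alone, which may be given simplex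
  -- by simplex.
  toSing (fun n s ↦ ContinuousMap.curry ((toTop.map (prismMap s)).hom.comp (prism n.unop.len)))
    fun {n m} α s z ↦ by
      refine ContinuousMap.ext fun t ↦ ?_
      change (toTop.map (prismMap (X.map α s))).hom (prism _ (z, t)) =
        (toTop.map (prismMap s)).hom (prism _ (_, t))
      rw [prismMap_map, Functor.map_comp, ← prism_naturality (α.unop.toOrderHom) (prismOp _)
        (fun _ ↦ rfl)]
      rfl

/-- The comparison map from the topological cylinder. -/
noncomputable def kappa (X : SSet.{u}) : C(|X| × unitInterval, |X ⊗ Δ[1]|) :=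
  ContinuousMap.uncurry (realize (cylSing X)).hom

lemma kappa_pt (s : X.obj n) (z) (t : unitInterval) :
    kappa X (pt s z, t) = (toTop.map (prismMap s)).hom (prism _ (z, t)) := by
  have := realize_pt (cylSing X) s z
  rw [cylSing, ev_toSing] at this
  exact congrArg (fun f : C(unitInterval, |X ⊗ Δ[1]|) ↦ f t) this

lemma kappa_naturality (f : X ⟶ Y) (y : |X|) (t : unitInterval) :
    (toTop.map (f ▷ Δ[1])).hom (kappa X (y, t)) = kappa Y ((toTop.map f).hom y, t) := by
  obtain ⟨n, s, z, rfl⟩ := exists_pt y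
  rw [kappa_pt, toTop_map_pt, kappa_pt, prismMap_app, Functor.map_comp]
  rfl

/-- An end of a prism as a simplex. -/
def prismEnd (k : ℕ) (e : Fin 2) : (ordNerve (PrismVertex.{u} k)) _⦋k⦌ :=
  (⟨fun i ↦ ⟨(i, e)⟩, fun _ _ h ↦ ⟨h, le_rfl⟩⟩ : Fin (k + 1) →o PrismVertex.{u} k)

/-- An end of the unit interval. -/
noncomputable def intervalEnd (e : Fin 2) : unitInterval := if e = 0 then 0 else 1

lemma prism_end {k : ℕ} (z : TopSimplex k) (e : Fin 2) :
    prism.{u} k (z, intervalEnd e) = pt (prismEnd k e) z := by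
  refine coord_injective (𝟙 _) ?_
  rw [coord_prism, coord_pt]
  have hsum (i : Fin (k + 1)) (D : Finset (Fin (k + 1))) : ∑ j ∈ D, z j ≤ 1 := by
    refine le_trans ?_ z.2.2.le
    exact Finset.sum_le_sum_of_subset_of_nonneg (Finset.subset_univ D) fun j _ _ ↦ z.2.1 j
  have hpos (D : Finset (Fin (k + 1))) : 0 ≤ ∑ j ∈ D, z j := Finset.sum_nonneg fun j _ ↦ z.2.1 j
  have l0 (i) : lowPart z (1 - 0) i = z i := by
    rw [lowPart, sub_zero, min_eq_left (hsum i _), min_eq_left (hsum i _), sum_Iic_eq]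
    exact add_sub_cancel_right _ _
  have l1 (i) : lowPart z (1 - 1) i = 0 := by
    rw [lowPart, sub_self, min_eq_right (hpos _), min_eq_right (hpos _), sub_self]
  have hinj : Function.Injective (ordNerve.seq (prismEnd.{u} k e)) := fun i j h ↦
    congrArg (fun q ↦ q.down.1) h
  ext ⟨⟨i, e'⟩⟩
  by_cases he : e' = e
  · subst he
    refine Eq.trans ?_ (push_apply_of_injective hinj _ i).symm
    fin_cases e'
    · simpa [prismCoord, intervalEnd] using l0 i
    · simpa [prismCoord, intervalEnd] using l1 i
  · rw [push_eq_zero]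
    · fin_cases e <;> fin_cases e' <;> simp at he
      · have := l0 i
        simp only [sub_zero] at this
        simp [prismCoord, intervalEnd, this]
      · have := l1 i
        simp only [sub_self] at this
        simp [prismCoord, intervalEnd, this]
    · intro j hj
      exact (he (congrArg (fun q ↦ q.down.2) hj).symm).elim

lemma prismMap_prismEnd (s : X.obj n) (e : Fin 2) :
    (prismMap s).app _ (prismEnd n.unop.len e) = (inc e).app n s := by
  refine Prod.ext ?_ rfl
  exact ConcreteCategory.congr_hom (X.map_id n) s

lemma kappa_end (y : |X|) (e : Fin 2) :
    kappa X (y, intervalEnd e) = (toTop.map (inc e)).hom y := by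
  obtain ⟨n, s, z, rfl⟩ := exists_pt y
  rw [kappa_pt, prism_end, toTop_map_pt, toTop_map_pt]
  exact congrArg (fun x ↦ pt x z) (prismMap_prismEnd s e)

/-- The characteristic map of a simplex, on nerves. -/
noncomputable def charMap (s : X.obj n) : ordNerve (ULift.{u} (Fin (n.unop.len + 1))) ⟶ X where
  app m := ↾fun (c : Fin (m.unop.len + 1) →o ULift.{u} (Fin (n.unop.len + 1))) ↦
    X.map (Quiver.Hom.op (SimplexCategory.Hom.mk
      ⟨fun i ↦ (c i).down, fun _ _ h ↦ c.monotone h⟩ : m.unop ⟶ n.unop)) s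
  naturality m m' α := by
    ext (c : Fin (m.unop.len + 1) →o ULift.{u} (Fin (n.unop.len + 1)))
    exact Functor.map_comp_apply X (Quiver.Hom.op (SimplexCategory.Hom.mk
      ⟨fun i ↦ (c i).down, fun _ _ h ↦ c.monotone h⟩ : m.unop ⟶ n.unop)) α s

/-- The projection of a prism. -/
def prismFst (k : ℕ) : PrismVertex.{u} k →o ULift.{u} (Fin (k + 1)) where
  toFun q := ⟨q.down.1⟩
  monotone' _ _ h := h.1

lemma kappa_fst (y : |X|) (t : unitInterval) :
    (toTop.map (fst X Δ[1])).hom (kappa X (y, t)) = y := by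
  obtain ⟨n, s, z, rfl⟩ := exists_pt y
  have h1 : prismMap s ≫ fst X Δ[1] = ordNerve.map (prismFst n.unop.len) ≫ charMap s := rfl
  let v : (ordNerve (ULift.{u} (Fin (n.unop.len + 1)))).obj n :=
    (⟨ULift.up, fun _ _ h ↦ h⟩ : Fin (n.unop.len + 1) →o ULift.{u} (Fin (n.unop.len + 1)))
  have h2 : (toTop.map (ordNerve.map (prismFst.{u} n.unop.len))).hom (prism _ (z, t)) = pt v z := by
    refine coord_injective (𝟙 _) ?_
    rw [coord_toTop_map, coord_prism, coord_pt]
    ext ⟨i⟩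
    refine Eq.trans ?_ (push_apply_of_injective (c := ordNerve.seq v) ULift.up_injective z i).symm
    unfold push
    have e0 (j : Fin (n.unop.len + 1)) (e : Fin 2) :
      prismFst.{u} n.unop.len ⟨(j, e)⟩ = ⟨j⟩ := rfl
    rw [sum_prismVertex, Finset.sum_eq_single i]
    · rw [e0, e0, if_pos rfl, if_pos rfl]
      exact add_sub_cancel (lowPart z (1 - t) i) (z i)
    · intro j _ hj
      rw [e0, e0, if_neg fun h ↦ hj (ULift.up_injective h),
        if_neg fun h ↦ hj (ULift.up_injective h), add_zero]
    · simp
  have h3 : (charMap s).app n v = s := ConcreteCategory.congr_hom (X.map_id n) s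
  have h4 : (toTop.map (prismMap s ≫ fst X Δ[1])).hom (prism _ (z, t)) = pt s z := by
    rw [h1, Functor.map_comp]
    change (toTop.map (charMap s)).hom ((toTop.map (ordNerve.map (prismFst _))).hom (prism _ (z, t))) = _
    rw [h2, toTop_map_pt, h3]
  rw [kappa_pt, ← h4, Functor.map_comp]
  rfl

end cylinder

section homotopy

variable {X Y : SSet.{u}} {S T : TopCat.{u}}

lemma realize_comp (f : X ⟶ Y) (τ : Y ⟶ TopCat.toSSet.obj T) :
    realize (f ≫ τ) = toTop.map f ≫ realize τ := by
  refine hom_realization_ext fun n s z ↦ ?_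
  change _ = (realize τ).hom ((toTop.map f).hom (pt s z))
  rw [realize_pt, toTop_map_pt, realize_pt]
  rfl

lemma realize_comp_map (τ : X ⟶ TopCat.toSSet.obj S) (f : S ⟶ T) :
    realize (τ ≫ TopCat.toSSet.map f) = realize τ ≫ f := by
  refine hom_realization_ext fun n s z ↦ ?_
  change _ = f.hom ((realize τ).hom (pt s z))
  rw [realize_pt, realize_pt]
  rfl

lemma realize_toSingTop : realize (toSingTop X) = 𝟙 |X| :=
  hom_realization_ext fun _ s z ↦ realize_pt _ s z

/-- The topological homotopy given by a simplicial homotopy into a singular simplicial set. -/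
noncomputable def realizeHomotopy (H : X ⊗ Δ[1] ⟶ TopCat.toSSet.obj T) :
    C(|X| × unitInterval, T) := (realize H).hom.comp (kappa X)

lemma realizeHomotopy_end (H : X ⊗ Δ[1] ⟶ TopCat.toSSet.obj T) (y : |X|) (e : Fin 2) :
    realizeHomotopy H (y, intervalEnd e) = (realize (inc e ≫ H)).hom y := by
  rw [realize_comp]
  exact congrArg (realize H).hom (kappa_end y e)

lemma realizeHomotopy_comp (f : Y ⟶ X) (H : X ⊗ Δ[1] ⟶ TopCat.toSSet.obj T) (y : |Y|) (t) :
    realizeHomotopy (f ▷ _ ≫ H) (y, t) = realizeHomotopy H ((toTop.map f).hom y, t) := by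
  change (realize (f ▷ _ ≫ H)).hom (kappa Y (y, t)) = (realize H).hom (kappa X (_, t))
  rw [realize_comp, ← kappa_naturality]
  rfl

lemma realizeHomotopy_const (τ : X ⟶ TopCat.toSSet.obj T) (y : |X|) (t) :
    realizeHomotopy (fst X Δ[1] ≫ τ) (y, t) = (realize τ).hom y := by
  change (realize (fst X Δ[1] ≫ τ)).hom (kappa X (y, t)) = _
  rw [realize_comp]
  exact congrArg (realize τ).hom (kappa_fst y t)

/-- The position in the interval given by a point of a simplex over `Δ[1]`. -/
noncomputable def intervalPos {k : ℕ} (θ : Fin (k + 1) → Fin 2) (w : TopSimplex k) : unitInterval :=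
  ⟨push θ w 1, push_nonneg _ w.2.1 _, by
    have h := (sum_push θ w).trans w.2.2
    rw [Fin.sum_univ_two] at h
    have := push_nonneg θ w.2.1 0
    change (0 : ℝ) ≤ push θ w 0 at this
    change push θ w 1 ≤ 1
    linarith⟩

lemma continuous_intervalPos {k : ℕ} (θ : Fin (k + 1) → Fin 2) : Continuous (intervalPos θ) :=
  Continuous.subtype_mk ((continuous_apply 1).comp ((continuous_push θ).comp continuous_subtype_val)) _

lemma intervalPos_const {k : ℕ} (e : Fin 2) (w : TopSimplex k) :
    intervalPos (fun _ ↦ e) w = intervalEnd e := by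
  refine Subtype.ext ?_
  change push (fun _ : Fin (k + 1) ↦ e) w 1 = intervalEnd e
  fin_cases e
  · rw [push_eq_zero _ (by simp)]
    rfl
  · simp [push, intervalEnd]

/-- The simplicial homotopy given by a topological homotopy. -/
noncomputable def singHomotopy (h : C(S × unitInterval, T)) :
    TopCat.toSSet.obj S ⊗ Δ[1] ⟶ TopCat.toSSet.obj T :=
  toSing (fun n x ↦ ⟨fun w ↦ h (ev x.1 w, intervalPos (vert x.2) w),
    h.continuous.comp ((ev x.1).continuous.prodMk (continuous_intervalPos _))⟩) fun {n m} α x w ↦ by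
      change h (ev ((TopCat.toSSet.obj S).map α x.1) w, intervalPos (vert (Δ[1].map α x.2)) w) =
        h (ev x.1 _, intervalPos (vert x.2) _)
      rw [ev_map]
      refine congrArg (fun t ↦ h (_, t)) (Subtype.ext ?_)
      change push (vert (Δ[1].map α x.2)) w 1 =
        push (vert x.2) (stdSimplex.map α.unop.toOrderHom w : TopSimplex n.unop.len) 1
      rw [coe_map_eq_push, ← push_comp]
      rfl

lemma inc_singHomotopy (h : C(S × unitInterval, T)) (e : Fin 2) (f : S ⟶ T)
    (hf : ∀ x, h (x, intervalEnd e) = f.hom x) :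
    inc e ≫ singHomotopy h = TopCat.toSSet.map f := by
  refine hom_sing_ext fun n x w ↦ ?_
  change ev ((singHomotopy h).app n ((inc e).app n x)) w = f.hom (ev x w)
  rw [singHomotopy, ev_toSing, ← hf]
  change h (_, intervalPos (fun _ ↦ e) w) = _
  rw [intervalPos_const]
  rfl

lemma Htpy.map_realize {τ τ' : X ⟶ TopCat.toSSet.obj T} (h : Htpy τ τ') :
    Htpy (TopCat.toSSet.map (realize τ)) (TopCat.toSSet.map (realize τ')) := by
  obtain ⟨H, h0, h1⟩ := h
  exact ⟨singHomotopy (realizeHomotopy H),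
    inc_singHomotopy _ 0 _ fun y ↦ by rw [realizeHomotopy_end, h0],
    inc_singHomotopy _ 1 _ fun y ↦ by rw [realizeHomotopy_end, h1]⟩

/-- The realization of an equivalence induces an equivalence of singular simplicial sets. -/
theorem IsKanEquivalence.map_sing {f : X ⟶ Y} (hf : IsKanEquivalence f) :
    IsKanEquivalence (TopCat.toSSet.map (toTop.map f)) := by
  have h := (isKanEquivalence_iff f).1 hf
  -- As the singular set of `|X|` is Kan, the unit of `X` extends along `f` up to homotopy. The
  -- realization of `g` is a homotopy inverse of the realization of `f`.
  obtain ⟨g, hg⟩ := (h (TopCat.toSSet.obj |X|)).2 (toSingTop X)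
  have nat : toSingTop X ≫ TopCat.toSSet.map (toTop.map f) = f ≫ toSingTop Y :=
    (sSetTopAdj.unit.naturality f).symm
  have hg' : Htpy (g ≫ TopCat.toSSet.map (toTop.map f)) (toSingTop Y) := by
    refine (h (TopCat.toSSet.obj |Y|)).1 _ _ ?_
    rw [← nat, ← Category.assoc]
    exact hg.comp_right _
  refine IsKanEquivalence.of_inverse (g := TopCat.toSSet.map (realize g)) ?_ ?_
  · have := hg.map_realize
    rw [realize_comp, realize_toSingTop, Functor.map_comp, CategoryTheory.Functor.map_id] at this
    exact (IsKanEquivalence.id _).of_htpy' this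
  · have := hg'.map_realize
    rw [realize_comp_map, realize_toSingTop, Functor.map_comp, CategoryTheory.Functor.map_id] at this
    exact (IsKanEquivalence.id _).of_htpy' this

end homotopy

end SSet

/-! ### Affine maps of simplices and their variation -/

namespace SSet
open HomotopicalAlgebra Opposite Limits
open scoped SSet.modelCategoryQuillen

section affine

variable {r m d : ℕ}

open Classical in
/-- The mass of a set of vertices. -/
noncomputable def mass (w : Fin (d + 1) → ℝ) (U : Set (Fin (d + 1))) : ℝ :=
  ∑ k, if k ∈ U then w k else 0

/-- The affine map given by the images of the vertices. -/
noncomputable def comb (g : Fin (r + 1) → TopSimplex d) (w : TopSimplex r) : TopSimplex d :=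
  ⟨fun k ↦ ∑ i, w i * g i k, fun k ↦ Finset.sum_nonneg fun i _ ↦ mul_nonneg (w.2.1 i) ((g i).2.1 k), by
    rw [Finset.sum_comm]
    refine Eq.trans (Finset.sum_congr rfl fun i _ ↦ ?_) w.2.2
    rw [← Finset.mul_sum]
    exact (congrArg _ (g i).2.2).trans (mul_one _)⟩

lemma comb_apply (g : Fin (r + 1) → TopSimplex d) (w : TopSimplex r) (k) :
    comb g w k = ∑ i, w i * g i k := rfl

lemma continuous_comb (g : Fin (r + 1) → TopSimplex d) : Continuous (comb g) := by
  refine Continuous.subtype_mk (continuous_pi fun k ↦ continuous_finsetSum _ fun i _ ↦ ?_) _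
  exact ((continuous_apply i).comp continuous_subtype_val).mul continuous_const

lemma comb_comb (A : Fin (m + 1) → TopSimplex d) (g : Fin (r + 1) → TopSimplex m) (w : TopSimplex r) :
    comb (fun i ↦ comb A (g i)) w = comb A (comb g w) := by
  refine _root_.stdSimplex.ext (funext fun k ↦ ?_)
  simp only [comb_apply, Finset.mul_sum, Finset.sum_mul]
  rw [Finset.sum_comm]
  exact Finset.sum_congr rfl fun _ _ ↦ Finset.sum_congr rfl fun _ _ ↦ (mul_assoc _ _ _).symm

lemma map_apply {k l : ℕ} (a : Fin (k + 1) → Fin (l + 1)) (w : TopSimplex k) (j : Fin (l + 1)) :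
    (stdSimplex.map a w : TopSimplex l) j = push a w j := congrFun (coe_map_eq_push a w) j

lemma map_comb {l : ℕ} (a : Fin (d + 1) → Fin (l + 1)) (g : Fin (r + 1) → TopSimplex d)
    (w : TopSimplex r) :
    (stdSimplex.map a (comb g w) : TopSimplex l) = comb (fun i ↦ stdSimplex.map a (g i)) w := by
  classical
  refine _root_.stdSimplex.ext (funext fun k ↦ ?_)
  simp only [comb_apply, map_apply, push, Finset.mul_sum]
  rw [Finset.sum_comm]
  refine Finset.sum_congr rfl fun i _ ↦ ?_
  split_ifs <;> simp

lemma comb_map {l : ℕ} (a : Fin (l + 1) → Fin (r + 1)) (g : Fin (r + 1) → TopSimplex d)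
    (w : TopSimplex l) :
    comb g (stdSimplex.map a w) = comb (fun i ↦ g (a i)) w := by
  classical
  refine _root_.stdSimplex.ext (funext fun k ↦ ?_)
  simp only [comb_apply, map_apply, push, Finset.sum_mul]
  rw [Finset.sum_comm]
  refine Finset.sum_congr rfl fun i _ ↦ ?_
  simp [ite_mul]

lemma mass_comb (A : Fin (m + 1) → TopSimplex d) (z : TopSimplex m) (U : Set (Fin (d + 1))) :
    mass (comb A z) U = ∑ l, z l * mass (A l) U := by
  classical
  simp only [mass, comb_apply, Finset.mul_sum]
  rw [Finset.sum_comm]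
  refine Finset.sum_congr rfl fun i _ ↦ ?_
  split_ifs <;> simp

lemma mass_map {l : ℕ} (a : Fin (d + 1) → Fin (l + 1)) (w : TopSimplex d) (U : Set (Fin (l + 1))) :
    mass (stdSimplex.map a w : TopSimplex l) U = mass w (a ⁻¹' U) := by
  classical
  simp only [mass, map_apply, push, Set.mem_preimage]
  refine Eq.trans (b := ∑ k, ∑ i, if a i = k then (if a i ∈ U then w i else 0) else 0)
    (Finset.sum_congr rfl fun k _ ↦ ?_) ?_
  · split_ifs with h
    · refine Finset.sum_congr rfl fun i _ ↦ ?_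
      split_ifs with h1 h2 <;> simp_all
    · refine (Finset.sum_eq_zero fun i _ ↦ ?_).symm
      split_ifs with h1 h2 <;> simp_all
  · rw [Finset.sum_comm]
    exact Finset.sum_congr rfl fun i _ ↦ by simp

/-- The total variation of the mass of a set of vertices. -/
noncomputable def tv (g : Fin (r + 1) → TopSimplex d) (U : Set (Fin (d + 1))) : ℝ :=
  ∑ i : Fin r, |mass (g i.succ) U - mass (g i.castSucc) U|

lemma tv_map {l : ℕ} (a : Fin (d + 1) → Fin (l + 1)) (g : Fin (r + 1) → TopSimplex d)
    (U : Set (Fin (l + 1))) :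
    tv (fun i ↦ (stdSimplex.map a (g i) : TopSimplex l)) U = tv g (a ⁻¹' U) := by
  simp only [tv, mass_map]

lemma tv_empty (g : Fin (r + 1) → TopSimplex d) : tv g ∅ = 0 := by simp [tv, mass]

lemma abs_sub_le_sum {r : ℕ} (f : Fin (r + 1) → ℝ) (i : Fin (r + 1)) :
    |f i - f 0| ≤ ∑ l : Fin r, |f l.succ - f l.castSucc| := by
  induction r with
  | zero => rw [Subsingleton.elim (α := Fin 1) i 0]; simp
  | succ r ih =>
    rw [Fin.sum_univ_succ]
    induction i using Fin.cases with
    | zero =>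
      rw [sub_self, abs_zero]
      exact add_nonneg (abs_nonneg _) (Finset.sum_nonneg fun _ _ ↦ abs_nonneg _)
    | succ i =>
      refine (abs_sub_le _ (f (Fin.succ 0)) _).trans ?_
      rw [add_comm]
      exact add_le_add le_rfl (ih (fun i ↦ f i.succ) i)

lemma eq_mass_sub (w : Fin (d + 1) → ℝ) (k : Fin (d + 1)) :
    w k = mass w (Set.Ici k) - mass w (Set.Ioi k) := by
  classical
  rw [mass, mass, ← Finset.sum_sub_distrib, Finset.sum_eq_single k]
  · simp
  · intro j _ hj
    by_cases h : k < j
    · simp [h, h.le]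
    · have : ¬ k ≤ j := fun h' ↦ h (lt_of_le_of_ne h' hj.symm)
      simp [h, this]
  · simp

/-- Each coordinate is a difference of the masses of two upper sets, and either mass changes by at
most `ε` along the list of vertices. -/
lemma dist_comb_le (g : Fin (r + 1) → TopSimplex d) {ε : ℝ}
    (hg : ∀ U, IsUpperSet U → tv g U ≤ ε) (w : TopSimplex r) : dist (comb g w) (g 0) ≤ 2 * ε := by
  have h0 : 0 ≤ ε := (Finset.sum_nonneg fun _ _ ↦ abs_nonneg _).trans (hg ∅ isUpperSet_empty)
  have h1 (i k) : |g i k - g 0 k| ≤ 2 * ε := by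
    have e1 := (abs_sub_le_sum (fun i ↦ mass (g i) (Set.Ici k)) i).trans (hg _ (isUpperSet_Ici k))
    have e2 := (abs_sub_le_sum (fun i ↦ mass (g i) (Set.Ioi k)) i).trans (hg _ (isUpperSet_Ioi k))
    rw [eq_mass_sub (g i) k, eq_mass_sub (g 0) k]
    rw [abs_le] at *
    constructor <;> linarith
  refine (dist_pi_le_iff (by positivity)).2 fun k ↦ ?_
  change |comb g w k - g 0 k| ≤ _
  have hw : ∑ i, w i = 1 := w.2.2
  have e : comb g w k - g 0 k = ∑ i, w i * (g i k - g 0 k) := by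
    simp only [mul_sub, Finset.sum_sub_distrib, ← Finset.sum_mul, hw, one_mul, comb_apply]
  rw [e]
  refine (Finset.abs_sum_le_sum_abs _ _).trans ?_
  calc ∑ i, |w i * (g i k - g 0 k)| ≤ ∑ i, w i * (2 * ε) := Finset.sum_le_sum fun i _ ↦ by
        have h2 : 0 ≤ w i := w.2.1 i
        rw [abs_mul, abs_of_nonneg h2]
        exact mul_le_mul_of_nonneg_left (h1 i k) h2
    _ = 2 * ε := by rw [← Finset.sum_mul, hw, one_mul]

/-- The middle of an edge. -/
noncomputable def mid (p q : Fin (d + 1)) : TopSimplex d :=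
  ⟨fun k ↦ (if k = p then 2⁻¹ else 0) + if k = q then 2⁻¹ else 0,
    fun k ↦ by dsimp only; split_ifs <;> norm_num, by
    simp only [Finset.sum_add_distrib, Finset.sum_ite_eq', Finset.mem_univ, if_true]
    norm_num⟩

lemma mid_apply (p q k : Fin (d + 1)) :
    mid p q k = (if k = p then 2⁻¹ else 0) + if k = q then 2⁻¹ else 0 := rfl

open Classical in
lemma mass_mid (p q : Fin (d + 1)) (U : Set (Fin (d + 1))) :
    mass (mid p q) U = (if p ∈ U then 2⁻¹ else 0) + if q ∈ U then 2⁻¹ else 0 := by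
  have key (p : Fin (d + 1)) : ∑ k, (if k ∈ U then (if k = p then (2⁻¹ : ℝ) else 0) else 0) =
      if p ∈ U then 2⁻¹ else 0 := by
    rw [Finset.sum_eq_single p]
    · simp
    · intro k _ hk
      simp [hk]
    · simp
  rw [← key p, ← key q, ← Finset.sum_add_distrib]
  refine Finset.sum_congr rfl fun k _ ↦ ?_
  rw [mid_apply]
  split_ifs <;> simp

lemma map_mid {l : ℕ} (a : Fin (d + 1) → Fin (l + 1)) (p q : Fin (d + 1)) :
    (stdSimplex.map a (mid p q) : TopSimplex l) = mid (a p) (a q) := by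
  classical
  refine _root_.stdSimplex.ext (funext fun k ↦ ?_)
  have h := mass_map a (mid p q) {k}
  rw [mass_mid] at h
  have h' : ((stdSimplex.map a (mid p q) : TopSimplex l) : Fin (l + 1) → ℝ) k =
    mass (stdSimplex.map a (mid p q) : TopSimplex l) {k} := by simp [mass]
  refine h'.trans (h.trans ?_)
  rw [mid_apply]
  simp only [Set.mem_preimage, Set.mem_singleton_iff, eq_comm]

lemma comb_mid_self (b : Fin (m + 1) → Fin (d + 1)) (w : TopSimplex m) :
    comb (fun l ↦ mid (b l) (b l)) w = stdSimplex.map b w := by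
  classical
  refine _root_.stdSimplex.ext (funext fun k ↦ ?_)
  simp only [comb_apply, map_apply, push, mid_apply]
  refine Finset.sum_congr rfl fun l _ ↦ ?_
  by_cases h : b l = k
  · rw [if_pos h, if_pos h.symm]
    ring
  · rw [if_neg h, if_neg (Ne.symm h)]
    ring

-- Mass is affine in the point. If it is given on vertices by a constant and two half indicators,
-- the variation of the image is at most half the sum of the two variations.
open Classical in
lemma tv_comb_le_of_mass_eq (A : Fin (m + 1) → TopSimplex d) {U : Set (Fin (d + 1))}
    {U₁ U₂ : Set (Fin (m + 1))} {c ε : ℝ} (hε : |ε| = 1)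
    (h : ∀ l, mass (A l) U = c + ε * (if l ∈ U₁ then 2⁻¹ else 0) + if l ∈ U₂ then 2⁻¹ else 0)
    (g : Fin (r + 1) → TopSimplex m) :
    tv (fun i ↦ comb A (g i)) U ≤ 2⁻¹ * tv g U₁ + 2⁻¹ * tv g U₂ := by
  have key (z : TopSimplex m) : mass (comb A z) U = c + ε * (2⁻¹ * mass z U₁) + 2⁻¹ * mass z U₂ := by
    have hz : ∑ l, z l = 1 := z.2.2
    rw [mass_comb]
    have : c = ∑ l, z l * c := by rw [← Finset.sum_mul, hz, one_mul]
    rw [this, mass, mass, Finset.mul_sum, Finset.mul_sum, Finset.mul_sum, ← Finset.sum_add_distrib,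
      ← Finset.sum_add_distrib]
    refine Finset.sum_congr rfl fun l _ ↦ ?_
    rw [h]
    split_ifs <;> ring
  rw [tv, tv, tv, Finset.mul_sum, Finset.mul_sum, ← Finset.sum_add_distrib]
  refine Finset.sum_le_sum fun i _ ↦ ?_
  rw [key, key]
  set x := mass (g i.succ) U₁
  set x' := mass (g i.castSucc) U₁
  set y := mass (g i.succ) U₂
  set y' := mass (g i.castSucc) U₂
  have : c + ε * (2⁻¹ * x) + 2⁻¹ * y - (c + ε * (2⁻¹ * x') + 2⁻¹ * y') =
    2⁻¹ * (ε * (x - x')) + 2⁻¹ * (y - y') := by ring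
  rw [this]
  refine (abs_add_le _ _).trans_eq ?_
  rw [abs_mul, abs_mul, abs_mul, hε, abs_of_pos (by norm_num : (0 : ℝ) < 2⁻¹), one_mul]

/-- If `a 0 ∈ U`, then every `b l` is in `U`, and the mass falls short of `1` by half the indicator
of `a l ∉ U`, unless `θ l = 1`. If `a 0 ∉ U`, then no `a l` is in `U`, and only the `b l` count. In
both cases the second set lives over `θ = 1`: where `θ` is `0` the variation is halved, and in
general it is not increased. -/
lemma tv_comb_mid_le {a b : Fin (m + 1) → Fin (d + 1)} (ha : Antitone a) (hb : Monotone b)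
    (hab : a 0 ≤ b 0) {θ : Fin (m + 1) → Fin 2} (hθ : Monotone θ) {U : Set (Fin (d + 1))}
    (hU : IsUpperSet U) :
    ∃ U₁ U₂ : Set (Fin (m + 1)), IsUpperSet U₁ ∧ IsUpperSet U₂ ∧ (∀ l ∈ U₂, θ l = 1) ∧
      ∀ {r : ℕ} (g : Fin (r + 1) → TopSimplex m),
        tv (fun i ↦ comb (fun l ↦ mid (if θ l = 0 then a l else b l) (b l)) (g i)) U ≤
          2⁻¹ * tv g U₁ + 2⁻¹ * tv g U₂ := by
  classical
  have hθ' {l l'} (h : l ≤ l') (h1 : θ l = 1) : θ l' = 1 :=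
    le_antisymm (Fin.le_last _) (h1 ▸ hθ h)
  have h01 (l) (h : θ l ≠ 0) : θ l = 1 := (Fin.exists_fin_two.1 ⟨θ l, rfl⟩).elim
    (fun e ↦ (h e).elim) fun e ↦ e
  by_cases h0 : a 0 ∈ U
  · have hbU (l) : b l ∈ U := hU (hab.trans (hb (Fin.zero_le l))) h0
    refine ⟨{l | a l ∉ U}, {l | a l ∉ U ∧ θ l = 1}, fun l l' h hl hl' ↦ hl (hU (ha h) hl'),
      fun l l' h hl ↦ ⟨fun hl' ↦ hl.1 (hU (ha h) hl'), hθ' h hl.2⟩, fun l hl ↦ hl.2,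
      fun g ↦ tv_comb_le_of_mass_eq _ (c := 1) (ε := -1) (by simp) (fun l ↦ ?_) g⟩
    rw [mass_mid, if_pos (hbU l)]
    simp only [Set.mem_ofPred_eq]
    by_cases h1 : θ l = 0 <;> by_cases h2 : a l ∈ U
    · simp [h1, h2]; norm_num
    · simp [h1, h2]; norm_num
    · simp [h1, h2, hbU]; norm_num
    · simp [h2, hbU, h01 l h1]; norm_num
  · have haU (l) : a l ∉ U := fun h ↦ h0 (hU (ha (Fin.zero_le l)) h)
    refine ⟨{l | b l ∈ U}, {l | b l ∈ U ∧ θ l = 1}, fun l l' h hl ↦ hU (hb h) hl,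
      fun l l' h hl ↦ ⟨hU (hb h) hl.1, hθ' h hl.2⟩, fun l hl ↦ hl.2,
      fun g ↦ tv_comb_le_of_mass_eq _ (c := 0) (ε := 1) (by simp) (fun l ↦ ?_) g⟩
    rw [mass_mid]
    simp only [Set.mem_ofPred_eq]
    by_cases h1 : θ l = 0 <;> by_cases h2 : b l ∈ U
    · simp [h1, h2, haU]
    · simp [h1, h2, haU]
    · simp [h2, h01 l h1]
    · simp [h2, h01 l h1]

/-- Along the vertices, the mass of an upper set is an increasing indicator, so its variation
telescopes to at most `1`. -/
lemma tv_mid_self_le (U : Set (Fin (d + 1))) (hU : IsUpperSet U) :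
    tv (fun i : Fin (d + 1) ↦ mid i i) U ≤ 1 := by
  classical
  have h1 (i : Fin (d + 1)) : mass (mid i i) U = if i ∈ U then 1 else 0 := by
    rw [mass_mid]
    split_ifs <;> norm_num
  have h2 (i : Fin d) : |mass (mid i.succ i.succ) U - mass (mid i.castSucc i.castSucc) U| =
      mass (mid i.succ i.succ) U - mass (mid i.castSucc i.castSucc) U := by
    refine abs_of_nonneg (sub_nonneg.2 ?_)
    rw [h1, h1]
    by_cases h : i.castSucc ∈ U
    · rw [if_pos h, if_pos (hU (Fin.castSucc_lt_succ).le h)]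
    · rw [if_neg h]
      split_ifs <;> norm_num
  rw [tv, Finset.sum_congr rfl fun i _ ↦ h2 i, Finset.sum_sub_distrib]
  have e1 := Fin.sum_univ_succ fun i : Fin (d + 1) ↦ mass (mid i i) U
  have e2 := Fin.sum_univ_castSucc fun i : Fin (d + 1) ↦ mass (mid i i) U
  have e3 : mass (mid (Fin.last d) (Fin.last d)) U ≤ 1 := by rw [h1]; split_ifs <;> norm_num
  have e4 : 0 ≤ mass (mid (0 : Fin (d + 1)) 0) U := by rw [h1]; split_ifs <;> norm_num
  linarith

end affine

end SSet

/-! ### Coarse subdivision and the theorem of small simplices -/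

namespace SSet
open HomotopicalAlgebra Opposite Limits
open scoped SSet.modelCategoryQuillen

namespace labNerve

variable {X Y : SSet.{u}}

/-- The first vertex function of a chain. -/
noncomputable def firstVert {m : ℕ} (c : Fin (m + 1) →o LabSimplex X) (i : Fin (m + 1)) :
    Fin ((c (Fin.last m)).dim + 1) :=
  (LabSimplex.hom (c.monotone (Fin.le_last i))).toOrderHom 0

lemma firstVert_antitone {m : ℕ} (c : Fin (m + 1) →o LabSimplex X) : Antitone (firstVert c) := by
  intro i j hij
  unfold firstVert
  rw [← LabSimplex.hom_comp (c.monotone hij) (c.monotone (Fin.le_last j))]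
  exact (LabSimplex.hom (c.monotone (Fin.le_last j))).toOrderHom.monotone (Fin.zero_le _)

lemma firstVert_le_lastOp {m : ℕ} (c : Fin (m + 1) →o LabSimplex X) (i : Fin (m + 1)) :
    firstVert c i ≤ (lastOp c).toOrderHom i :=
  (LabSimplex.hom (c.monotone (Fin.le_last i))).toOrderHom.monotone (Fin.zero_le _)

/-- The vertices of the homotopy from the coarse subdivision to the last vertex map. -/
noncomputable def sdVert {m : ℕ} (c : Fin (m + 1) →o LabSimplex X) (θ : Fin (m + 1) →o Fin 2)
    (i : Fin (m + 1)) : TopSimplex (c (Fin.last m)).dim :=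
  mid (if θ i = 0 then firstVert c i else (lastOp c).toOrderHom i) ((lastOp c).toOrderHom i)

lemma map_sdVert {m m' : ℕ} (c : Fin (m + 1) →o LabSimplex X) (θ : Fin (m + 1) →o Fin 2)
    (α : Fin (m' + 1) →o Fin (m + 1)) (i : Fin (m' + 1)) :
    (stdSimplex.map (LabSimplex.hom (c.monotone (Fin.le_last (α (Fin.last m'))))).toOrderHom
      (sdVert (c.comp α) (θ.comp α) i) : TopSimplex (c (Fin.last m)).dim) = sdVert c θ (α i) := by
  set η := LabSimplex.hom (c.monotone (Fin.le_last (α (Fin.last m'))))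
  have h : LabSimplex.hom ((c.comp α).monotone (Fin.le_last i)) ≫ η =
    LabSimplex.hom (c.monotone (Fin.le_last (α i))) := LabSimplex.hom_comp _ _
  have h1 : η.toOrderHom (firstVert (c.comp α) i) = firstVert c (α i) :=
    congrArg (fun β ↦ SimplexCategory.Hom.toOrderHom β 0) h
  have h2 : η.toOrderHom ((lastOp (c.comp α)).toOrderHom i) = (lastOp c).toOrderHom (α i) :=
    congrArg (fun β ↦ SimplexCategory.Hom.toOrderHom β (Fin.last _)) h
  refine (map_mid _ _ _).trans (congrArg₂ mid ?_ h2)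
  by_cases hθ : θ (α i) = 0
  · exact (congrArg _ (if_pos hθ)).trans (h1.trans (if_pos hθ).symm)
  · exact (congrArg _ (if_neg hθ)).trans (h2.trans (if_neg hθ).symm)

/-- The homotopy from the coarse subdivision to the last vertex map. -/
noncomputable def sdHomotopy {T : TopCat.{u}} (j : X ⟶ TopCat.toSSet.obj T) :
    labNerve.obj X ⊗ Δ[1] ⟶ TopCat.toSSet.obj T :=
  toSing (fun n (x : (labNerve.obj X ⊗ Δ[1] : SSet.{u}).obj n) ↦
    ⟨fun w ↦ ev (j.app _ (ordNerve.seq (P := LabSimplex X) x.1 (Fin.last _)).val)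
      (comb (sdVert (ordNerve.seq (P := LabSimplex X) x.1) (vert x.2)) w),
      (ev _).continuous.comp (continuous_comb _)⟩) fun {n m} α x w ↦ by
    let c : Fin (n.unop.len + 1) →o LabSimplex X := x.1
    let θ : Fin (n.unop.len + 1) →o Fin 2 := vert x.2
    let a : Fin (m.unop.len + 1) →o Fin (n.unop.len + 1) := α.unop.toOrderHom
    have hle := c.monotone (Fin.le_last (a (Fin.last _)))
    change ev (j.app _ (c (a (Fin.last _))).val) (comb (sdVert (c.comp a) (θ.comp a)) w) =
      ev (j.app _ (c (Fin.last _)).val) (comb (sdVert c θ) (stdSimplex.map a w))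
    rw [comb_map, ← (LabSimplex.isHom_hom hle).val]
    have h : j.app _ (X.map (LabSimplex.hom hle).op (c (Fin.last _)).val) =
      (TopCat.toSSet.obj T).map (LabSimplex.hom hle).op (j.app _ (c (Fin.last _)).val) :=
      NatTrans.naturality_apply _ _ _
    rw [h, ev_map]
    refine congrArg _ ((map_comb _ _ _).trans ?_)
    exact congrArg (fun g ↦ comb g w) (funext fun i ↦ map_sdVert c θ a i)

lemma ev_sdHomotopy {T : TopCat.{u}} (j : X ⟶ TopCat.toSSet.obj T) {n : SimplexCategoryᵒᵖ}
    (c : Fin (n.unop.len + 1) →o LabSimplex X) (θ : (Δ[1] : SSet.{u}).obj n) (w) :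
    ev ((sdHomotopy j).app n (((c, θ) : (labNerve.obj X ⊗ Δ[1] : SSet.{u}).obj n))) w =
      ev (j.app _ (c (Fin.last _)).val) (comb (sdVert c (vert θ)) w) :=
  DFunLike.congr_fun (ev_toSing (X := labNerve.obj X ⊗ Δ[1]) _ _ n (c, θ)) w

lemma inc_one_sdHomotopy {T : TopCat.{u}} (j : X ⟶ TopCat.toSSet.obj T) :
    inc 1 ≫ sdHomotopy j = last X ≫ j := by
  refine hom_sing_ext fun n (c : Fin (n.unop.len + 1) →o LabSimplex X) w ↦ ?_
  refine (ev_sdHomotopy j c (stdSimplex.const 1 1 n) w).trans ?_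
  change _ = ev (j.app n (X.map (lastOp c).op (c (Fin.last _)).val)) w
  rw [NatTrans.naturality_apply, ev_map]
  exact congrArg _ (comb_mid_self _ _)

lemma map_sdHomotopy {T : TopCat.{u}} (f : X ⟶ Y) (j : Y ⟶ TopCat.toSSet.obj T) :
    labNerve.map f ▷ _ ≫ sdHomotopy j = sdHomotopy (f ≫ j) := by
  refine hom_sing_ext fun n ⟨(c : Fin (n.unop.len + 1) →o LabSimplex X), θ⟩ w ↦ ?_
  refine (ev_sdHomotopy j ((LabSimplex.map f).comp c) θ w).trans
    (Eq.trans ?_ (ev_sdHomotopy (f ≫ j) c θ w).symm)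
  have h (i) : LabSimplex.hom (((LabSimplex.map f).comp c).monotone (Fin.le_last i)) =
      LabSimplex.hom (c.monotone (Fin.le_last i)) :=
    LabSimplex.hom_eq _ (LabSimplex.isHom_hom (c.monotone (Fin.le_last i))).lab
  refine congrArg (fun g ↦ ev (j.app _ (f.app _ (c (Fin.last _)).val)) (comb g w)) (funext fun i ↦ ?_)
  have h1 : firstVert ((LabSimplex.map f).comp c) i = firstVert c i :=
    congrArg (fun β ↦ SimplexCategory.Hom.toOrderHom β 0) (h i)
  have h2 : (lastOp ((LabSimplex.map f).comp c)).toOrderHom i = (lastOp c).toOrderHom i :=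
    congrArg (fun β ↦ SimplexCategory.Hom.toOrderHom β (Fin.last _)) (h i)
  change mid (if vert θ i = 0 then firstVert ((LabSimplex.map f).comp c) i else
    (lastOp ((LabSimplex.map f).comp c)).toOrderHom i)
      ((lastOp ((LabSimplex.map f).comp c)).toOrderHom i) = mid _ _
  rw [h1, h2]
  rfl

end labNerve

section small

variable {T : TopCat.{u}} (𝒰 : Set (Set T))

/-- Singular simplices which are small after composition with affine maps of small variation. -/
noncomputable def smallSing (k : ℕ) : (TopCat.toSSet.obj T).Subcomplex where
  obj n := {x | ∀ (r : ℕ) (g : Fin (r + 1) → TopSimplex n.unop.len),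
    (∀ U, IsUpperSet U → tv g U ≤ 2⁻¹ ^ k) → ∃ V ∈ 𝒰, ∀ w, ev x (comb g w) ∈ V}
  map {n m} α x hx r g hg := by
    obtain ⟨V, hV, h⟩ := hx r (fun i ↦ stdSimplex.map α.unop.toOrderHom (g i)) fun U hU ↦ by
      rw [tv_map]
      exact hg _ (hU.preimage α.unop.toOrderHom.monotone)
    refine ⟨V, hV, fun w ↦ ?_⟩
    rw [ev_map, map_comb]
    exact h w

lemma smallSing_le (k : ℕ) : smallSing 𝒰 k ≤ smallSing 𝒰 (k + 1) := fun n x hx r g hg ↦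
  hx r g fun U hU ↦ (hg U hU).trans (pow_le_pow_of_le_one (by norm_num) (by norm_num) (Nat.le_succ k))

lemma mem_smallSing_zero {n : SimplexCategoryᵒᵖ} (x : (TopCat.toSSet.obj T).obj n) :
    x ∈ (smallSing 𝒰 0).obj n ↔ ∃ V ∈ 𝒰, ∀ w, ev x w ∈ V := by
  constructor
  · intro h
    obtain ⟨V, hV, h⟩ := h n.unop.len (fun i ↦ mid i i) fun U hU ↦
      (tv_mid_self_le U hU).trans_eq (pow_zero _).symm
    refine ⟨V, hV, fun w ↦ ?_⟩
    have := h w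
    rw [comb_mid_self] at this
    exact (stdSimplex.map_id_apply w) ▸ this
  · rintro ⟨V, hV, h⟩ r g -
    exact ⟨V, hV, fun w ↦ h _⟩

/-- By `dist_comb_le`, affine simplices of small variation have small diameter, so a Lebesgue number
of the pulled back cover suffices. -/
lemma exists_mem_smallSing (h𝒰 : ∀ V ∈ 𝒰, IsOpen V) (hc : ∀ y : T, ∃ V ∈ 𝒰, y ∈ V)
    {n : SimplexCategoryᵒᵖ} (x : (TopCat.toSSet.obj T).obj n) :
    ∃ k, x ∈ (smallSing 𝒰 k).obj n := by
  obtain ⟨δ, hδ, h⟩ := lebesgue_number_lemma_of_metric_sUnion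
    (s := (Set.univ : Set (TopSimplex n.unop.len))) (c := (fun V ↦ ev x ⁻¹' V) '' 𝒰) isCompact_univ
    (by
      rintro _ ⟨V, hV, rfl⟩
      exact (h𝒰 V hV).preimage (ev x).continuous) (fun w _ ↦ by
      obtain ⟨V, hV, h⟩ := hc (ev x w)
      exact ⟨_, ⟨V, hV, rfl⟩, h⟩)
  obtain ⟨k, hk⟩ := exists_pow_lt_of_lt_one (half_pos hδ) (by norm_num : (2⁻¹ : ℝ) < 1)
  refine ⟨k, fun r g hg ↦ ?_⟩
  obtain ⟨_, ⟨V, hV, rfl⟩, hb⟩ := h (g 0) trivial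
  refine ⟨V, hV, fun w ↦ hb ?_⟩
  rw [Metric.mem_ball]
  have := dist_comb_le g hg w
  linarith

-- Smallness is preserved along the subdivision homotopy and improves by one level at its end `0`,
-- where the second term of `tv_comb_mid_le` is absent.
open labNerve in
lemma sdHomotopy_mem {k l : ℕ} {n : SimplexCategoryᵒᵖ}
    (c : Fin (n.unop.len + 1) →o LabSimplex (smallSing 𝒰 k : SSet.{u})) (θ : (Δ[1] : SSet.{u}).obj n)
    (h : k = l ∨ (∀ i, vert θ i ≠ 1) ∧ k = l + 1) :
    (sdHomotopy (smallSing 𝒰 k).ι).app n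
      (((c, θ) : (labNerve.obj (smallSing 𝒰 k : SSet.{u}) ⊗ Δ[1] : SSet.{u}).obj n)) ∈
        (smallSing 𝒰 l).obj n := by
  intro r g hg
  obtain ⟨V, hV, hx⟩ := (c (Fin.last _)).val.2 r (fun i ↦ comb (sdVert c (vert θ)) (g i)) (by
    intro U hU
    obtain ⟨U₁, U₂, h1, h2, h3, h4⟩ := tv_comb_mid_le (firstVert_antitone c)
      (lastOp c).toOrderHom.monotone (firstVert_le_lastOp c 0) (vert θ).monotone hU
    refine (h4 g).trans ?_
    have h5 := hg _ h1
    obtain rfl | ⟨h, rfl⟩ := h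
    · have h6 := hg _ h2
      linarith
    · rw [show U₂ = ∅ from Set.eq_empty_of_forall_notMem fun i hi ↦ h i (h3 i hi), tv_empty, pow_succ]
      linarith)
  refine ⟨V, hV, fun w ↦ ?_⟩
  rw [ev_sdHomotopy, ← comb_comb]
  exact hx w

open labNerve in
/-- One step of the theorem of small simplices. -/
lemma isKanEquivalence_smallSing_step (k : ℕ) :
    IsKanEquivalence (Subcomplex.homOfLE (smallSing_le 𝒰 k)) := by
  have exH (k : ℕ) : ∃ H : labNerve.obj (smallSing 𝒰 k : SSet.{u}) ⊗ Δ[1] ⟶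
      (smallSing 𝒰 k : SSet.{u}), H ≫ (smallSing 𝒰 k).ι = sdHomotopy (smallSing 𝒰 k).ι :=
    ⟨Subcomplex.lift _ (by
      rintro n _ ⟨⟨c, θ⟩, rfl⟩
      exact sdHomotopy_mem 𝒰 c θ (Or.inl rfl)), Subcomplex.lift_ι _ _⟩
  choose H hH using exH
  -- Subdivision maps level `k + 1` to level `k`. Its composites with the inclusion on either side
  -- are ends of homotopies to last vertex maps, so two out of six applies.
  obtain ⟨D, hD⟩ : ∃ D : labNerve.obj (smallSing 𝒰 (k + 1) : SSet.{u}) ⟶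
      (smallSing 𝒰 k : SSet.{u}),
      D ≫ (smallSing 𝒰 k).ι = inc 0 ≫ sdHomotopy (smallSing 𝒰 (k + 1)).ι :=
    ⟨Subcomplex.lift _ (by
      rintro n _ ⟨c, rfl⟩
      refine sdHomotopy_mem 𝒰 c (stdSimplex.const 1 0 n) (Or.inr ⟨fun i ↦ ?_, rfl⟩)
      exact zero_ne_one (α := Fin 2)), Subcomplex.lift_ι _ _⟩
  obtain ⟨ι, hι', hι⟩ : ∃ ι : (smallSing 𝒰 k : SSet.{u}) ⟶ (smallSing 𝒰 (k + 1) : SSet.{u}),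
      Subcomplex.homOfLE (smallSing_le 𝒰 k) = ι ∧ ι ≫ (smallSing 𝒰 (k + 1)).ι = (smallSing 𝒰 k).ι :=
    ⟨_, rfl, Subcomplex.homOfLE_ι _⟩
  rw [hι']
  have h1 (k : ℕ) : Htpy (inc 0 ≫ H k) (last (smallSing 𝒰 k : SSet.{u})) := by
    refine ⟨H k, rfl, ?_⟩
    rw [← cancel_mono (smallSing 𝒰 k).ι, Category.assoc, hH, inc_one_sdHomotopy]
  have h2 (k : ℕ) : IsKanEquivalence (inc 0 ≫ H k) := (isKanEquivalence_last _).of_htpy' (h1 k)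
  have e1 : labNerve.map ι ≫ D = inc 0 ≫ H k := by
    rw [← cancel_mono (smallSing 𝒰 k).ι, Category.assoc, hD, Category.assoc, hH, ← hι,
      ← map_sdHomotopy, inc_comp_assoc]
  have e2 : D ≫ ι = inc 0 ≫ H (k + 1) := by
    rw [← cancel_mono (smallSing 𝒰 (k + 1)).ι, Category.assoc, hι, hD, Category.assoc, hH]
  have h3 : IsKanEquivalence D := IsKanEquivalence.two_of_six (e1 ▸ h2 k) (e2 ▸ h2 (k + 1))
  exact h3.of_comp_left (e2 ▸ h2 (k + 1))

/-- The theorem of small simplices. -/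
theorem isKanEquivalence_smallSing (h𝒰 : ∀ V ∈ 𝒰, IsOpen V) (hc : ∀ y : T, ∃ V ∈ 𝒰, y ∈ V) :
    IsKanEquivalence (smallSing 𝒰 0).ι :=
  (IsKanAnodyne.of_iSup (smallSing 𝒰) (smallSing_le 𝒰)
    (fun k ↦ IsKanAnodyne.of_isKanEquivalence (isKanEquivalence_smallSing_step 𝒰 k))
    fun _ x ↦ exists_mem_smallSing 𝒰 h𝒰 hc x).isKanEquivalence

end small

end SSet

/-! ### Star neighbourhoods of chains in the realization of a nerve -/

namespace SSet
open HomotopicalAlgebra Opposite Limits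
open scoped SSet.modelCategoryQuillen

section openSubset

variable {X : SSet.{u}} {Z K : Type*} [TopologicalSpace Z] [TopologicalSpace K]

lemma continuous_open_of_pt {V : Set |X|} (hV : IsOpen V) {f : V → Z}
    (h : ∀ n (s : X.obj n), Continuous fun z : {z // pt s z ∈ V} ↦ f ⟨pt s z.1, z.2⟩) :
    Continuous f := by
  refine ⟨fun U hU ↦ ?_⟩
  have : IsOpen {y | ∃ hy : y ∈ V, f ⟨y, hy⟩ ∈ U} := isOpen_of_pt fun n s ↦ by
    have h1 := (hV.preimage (pt s).continuous).isOpenMap_subtype_val _ (hU.preimage (h n s))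
    convert h1 using 1
    ext z
    constructor
    · rintro ⟨hz, hz'⟩
      exact ⟨⟨z, hz⟩, hz', rfl⟩
    · rintro ⟨⟨z, hz⟩, hz', rfl⟩
      exact ⟨hz, hz'⟩
  convert this.preimage continuous_subtype_val using 1
  ext ⟨y, hy⟩
  exact ⟨fun h ↦ ⟨hy, h⟩, fun ⟨_, h⟩ ↦ h⟩

/-- Continuity on the product is reduced to continuity of the curried map on `V`, which can be
tested on simplices. Local compactness of `K` allows the return. -/
lemma continuous_open_prod_of_pt [LocallyCompactSpace K] {V : Set |X|} (hV : IsOpen V)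
    {f : V × K → Z}
    (h : ∀ n (s : X.obj n), Continuous fun p : {z // pt s z ∈ V} × K ↦ f (⟨pt s p.1.1, p.1.2⟩, p.2)) :
    Continuous f := by
  have h1 (y : V) : Continuous fun t ↦ f (y, t) := by
    obtain ⟨y, hy⟩ := y
    obtain ⟨n, s, z, rfl⟩ := exists_pt y
    exact (h n s).comp (by fun_prop : Continuous fun t ↦ ((⟨z, hy⟩ : {z // pt s z ∈ V}), t))
  have h2 : Continuous fun y ↦ (⟨_, h1 y⟩ : C(K, Z)) := continuous_open_of_pt hV fun n s ↦
    (ContinuousMap.curry ⟨_, h n s⟩).continuous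
  exact ContinuousMap.continuous_uncurry_of_continuous ⟨_, h2⟩

end openSubset

lemma exists_push_pos {Q : Type*} {k : ℕ} (c : Fin (k + 1) → Q) (z : TopSimplex k) : ∃ j, 0 < push c z (c j) := by
  classical
  obtain ⟨j, hj⟩ : ∃ j, 0 < z j := by
    by_contra! hz
    have h1 : ∑ j, z j = 1 := z.2.2
    have : ∑ j, z j ≤ 0 := Finset.sum_nonpos fun j _ ↦ hz j
    linarith
  refine ⟨j, hj.trans_le ?_⟩
  have := Finset.single_le_sum (f := fun i ↦ if c i = c j then z i else 0)
    (fun i _ ↦ by split_ifs; exacts [z.2.1 i, le_rfl]) (Finset.mem_univ j)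
  simpa [push] using this

section nerve

variable {P : Type u} [PartialOrder P]

/-- Barycentric coordinates on the realization of a nerve. -/
noncomputable abbrev crd : C(|ordNerve P|, P → ℝ) := coord (𝟙 (ordNerve P))

lemma exists_chain_pt (y : |ordNerve P|) : ∃ (k : ℕ) (c : Fin (k + 1) →o P) (z : TopSimplex k),
    pt (X := ordNerve P) (n := op ⦋k⦌) c z = y := by
  obtain ⟨⟨⟨k⟩⟩, s, z, h⟩ := exists_pt y
  exact ⟨k, s, z, h⟩

lemma crd_pt {k : ℕ} (c : Fin (k + 1) →o P) (z : TopSimplex k) :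
    crd (pt (X := ordNerve P) (n := op ⦋k⦌) c z) = push c z := coord_pt _ _ _

lemma crd_nonneg (y : |ordNerve P|) (p : P) : 0 ≤ crd y p := by
  obtain ⟨k, c, z, rfl⟩ := exists_chain_pt y
  rw [crd_pt]
  exact push_nonneg _ z.2.1 _

/-- The vertices with the largest coordinate. -/
def argmax (y : |ordNerve P|) : Set P := {p | ∀ q, crd y q ≤ crd y p}

lemma exists_mem_argmax (y : |ordNerve P|) : ∃ p, p ∈ argmax y := by
  obtain ⟨k, c, z, rfl⟩ := exists_chain_pt y
  obtain ⟨i, hi⟩ := Finite.exists_max fun i ↦ push c z (c i)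
  refine ⟨c i, fun q ↦ ?_⟩
  rw [crd_pt]
  by_cases hq : ∃ j, c j = q
  · obtain ⟨j, rfl⟩ := hq
    exact hi j
  · rw [push_eq_zero _ fun j hj ↦ (hq ⟨j, hj⟩).elim]
    exact push_nonneg _ z.2.1 _

lemma crd_pos_of_mem_argmax {y : |ordNerve P|} {p : P} (hp : p ∈ argmax y) : 0 < crd y p := by
  obtain ⟨k, c, z, rfl⟩ := exists_chain_pt y
  obtain ⟨j, hj⟩ := exists_push_pos c z
  refine lt_of_lt_of_le ?_ (hp (c j))
  rwa [crd_pt]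

/-- The points whose largest coordinates are in a given chain. -/
def starNhd (F : FinChain P) : Set |ordNerve P| := {y | argmax y ⊆ F.1}

lemma mem_starNhd_iff {F : FinChain P} {y : |ordNerve P|} :
    y ∈ starNhd F ↔ ∃ p ∈ F.1, ∀ q ∉ F.1, crd y q < crd y p := by
  constructor
  · intro h
    obtain ⟨p, hp⟩ := exists_mem_argmax y
    refine ⟨p, h hp, fun q hq ↦ lt_of_le_of_ne (hp q) fun e ↦ hq (h fun r ↦ ?_)⟩
    rw [e]
    exact hp r
  · rintro ⟨p, hp, h⟩ q hq
    by_contra h'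
    exact (h q h').not_ge (hq p)

lemma isOpen_starNhd (F : FinChain P) : IsOpen (starNhd F) := by
  refine isOpen_of_pt fun n (c : Fin (n.unop.len + 1) →o P) ↦ ?_
  have hc (p : P) : Continuous fun z : TopSimplex n.unop.len ↦ push c z p :=
    (continuous_apply p).comp ((continuous_push c).comp continuous_subtype_val)
  -- On one simplex, coordinates outside the vertices of `c` vanish. The infinitely many
  -- inequalities become finitely many, together with positivity at `p` if some element outside `F`
  -- is not a vertex of `c`.
  have : pt (X := ordNerve P) (n := n) c ⁻¹' starNhd F =
      ⋃ p ∈ F.1, ((⋂ j, ({z | c j ∉ F.1 → push c z (c j) < push c z p} : Set (TopSimplex n.unop.len))) ∩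
        {z | (∃ q ∉ F.1, ∀ j, c j ≠ q) → 0 < push c z p}) := by
    ext z
    simp only [Set.mem_preimage, Set.mem_iUnion, Set.mem_inter_iff, Set.mem_iInter, Set.mem_ofPred_eq, exists_prop]
    have e : crd (pt (X := ordNerve P) (n := n) c z) = push c z := coord_pt _ _ _
    rw [mem_starNhd_iff, e]
    refine exists_congr fun p ↦ and_congr_right fun _ ↦ ⟨fun h ↦ ⟨fun j hj ↦ h _ hj, ?_⟩, ?_⟩
    · rintro ⟨q, hq, h'⟩
      have := h q hq
      rwa [push_eq_zero _ fun j hj ↦ (h' j hj).elim] at this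
    · rintro ⟨h1, h2⟩ q hq
      by_cases hj : ∃ j, c j = q
      · obtain ⟨j, rfl⟩ := hj
        exact h1 j hq
      · rw [push_eq_zero _ fun j hj' ↦ (hj ⟨j, hj'⟩).elim]
        exact h2 ⟨q, hq, fun j hj' ↦ hj ⟨j, hj'⟩⟩
  change IsOpen (pt (X := ordNerve P) (n := n) c ⁻¹' starNhd F)
  rw [this]
  refine isOpen_biUnion fun p _ ↦ (isOpen_iInter_of_finite fun j ↦ ?_).inter ?_
  · by_cases h : c j ∈ F.1
    · simp [h]
    · simpa [h] using isOpen_lt (hc _) (hc _)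
  · by_cases h : ∃ q ∉ F.1, ∀ j, c j ≠ q
    · simpa only [h, true_imp_iff] using isOpen_lt continuous_const (hc _)
    · simp only [h, false_imp_iff, Set.ofPred_true, isOpen_univ]

lemma exists_mem_starNhd (y : |ordNerve P|) : ∃ F : FinChain P, y ∈ starNhd F := by
  obtain ⟨k, c, z, rfl⟩ := exists_chain_pt y
  refine ⟨FinChain.range c, fun p hp ↦ ?_⟩
  have h := crd_pos_of_mem_argmax hp
  rw [crd_pt] at h
  obtain ⟨j, hj, -⟩ := exists_of_push_ne_zero h.ne'
  exact FinChain.mem_range.2 ⟨j, hj⟩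

/-- The total mass of a chain. -/
noncomputable def chainMass (F : FinChain P) (w : P → ℝ) : ℝ := ∑ p ∈ F.1, w p

lemma chainMass_pos {F : FinChain P} {y : |ordNerve P|} (hy : y ∈ starNhd F) :
    0 < chainMass F (crd y) := by
  obtain ⟨p, hp⟩ := exists_mem_argmax y
  exact (crd_pos_of_mem_argmax hp).trans_le
    (Finset.single_le_sum (fun q _ ↦ crd_nonneg y q) (hy hp))

lemma continuous_chainMass (F : FinChain P) : Continuous (chainMass F) := by
  unfold chainMass
  fun_prop

open Classical in
lemma chainMass_push (F : FinChain P) {k : ℕ} (c : Fin (k + 1) → P) (z : Fin (k + 1) → ℝ) :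
    chainMass F (push c z) = ∑ i, if c i ∈ F.1 then z i else 0 := by
  simp only [chainMass, push]
  rw [Finset.sum_comm]
  refine Finset.sum_congr rfl fun i _ ↦ ?_
  rw [Finset.sum_ite_eq]

open Classical in
/-- Coordinates moving towards a chain. -/
noncomputable def towards (F : FinChain P) (w : P → ℝ) (t : ℝ) (p : P) : ℝ :=
  (1 - t) * w p + t * if p ∈ F.1 then w p / chainMass F w else 0

open Classical in
/-- Coordinates of a simplex moving towards a chain. -/
noncomputable def towardsSimplex (F : FinChain P) {k : ℕ} (c : Fin (k + 1) → P) (z : TopSimplex k)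
    (hz : 0 < chainMass F (push c z)) (t : unitInterval) : TopSimplex k :=
  ⟨fun i ↦ (1 - t) * z i + t * if c i ∈ F.1 then z i / chainMass F (push c z) else 0, fun i ↦ by
    have h1 : 0 ≤ z i := z.2.1 i
    have h2 : 0 ≤ (1 - t : ℝ) := sub_nonneg.2 t.2.2
    have h3 := t.2.1
    change 0 ≤ (1 - t) * z i + t * (if c i ∈ F.1 then z i / chainMass F (push c z) else 0)
    split_ifs <;> positivity, by
    have h1 : ∑ i, z i = 1 := z.2.2
    have h2 : ∑ i, (if c i ∈ F.1 then z i / chainMass F (push c z) else 0) = 1 := by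
      have : ∀ i, (if c i ∈ F.1 then z i / chainMass F (push c z) else 0) =
        (if c i ∈ F.1 then z i else 0) / chainMass F (push c z) := fun i ↦ by split_ifs <;> simp
      rw [Finset.sum_congr rfl fun i _ ↦ this i, ← Finset.sum_div, ← chainMass_push]
      exact div_self hz.ne'
    change ∑ i, ((1 - t) * z i + t * (if c i ∈ F.1 then z i / chainMass F (push c z) else 0)) = 1
    rw [Finset.sum_add_distrib, ← Finset.mul_sum, ← Finset.mul_sum, h1, h2]
    ring⟩

lemma push_towardsSimplex (F : FinChain P) {k : ℕ} (c : Fin (k + 1) → P) (z : TopSimplex k)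
    (hz : 0 < chainMass F (push c z)) (t : unitInterval) :
    push c (towardsSimplex F c z hz t) = towards F (push c z) t := by
  classical
  ext p
  have e : towardsSimplex F c z hz t = (fun i ↦ (1 - (t : ℝ)) * z i +
    t * if c i ∈ F.1 then z i / chainMass F (push c z) else 0 : Fin (k + 1) → ℝ) := rfl
  rw [towards, push, e, push, Finset.mul_sum]
  by_cases hp : p ∈ F.1
  · rw [if_pos hp, Finset.sum_div, Finset.mul_sum, ← Finset.sum_add_distrib]
    refine Finset.sum_congr rfl fun i _ ↦ ?_
    by_cases hi : c i = p
    · subst hi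
      simp [hp]
    · simp [hi]
  · rw [if_neg hp, mul_zero, add_zero]
    refine Finset.sum_congr rfl fun i _ ↦ ?_
    by_cases hi : c i = p
    · subst hi
      simp [hp]
    · simp [hi]

end nerve

end SSet

/-! ### Contractibility of star neighbourhoods -/

namespace SSet
open HomotopicalAlgebra Opposite Limits
open scoped SSet.modelCategoryQuillen

section extension

variable {T : TopCat.{u}} {V : Set T}

/-- On `A` the map is homotopic to a constant map. The constant extends to `X`, and homotopy
extension run backwards recovers `f` at the other end. -/
lemma exists_extension_of_htpy_const {S : TopCat.{u}} (v : S)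
    (h : Htpy (𝟙 (TopCat.toSSet.obj S)) (TopCat.toSSet.map (TopCat.ofHom (ContinuousMap.const S v))))
    {A X : SSet.{u}} (i : A ⟶ X) [Mono i] (f : A ⟶ TopCat.toSSet.obj S) :
    ∃ g : X ⟶ TopCat.toSSet.obj S, i ≫ g = f := by
  obtain ⟨H, h0, h1⟩ := h
  let x : X ⟶ TopCat.toSSet.obj S := toSing (fun _ _ ↦ ContinuousMap.const _ v) fun _ _ _ ↦ rfl
  obtain ⟨K, k1, -⟩ := exists_extend_cylinder i 1 (f ▷ _ ≫ H) x (by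
    rw [inc_comp_assoc, h1]
    refine hom_sing_ext fun n s z ↦ ?_
    change ev ((TopCat.toSSet.map (TopCat.ofHom (ContinuousMap.const S v))).app n (f.app n s)) z =
      ev (x.app n (i.app n s)) z
    exact (congrArg (fun g : C(_, S) ↦ g z) (ev_toSing (fun _ _ ↦ ContinuousMap.const _ v) _ n (i.app n s))).symm)
  refine ⟨inc 0 ≫ K, ?_⟩
  rw [← inc_comp_assoc, k1, inc_comp_assoc, h0, Category.comp_id]

lemma exists_extension_of_subset (v : V)
    (h : Htpy (𝟙 (TopCat.toSSet.obj (TopCat.of V)))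
      (TopCat.toSSet.map (TopCat.ofHom (ContinuousMap.const V v))))
    {A X : SSet.{u}} (i : A ⟶ X) [Mono i] (f : A ⟶ TopCat.toSSet.obj T)
    (hf : ∀ n (a : A.obj n) w, ev (f.app n a) w ∈ V) :
    ∃ g : X ⟶ TopCat.toSSet.obj T, i ≫ g = f ∧ ∀ n (x : X.obj n) w, ev (g.app n x) w ∈ V := by
  let f' : A ⟶ TopCat.toSSet.obj (TopCat.of V) :=
    toSing (fun n a ↦ ⟨fun w ↦ ⟨ev (f.app n a) w, hf n a w⟩,
      (ev (f.app n a)).continuous.subtype_mk _⟩) fun {n m} α s z ↦ Subtype.ext (by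
        change ev (f.app m (A.map α s)) z = ev (f.app n s) _
        rw [NatTrans.naturality_apply, ev_map])
  obtain ⟨g, hg⟩ := exists_extension_of_htpy_const (S := TopCat.of V) v h i f'
  refine ⟨g ≫ TopCat.toSSet.map (TopCat.ofHom ⟨Subtype.val, continuous_subtype_val⟩), ?_,
    fun n x w ↦ (ev (T := TopCat.of V) (g.app n x) w).2⟩
  rw [← Category.assoc, hg]
  refine hom_sing_ext fun n s z ↦ ?_
  change (ev (f'.app n s) z).1 = _
  rw [ev_toSing]
  rfl

end extension

section nerve

variable {P : Type u} [PartialOrder P]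

lemma crd_injective : Function.Injective (crd (P := P)) := coord_injective _

lemma exists_crd_eq_towards {F : FinChain P} {y : |ordNerve P|} (hy : y ∈ starNhd F)
    (t : unitInterval) : ∃ y' ∈ starNhd F, crd y' = towards F (crd y) t := by
  obtain ⟨k, c, z, rfl⟩ := exists_chain_pt y
  have hz := chainMass_pos hy
  rw [crd_pt] at hz
  have h : crd (pt (X := ordNerve P) (n := op ⦋k⦌) c (towardsSimplex F c z hz t)) =
      towards F (crd (pt (X := ordNerve P) (n := op ⦋k⦌) c z)) t := by
    rw [crd_pt, crd_pt, push_towardsSimplex]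
  refine ⟨_, mem_starNhd_iff.2 ?_, h⟩
  rw [h]
  obtain ⟨p, hp, h'⟩ := mem_starNhd_iff.1 hy
  obtain ⟨r, hr⟩ := exists_mem_argmax (pt (X := ordNerve P) (n := op ⦋k⦌) c z)
  refine ⟨r, hy hr, fun q hq ↦ ?_⟩
  have h1 : crd (pt (X := ordNerve P) (n := op ⦋k⦌) c z) q <
    crd (pt (X := ordNerve P) (n := op ⦋k⦌) c z) r := (h' q hq).trans_le (hr p)
  have h2 := div_pos (crd_pos_of_mem_argmax hr) (chainMass_pos hy)
  rw [towards, towards, if_neg hq, if_pos (show r ∈ F.1 from hy hr), mul_zero, add_zero]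
  -- Outside `F` coordinates shrink by the factor `1 - t`, while at a maximal vertex, which is in
  -- `F`, a positive multiple of `t` is added. For `t = 1` the strict comparison of the shrunk parts
  -- is lost, but the added term alone is positive.
  rcases t.2.2.lt_or_eq with ht | ht
  · have h3 := mul_lt_mul_of_pos_left h1 (sub_pos.2 ht)
    have h4 := mul_nonneg t.2.1 h2.le
    linarith
  · rw [ht]
    simpa using h2

/-- A star neighbourhood contracts to its simplex. -/
lemma exists_starNhd_contraction (F : FinChain P) : ∃ h : C(starNhd F × unitInterval, starNhd F),
    ∀ y t, crd (h (y, t)) = towards F (crd y) t := by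
  choose g hg using fun p : starNhd F × unitInterval ↦ exists_crd_eq_towards p.1.2 p.2
  refine ⟨⟨fun p ↦ ⟨g p, (hg p).1⟩, ?_⟩, fun y t ↦ (hg (y, t)).2⟩
  refine Continuous.subtype_mk (continuous_open_prod_of_pt (isOpen_starNhd F)
    fun n (c : Fin (n.unop.len + 1) →o P) ↦ ?_) _
  have hz (z : {z // pt (X := ordNerve P) (n := n) c z ∈ starNhd F}) :
      0 < chainMass F (push c z.1) := by
    have := chainMass_pos z.2
    rwa [(crd_pt (k := n.unop.len) c z.1 :)] at this
  have h1 (p : {z // pt (X := ordNerve P) (n := n) c z ∈ starNhd F} × unitInterval) :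
      g (⟨pt (X := ordNerve P) (n := n) c p.1.1, p.1.2⟩, p.2) =
        pt (X := ordNerve P) (n := n) c (towardsSimplex F c p.1.1 (hz p.1) p.2) := by
    refine crd_injective ?_
    rw [(hg _).2]
    change towards F (crd (pt (X := ordNerve P) (n := n) c p.1.1)) p.2 = _
    have e1 : crd (pt (X := ordNerve P) (n := n) c p.1.1) = push c p.1.1 := coord_pt _ _ _
    have e2 : crd (pt (X := ordNerve P) (n := n) c (towardsSimplex F c p.1.1 (hz p.1) p.2)) =
      push c (towardsSimplex F c p.1.1 (hz p.1) p.2) := coord_pt _ _ _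
    rw [e1, e2, push_towardsSimplex]
  simp only [h1]
  refine (pt (X := ordNerve P) (n := n) c).continuous.comp (Continuous.subtype_mk
    (continuous_pi fun i ↦ ?_) _)
  have hc : Continuous fun p : {z // pt (X := ordNerve P) (n := n) c z ∈ starNhd F} ×
      unitInterval ↦ chainMass F (push c p.1.1) :=
    (continuous_chainMass F).comp ((continuous_push c).comp (by fun_prop))
  have hi : Continuous fun p : {z // pt (X := ordNerve P) (n := n) c z ∈ starNhd F} ×
      unitInterval ↦ p.1.1 i :=
    (continuous_apply i).comp (continuous_subtype_val.comp (by fun_prop))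
  refine Continuous.add (Continuous.mul (by fun_prop) hi) (Continuous.mul (by fun_prop) ?_)
  by_cases hp : c i ∈ F.1
  · simp only [if_pos hp]
    exact hi.div hc fun p ↦ (hz p.1).ne'
  · simp only [if_neg hp]
    exact continuous_const

/-- A simplex contracts to a vertex. -/
lemma exists_chain_contraction (F : FinChain P) : ∃ (h : C(starNhd F × unitInterval, starNhd F))
    (v : starNhd F), (∀ y, crd (h (y, 0)) = towards F (crd y) 1) ∧ ∀ y, h (y, 1) = v := by
  classical
  obtain ⟨k, e, he, hr⟩ := F.exists_orderHom
  have hF (j) : e j ∈ F.1 := by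
    rw [← hr]
    exact FinChain.mem_range.2 ⟨j, rfl⟩
  have hF' {q} (hq : q ∉ F.1) (j) : e j ≠ q := fun h ↦ hq (h ▸ hF j)
  have hS (w : P → ℝ) : ∑ j, w (e j) = chainMass F w := by
    rw [chainMass, ← hr]
    refine (Finset.sum_image fun i _ j _ h ↦ he.injective h).symm.trans ?_
    exact Finset.sum_congr (by ext p; simp [FinChain.mem_range]) fun _ _ ↦ rfl
  have mem (z : TopSimplex k) : pt (X := ordNerve P) (n := op ⦋k⦌) e z ∈ starNhd F := by
    intro q hq
    by_contra hqF
    have := crd_pos_of_mem_argmax hq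
    rw [crd_pt, push_eq_zero _ fun j hj ↦ (hF' hqF j hj).elim] at this
    exact this.false
  let z (p : starNhd F × unitInterval) : TopSimplex k :=
    ⟨fun j ↦ (1 - p.2) * (crd p.1.1 (e j) / chainMass F (crd p.1)) + p.2 * if j = 0 then 1 else 0,
    fun j ↦ by
      have h1 := div_nonneg (crd_nonneg p.1.1 (e j)) (chainMass_pos p.1.2).le
      have h2 : 0 ≤ (1 - p.2 : ℝ) := sub_nonneg.2 p.2.2.2
      have h3 := p.2.2.1
      change 0 ≤ (1 - p.2 : ℝ) * _ + p.2 * (if j = 0 then (1 : ℝ) else 0)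
      split_ifs <;> positivity, by
      change ∑ j, ((1 - p.2 : ℝ) * (crd p.1.1 (e j) / chainMass F (crd p.1)) +
        p.2 * if j = 0 then 1 else 0) = 1
      rw [Finset.sum_add_distrib, ← Finset.mul_sum, ← Finset.mul_sum, ← Finset.sum_div, hS,
        div_self (chainMass_pos p.1.2).ne']
      simp⟩
  have hz : Continuous z := by
    refine Continuous.subtype_mk (continuous_pi fun j ↦ ?_) _
    have h1 : Continuous fun p : starNhd F × unitInterval ↦ crd p.1.1 :=
      crd.continuous.comp (by fun_prop)
    refine Continuous.add (Continuous.mul (by fun_prop) (Continuous.div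
      ((continuous_apply (e j)).comp h1) ((continuous_chainMass F).comp h1)
      fun p ↦ (chainMass_pos p.1.2).ne')) (Continuous.mul (by fun_prop) continuous_const)
  refine ⟨⟨fun p ↦ ⟨pt (X := ordNerve P) (n := op ⦋k⦌) e (z p), mem _⟩,
    ((pt (X := ordNerve P) (n := op ⦋k⦌) e).continuous.comp hz).subtype_mk _⟩,
    ⟨pt (X := ordNerve P) (n := op ⦋k⦌) e (stdSimplex.vertex 0), mem _⟩, fun y ↦ ?_, fun y ↦ ?_⟩
  · change crd (pt (X := ordNerve P) (n := op ⦋k⦌) e (z (y, 0))) = _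
    rw [crd_pt]
    ext p
    by_cases hp : p ∈ F.1
    · obtain ⟨j, rfl⟩ := FinChain.mem_range.1 (hr.symm ▸ hp)
      rw [push_apply_of_injective he.injective, towards, if_pos hp]
      change (1 - ((0 : unitInterval) : ℝ)) * _ + ((0 : unitInterval) : ℝ) * _ = _
      simp
    · rw [push_eq_zero _ fun j hj ↦ (hF' hp j hj).elim, towards, if_neg hp]
      simp
  · refine Subtype.ext (congrArg (pt (X := ordNerve P) (n := op ⦋k⦌) e)
      (_root_.stdSimplex.ext (funext fun j ↦ ?_)))
    change (1 - ((1 : unitInterval) : ℝ)) * _ + ((1 : unitInterval) : ℝ) * (if j = 0 then 1 else 0)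
      = (Pi.single 0 1 : Fin (k + 1) → ℝ) j
    simp [Pi.single_apply]

lemma starNhd_htpy_const (F : FinChain P) : ∃ v : starNhd F,
    Htpy (𝟙 (TopCat.toSSet.obj (TopCat.of (starNhd F))))
      (TopCat.toSSet.map (TopCat.ofHom (ContinuousMap.const (starNhd F) v))) := by
  obtain ⟨h, hh⟩ := exists_starNhd_contraction F
  obtain ⟨h', v, h0, h1⟩ := exists_chain_contraction F
  let S : TopCat.{u} := TopCat.of (starNhd F)
  let g : S ⟶ S := TopCat.ofHom ⟨fun y ↦ h (y, 1), by fun_prop⟩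
  have a1 : Htpy (𝟙 (TopCat.toSSet.obj S)) (TopCat.toSSet.map g) := by
    refine ⟨singHomotopy (S := S) (T := S) h, ?_, inc_singHomotopy (S := S) (T := S) h 1 g fun y ↦ rfl⟩
    rw [← CategoryTheory.Functor.map_id]
    refine inc_singHomotopy (S := S) (T := S) h 0 (𝟙 _) fun y ↦ Subtype.ext (crd_injective ?_)
    refine (hh y 0).trans ?_
    ext p
    simp [towards]
  refine ⟨v, a1.trans ⟨singHomotopy (S := S) (T := S) h',
    inc_singHomotopy (S := S) (T := S) h' 0 g fun y ↦ Subtype.ext (crd_injective ?_),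
    inc_singHomotopy (S := S) (T := S) h' 1 _ fun y ↦ h1 y⟩⟩
  exact (h0 y).trans (hh y 1).symm

lemma exists_extension_of_starNhd (F : FinChain P) {A X : SSet.{u}} (i : A ⟶ X) [Mono i]
    (f : A ⟶ TopCat.toSSet.obj |ordNerve P|)
    (hf : ∀ n (a : A.obj n) w, ev (f.app n a) w ∈ starNhd F) :
    ∃ g : X ⟶ TopCat.toSSet.obj |ordNerve P|, i ≫ g = f ∧
      ∀ n (x : X.obj n) w, ev (g.app n x) w ∈ starNhd F := by
  obtain ⟨v, h⟩ := starNhd_htpy_const F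
  exact exists_extension_of_subset v h i f hf

end nerve

end SSet

/-! ### Small singular simplices against chains of stars: the unit is a Kan equivalence -/

namespace SSet
open HomotopicalAlgebra Opposite Limits
open scoped SSet.modelCategoryQuillen

lemma δ_mem_boundary {n : ℕ} (j : Fin (n + 2)) :
    (stdSimplex.objEquiv.symm (SimplexCategory.δ j) : (Δ[n + 1] : SSet.{u}) _⦋n⦌) ∈
      (boundary.{u} (n + 1)).obj (op ⦋n⦌) := fun h ↦ by
  obtain ⟨i, hi⟩ := h j
  exact Fin.succAbove_ne j i hi

variable {P : Type u} [PartialOrder P]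

lemma starNhd_mono {F F' : FinChain P} (h : F ≤ F') : starNhd F ⊆ starNhd F' :=
  fun _ hy _ hp ↦ h (hy hp)

/-- The set of star neighbourhoods. -/
def starCover (P : Type u) [PartialOrder P] : Set (Set |ordNerve P|) := Set.range starNhd

lemma isKanEquivalence_starCover :
    IsKanEquivalence (smallSing (T := |ordNerve P|) (starCover P) 0).ι := by
  refine isKanEquivalence_smallSing _ ?_ fun y ↦ ?_
  · rintro _ ⟨F, rfl⟩
    exact isOpen_starNhd F
  · obtain ⟨F, hF⟩ := exists_mem_starNhd y
    exact ⟨_, ⟨F, rfl⟩, hF⟩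

/-- Singular simplices small with respect to star neighbourhoods. -/
noncomputable abbrev StarSing (P : Type u) [PartialOrder P] : SSet.{u} :=
  (smallSing (T := |ordNerve P|) (starCover P) 0 : SSet.{u})

lemma exists_support (x : LabSimplex (StarSing P)) :
    ∃ F : FinChain P, ∀ p, p ∈ F.1 ↔ ∃ z, p ∈ argmax (ev x.val.1 z) := by
  obtain ⟨_, ⟨F, rfl⟩, hF⟩ := (mem_smallSing_zero (T := |ordNerve P|) (starCover P) x.val.1).1 x.val.2
  classical
  refine ⟨⟨F.1.filter fun p ↦ ∃ z, p ∈ argmax (ev x.val.1 z), ?_, ?_⟩, fun p ↦ ?_⟩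
  · let z : TopSimplex x.dim := stdSimplex.vertex 0
    obtain ⟨p, hp⟩ := exists_mem_argmax (ev x.val.1 z)
    exact ⟨p, Finset.mem_filter.2 ⟨hF _ hp, z, hp⟩⟩
  · exact F.2.2.mono fun p hp ↦ (Finset.mem_filter.1 hp).1
  · refine Finset.mem_filter.trans ⟨fun h ↦ h.2, fun ⟨z, h⟩ ↦ ⟨hF _ h, z, h⟩⟩

lemma ev_eq_of_isHom {x y : LabSimplex (StarSing P)} {β} (h : LabSimplex.IsHom x y β) (z) :
    ev x.val.1 z = ev y.val.1 (stdSimplex.map β.toOrderHom z) := by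
  rw [← h.val]
  rfl

/-- The vertices whose coordinate is largest at some point of a simplex. -/
noncomputable def support : LabSimplex (StarSing P) →o FinChain P where
  toFun x := (exists_support x).choose
  monotone' x y := by
    rintro ⟨β, h⟩ p hp
    obtain ⟨z, hz⟩ := ((exists_support x).choose_spec p).1 hp
    refine ((exists_support y).choose_spec p).2 ⟨stdSimplex.map β.toOrderHom z, ?_⟩
    rwa [← ev_eq_of_isHom h]

lemma mem_support {x : LabSimplex (StarSing P)} {p : P} :
    p ∈ (support x).1 ↔ ∃ z, p ∈ argmax (ev x.val.1 z) := (exists_support x).choose_spec p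

lemma mem_starNhd_support (x : LabSimplex (StarSing P)) (z) : ev x.val.1 z ∈ starNhd (support x) :=
  fun _ hp ↦ mem_support.2 ⟨z, hp⟩

/-- Pairs of a singular simplex and a chain of chains, the front faces of the simplex being in the
star neighbourhoods. -/
def frontPairs (P : Type u) [PartialOrder P] :
    (TopCat.toSSet.obj |ordNerve P| ⊗ ordNerve (FinChain P) : SSet.{u}).Subcomplex where
  obj n := {c | ∀ i (w : TopSimplex n.unop.len), (∀ j, i < j → w j = 0) →
    ev c.1 w ∈ starNhd (ordNerve.seq c.2 i)}
  map {n m} α c hc i w hw := by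
    refine hc (α.unop.toOrderHom i) (stdSimplex.map α.unop.toOrderHom w) fun j hj ↦ ?_
    rw [coe_map_eq_push]
    refine push_eq_zero _ fun k hk ↦ hw k ?_
    by_contra! hki
    exact (hk ▸ α.unop.toOrderHom.monotone hki).not_gt hj

lemma mem_starNhd_of_frontPairs {n : SimplexCategoryᵒᵖ} (c : (frontPairs P : SSet.{u}).obj n) (w) :
    ev c.1.1 w ∈ starNhd (ordNerve.seq c.1.2 (Fin.last _)) :=
  c.2 _ w fun j hj ↦ absurd (Fin.le_last j) hj.not_ge

lemma exists_lift_frontPairs {A : SSet.{u}} (f : A ⟶ TopCat.toSSet.obj |ordNerve P|)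
    (g : A ⟶ ordNerve (FinChain P)) (h : ∀ n (x : A.obj n), ((f.app n x, g.app n x) :
      (TopCat.toSSet.obj |ordNerve P| ⊗ ordNerve (FinChain P) : SSet.{u}).obj n) ∈
        (frontPairs P).obj n) :
    ∃ l : A ⟶ (frontPairs P : SSet.{u}), l ≫ (frontPairs P).ι ≫ fst _ _ = f ∧
      l ≫ (frontPairs P).ι ≫ snd _ _ = g := by
  obtain ⟨l, hl⟩ : ∃ l : A ⟶ (frontPairs P : SSet.{u}), l ≫ (frontPairs P).ι = lift f g :=
    ⟨Subcomplex.lift _ (by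
      rintro n _ ⟨c, rfl⟩
      exact h n c), Subcomplex.lift_ι _ _⟩
  exact ⟨l, by rw [reassoc_of% hl, lift_fst], by rw [reassoc_of% hl, lift_snd]⟩

lemma frontPairs_hom_ext {A : SSet.{u}} {f g : A ⟶ (frontPairs P : SSet.{u})}
    (h1 : f ≫ (frontPairs P).ι ≫ fst _ _ = g ≫ (frontPairs P).ι ≫ fst _ _)
    (h2 : f ≫ (frontPairs P).ι ≫ snd _ _ = g ≫ (frontPairs P).ι ≫ snd _ _) : f = g := by
  rw [← cancel_mono (frontPairs P).ι]
  refine CartesianMonoidalCategory.hom_ext _ _ ?_ ?_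
  · simpa only [Category.assoc] using h1
  · simpa only [Category.assoc] using h2

lemma exists_frontPairs_fst :
    ∃ π : (frontPairs P : SSet.{u}) ⟶ StarSing P,
      π ≫ (smallSing (T := |ordNerve P|) (starCover P) 0).ι = (frontPairs P).ι ≫ fst _ _ :=
  ⟨Subcomplex.lift _ (by
    rintro n _ ⟨c, rfl⟩
    exact (mem_smallSing_zero _ _).2 ⟨_, ⟨_, rfl⟩, mem_starNhd_of_frontPairs c⟩),
    Subcomplex.lift_ι _ _⟩

/-- On the front face up to `i`, the last vertex map factors through the simplex `c i`, which lies
in the star of its support. -/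
lemma last_mem_frontPairs {n : SimplexCategoryᵒᵖ}
    (c : Fin (n.unop.len + 1) →o LabSimplex (StarSing P)) (e : (ordNerve (FinChain P)).obj n)
    (h : ∀ i, support (c i) ≤ ordNerve.seq e i) :
    ((((labNerve.last (StarSing P)).app n c).1, e) :
      (TopCat.toSSet.obj |ordNerve P| ⊗ ordNerve (FinChain P) : SSet.{u}).obj n) ∈
        (frontPairs P).obj n := by
  intro i w hw
  refine starNhd_mono (h i) ?_
  -- The value beyond `i` is arbitrary: the point `w` has no mass there.
  let γ (j : Fin (n.unop.len + 1)) : Fin ((c i).dim + 1) :=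
    if hj : j ≤ i then (LabSimplex.hom (c.monotone hj)).toOrderHom (Fin.last _) else Fin.last _
  have hi := LabSimplex.isHom_hom (c.monotone (Fin.le_last i))
  have e1 : stdSimplex.map (labNerve.lastOp c).toOrderHom w =
      stdSimplex.map (LabSimplex.hom (c.monotone (Fin.le_last i))).toOrderHom
        (stdSimplex.map γ w) := by
    refine _root_.stdSimplex.ext ?_
    rw [coe_map_eq_push, coe_map_eq_push, coe_map_eq_push, ← push_comp]
    ext q
    refine Finset.sum_congr rfl fun j _ ↦ ?_
    by_cases hj : j ≤ i
    · have : (labNerve.lastOp c).toOrderHom j =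
          ((LabSimplex.hom (c.monotone (Fin.le_last i))).toOrderHom ∘ γ) j := by
        change (LabSimplex.hom (c.monotone (Fin.le_last j))).toOrderHom (Fin.last _) = _
        rw [← LabSimplex.hom_comp (c.monotone hj) (c.monotone (Fin.le_last i))]
        simp only [Function.comp_apply, γ, dif_pos hj]
        rfl
      rw [this]
    · rw [hw j (not_le.1 hj)]
      simp
  have e2 : ev ((labNerve.last (StarSing P)).app n c).1 w = ev (c i).val.1 (stdSimplex.map γ w) := by
    rw [ev_eq_of_isHom hi, ← e1]
    rfl
  change ev ((labNerve.last (StarSing P)).app n c).1 w ∈ _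
  rw [e2]
  exact mem_starNhd_support _ _

/-- The last chain of a labelled pair. -/
def lastChain : LabSimplex (frontPairs P : SSet.{u}) →o FinChain P where
  toFun x := ordNerve.seq x.val.1.2 (Fin.last _)
  monotone' x y := by
    rintro ⟨β, h⟩
    have e := congrArg (fun c : (frontPairs P : SSet.{u}) _⦋x.dim⦌ ↦
      ordNerve.seq c.1.2 (Fin.last _)) h.val
    exact e.symm.le.trans ((ordNerve.seq y.val.1.2).monotone (Fin.le_last _))

lemma last_comp_snd : labNerve.last (frontPairs P : SSet.{u}) ≫ (frontPairs P).ι ≫ snd _ _ =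
    ordNerve.map lastChain := by
  refine ordNerve.hom_app_ext fun n (c : Fin (n.unop.len + 1) →o LabSimplex (frontPairs P : SSet.{u}))
    i ↦ ?_
  have h := LabSimplex.isHom_hom (c.monotone (Fin.le_last i))
  change ordNerve.seq (c (Fin.last _)).val.1.2
    ((LabSimplex.hom (c.monotone (Fin.le_last i))).toOrderHom (Fin.last _)) =
      ordNerve.seq (c i).val.1.2 (Fin.last _)
  conv_rhs => rw [← h.val]
  rfl

/-- The last vertex map together with the support of each labelled simplex defines `ρ`, with `ρ ≫ π`
the last vertex map. In the other order, `labNerve.map π ≫ ρ` is homotopic to the last vertex map of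
`frontPairs`: the singular coordinate stays fixed and the chain grows from the support to the last
chain. Two out of six gives the claim. -/
lemma isKanEquivalence_of_frontPairs_fst (π : (frontPairs P : SSet.{u}) ⟶ StarSing P)
    (hπ : π ≫ (smallSing (T := |ordNerve P|) (starCover P) 0).ι = (frontPairs P).ι ≫ fst _ _) :
    IsKanEquivalence π := by
  obtain ⟨q, hq⟩ : ∃ q : labNerve.obj (StarSing P) ⟶ ordNerve (FinChain P),
    q = ordNerve.map support := ⟨_, rfl⟩
  obtain ⟨ρ, hρ, hρ'⟩ := exists_lift_frontPairs
    (labNerve.last (StarSing P) ≫ (smallSing (T := |ordNerve P|) (starCover P) 0).ι) q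
    (fun n x ↦ by
      rw [hq]
      exact last_mem_frontPairs x _ fun i ↦ le_rfl)
  have e1 : ρ ≫ π = labNerve.last (StarSing P) := by
    rw [← cancel_mono (smallSing (T := |ordNerve P|) (starCover P) 0).ι, Category.assoc, hπ, hρ]
  have hle (x : LabSimplex (frontPairs P : SSet.{u})) : support (LabSimplex.map π x) ≤ lastChain x := by
    intro p hp
    obtain ⟨z, hz⟩ := mem_support.1 hp
    have : (π.app (op ⦋x.dim⦌) x.val).1 = x.val.1.1 := by
      have h := ConcreteCategory.congr_hom (NatTrans.congr_app hπ (op ⦋x.dim⦌)) x.val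
      exact h
    refine mem_starNhd_of_frontPairs x.val z ?_
    rw [← this]
    exact hz
  obtain ⟨K, k0, k1, k⟩ : ∃ K : labNerve.obj (frontPairs P : SSet.{u}) ⊗ Δ[1] ⟶
      ordNerve (FinChain P), inc 0 ≫ K = labNerve.map π ≫ q ∧
        inc 1 ≫ K = labNerve.last _ ≫ (frontPairs P).ι ≫ snd _ _ ∧
        ∀ n (c : (labNerve.obj (frontPairs P : SSet.{u}) ⊗ Δ[1] : SSet.{u}).obj n) i,
          support (LabSimplex.map π (ordNerve.seq c.1 i)) ≤ ordNerve.seq (K.app n c) i := by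
    rw [last_comp_snd, hq]
    exact ordNerve.exists_homotopy_of_le
      (f := support.comp (LabSimplex.map π)) (g := lastChain (P := P)) hle
  have hfst : labNerve.last _ ≫ (frontPairs P).ι ≫ fst _ _ =
      labNerve.map π ≫ labNerve.last _ ≫ (smallSing (T := |ordNerve P|) (starCover P) 0).ι := by
    rw [reassoc_of% (labNerve.last_naturality π), hπ]
  obtain ⟨N, hN, hN'⟩ := exists_lift_frontPairs
    (fst (labNerve.obj (frontPairs P : SSet.{u})) Δ[1] ≫ labNerve.map π ≫ labNerve.last _ ≫
      (smallSing (T := |ordNerve P|) (starCover P) 0).ι) K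
    (fun n c ↦ last_mem_frontPairs ((LabSimplex.map π).comp
        (c.1 : Fin (n.unop.len + 1) →o LabSimplex (frontPairs P : SSet.{u})))
        (K.app n c) (fun i ↦ k n c i))
  have e2 : Htpy (labNerve.map π ≫ ρ) (labNerve.last (frontPairs P : SSet.{u})) := by
    refine ⟨N, frontPairs_hom_ext ?_ ?_, frontPairs_hom_ext ?_ ?_⟩
    · rw [Category.assoc, hN, inc_fst_assoc, Category.assoc, hρ]
    · rw [Category.assoc, hN', k0, Category.assoc, hρ']
    · rw [Category.assoc, hN, inc_fst_assoc, hfst]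
    · rw [Category.assoc, hN', k1]
  have h1 : IsKanEquivalence (ρ ≫ π) := e1 ▸ labNerve.isKanEquivalence_last _
  have h2 : IsKanEquivalence ρ :=
    IsKanEquivalence.two_of_six ((labNerve.isKanEquivalence_last _).of_htpy' e2) h1
  exact h2.of_comp_left h1

/-- All stars of a chain of chains lie in the last one, which is contractible, so the singular
coordinate extends over `Δ[n]` inside it. The conditions on proper front faces concern the boundary
and hold already. -/
lemma hasLiftingProperty_frontPairs_snd (n : ℕ) :
    HasLiftingProperty (boundary.{u} n).ι ((frontPairs P).ι ≫ snd _ _) := by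
  refine hasLiftingProperty_of_exists fun a b hab ↦ ?_
  let top : (Δ[n] : SSet.{u}) _⦋n⦌ := stdSimplex.objEquiv.symm (𝟙 _)
  have htop {m : SimplexCategoryᵒᵖ} (s : (Δ[n] : SSet.{u}).obj m) :
      (Δ[n] : SSet.{u}).map (stdSimplex.objEquiv s).op top = s :=
    vert_injective (OrderHom.ext _ _ rfl)
  let e : (ordNerve (FinChain P)) _⦋n⦌ := b.app _ top
  have hb {m : SimplexCategoryᵒᵖ} (s : (Δ[n] : SSet.{u}).obj m) (i) :
      ordNerve.seq (b.app m s) i = ordNerve.seq e (vert s i) := by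
    conv_lhs => rw [← htop s, NatTrans.naturality_apply]
    rfl
  have hab' {m : SimplexCategoryᵒᵖ} (s : (boundary.{u} n : SSet.{u}).obj m) (i) :
      ordNerve.seq (a.app m s).1.2 i = ordNerve.seq e (vert s.1 i) := by
    have h := ConcreteCategory.congr_hom (NatTrans.congr_app hab m) s
    exact (congrArg (fun x ↦ ordNerve.seq x i) h).trans (hb s.1 i)
  obtain ⟨σ, h1, h2⟩ := exists_extension_of_starNhd (ordNerve.seq e (Fin.last n)) (boundary.{u} n).ι
    (a ≫ (frontPairs P).ι ≫ fst _ _) fun m s w ↦ by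
      refine starNhd_mono ?_ (mem_starNhd_of_frontPairs (a.app m s) w)
      rw [hab']
      exact (ordNerve.seq e).monotone (Fin.le_last _)
  -- For `i` last this is containment in the largest star. Otherwise `w` lies on the face opposite
  -- to the last vertex, where the condition is inherited from `a`.
  have key : ∀ (i : Fin (n + 1)) (w : TopSimplex n), (∀ j, i < j → w j = 0) →
      ev (σ.app _ top) w ∈ starNhd (ordNerve.seq e i) := by
    intro i w hw
    rcases (Fin.le_last i).eq_or_lt with rfl | hi
    · exact h2 _ _ _
    obtain ⟨n, rfl⟩ : ∃ k, n = k + 1 := Nat.exists_eq_succ_of_ne_zero (by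
      rintro rfl
      exact hi.ne (Subsingleton.elim (α := Fin 1) _ _))
    obtain ⟨z, hz⟩ := exists_push_succAbove w (hw _ hi)
    let s : (boundary.{u} (n + 1) : SSet.{u}) _⦋n⦌ :=
      ⟨stdSimplex.objEquiv.symm (SimplexCategory.δ (Fin.last _)), δ_mem_boundary _⟩
    have e1 : ev (σ.app _ top) w = ev (a.app _ s).1.1 z := by
      have h := ConcreteCategory.congr_hom (NatTrans.congr_app h1 (op ⦋n⦌)) s
      refine Eq.trans ?_ (congrArg (fun x : (TopCat.toSSet.obj |ordNerve P|) _⦋n⦌ ↦ ev x z) h)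
      change _ = ev (σ.app (op ⦋n⦌) s.1) z
      rw [← htop s.1, NatTrans.naturality_apply, ev_map]
      refine congrArg _ (_root_.stdSimplex.ext ?_)
      rw [coe_map_eq_push, ← hz]
      rfl
    rw [e1]
    have h3 := (a.app _ s).2 (i.castPred hi.ne) z fun j hj ↦ by
      have h4 := congrFun hz j.castSucc
      rw [← Fin.succAbove_last, push_apply_of_injective Fin.succAbove_right_injective] at h4
      rw [h4, Fin.succAbove_last]
      exact hw _ (by simpa [Fin.lt_def] using hj)
    rw [hab'] at h3
    have e2 : vert s.1 (i.castPred hi.ne) = i := by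
      refine (congrFun (vert_δ.{u} (Fin.last (n + 1))) _).trans ?_
      simp
    rwa [e2] at h3
  obtain ⟨g, hg, hg'⟩ := exists_lift_frontPairs σ b fun m s ↦ by
    have h := (frontPairs P).map (stdSimplex.objEquiv s).op
      (show ((σ.app _ top, e) : (TopCat.toSSet.obj |ordNerve P| ⊗
        ordNerve (FinChain P) : SSet.{u}) _⦋n⦌) ∈ (frontPairs P).obj (op ⦋n⦌) from key)
    have e1 : (TopCat.toSSet.obj |ordNerve P|).map (stdSimplex.objEquiv s).op (σ.app _ top) =
      σ.app m s := by rw [← NatTrans.naturality_apply, htop]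
    have e2 : (ordNerve (FinChain P)).map (stdSimplex.objEquiv s).op e = b.app m s := by
      rw [← NatTrans.naturality_apply, htop]
    rw [← e1, ← e2]
    exact h
  exact ⟨g, frontPairs_hom_ext (by rw [Category.assoc, hg, h1]) (by rw [Category.assoc, hg', hab]), hg'⟩

lemma isKanEquivalence_frontPairs_snd : IsKanEquivalence ((frontPairs P).ι ≫ snd _ _) :=
  (isTrivialFib_of_boundary hasLiftingProperty_frontPairs_snd).isKanEquivalence

/-- At a point of the front face up to `i`, the largest coordinates are at maxima of chains with
index at most `i`. These maxima belong to the `i`-th chain. -/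
lemma exists_frontPairs_section : ∃ s : ordNerve (FinChain P) ⟶ (frontPairs P : SSet.{u}),
    s ≫ (frontPairs P).ι ≫ fst _ _ = ordNerve.map FinChain.max ≫ toSingTop (ordNerve P) ∧
    s ≫ (frontPairs P).ι ≫ snd _ _ = 𝟙 _ := by
  refine exists_lift_frontPairs _ _ fun n c i w hw p hp ↦ ?_
  have h := crd_pos_of_mem_argmax hp
  change 0 < crd (pt (X := ordNerve P) ((ordNerve.map FinChain.max).app n c) w) p at h
  rw [coord_pt] at h
  obtain ⟨j, rfl, hj⟩ := exists_of_push_ne_zero h.ne'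
  have hji : j ≤ i := by
    by_contra! hij
    exact hj (hw j hij)
  exact (ordNerve.seq c).monotone hji (FinChain.max_mem (ordNerve.seq c j))

/-- The composite of the section with the projection to small simplices and their inclusion is `max`
followed by the unit. The three maps and `max` are Kan equivalences, hence so is the unit. -/
theorem isKanEquivalence_toSingTop_ordNerve {d : P → ℕ} (hd : StrictMono d) :
    IsKanEquivalence (toSingTop (ordNerve P)) := by
  obtain ⟨s, hs, hs'⟩ := exists_frontPairs_section (P := P)
  obtain ⟨π, hπ⟩ := exists_frontPairs_fst (P := P)
  have h1 : IsKanEquivalence s := by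
    refine isKanEquivalence_frontPairs_snd.of_comp_right ?_
    rw [hs']
    exact IsKanEquivalence.id _
  have h2 := (h1.comp (isKanEquivalence_of_frontPairs_fst π hπ)).comp isKanEquivalence_starCover
  rw [Category.assoc, hπ, hs] at h2
  exact (FinChain.isKanEquivalence_map_max hd).of_comp_left h2

/-- The unit of the adjunction between realization and singular simplices is a weak equivalence. -/
theorem isKanEquivalence_toSingTop (X : SSet.{u}) : IsKanEquivalence (toSingTop X) := by
  -- The dimension serves as the strictly monotone function on the poset of labelled simplices.
  have h1 : IsKanEquivalence (toSingTop (labNerve.obj X)) :=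
    isKanEquivalence_toSingTop_ordNerve LabSimplex.dim_strictMono
  have h2 := h1.comp (IsKanEquivalence.map_sing (labNerve.isKanEquivalence_last X))
  have h3 : labNerve.last X ≫ toSingTop X =
      toSingTop _ ≫ TopCat.toSSet.map (toTop.map (labNerve.last X)) :=
    sSetTopAdj.unit.naturality _
  exact (labNerve.isKanEquivalence_last X).of_comp_left (h3 ▸ h2)

end SSet

/-! ### From the weak lifting property to lifting up to relative homotopy -/

namespace SSet
open HomotopicalAlgebra Opposite Limits
open scoped SSet.modelCategoryQuillen

section relative

variable {A B Z : SSet.{u}} (i : A ⟶ B) [Mono i] [KanComplex Z]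

lemma exists_square_relative (e : Fin 2) (K : B ⊗ Δ[1] ⟶ Z) (S : Fin 2 → (B ⊗ Δ[1] ⟶ Z))
    (Q : (A ⊗ Δ[1]) ⊗ Δ[1] ⟶ Z) (hSK : ∀ s, inc e ≫ S s = inc s ≫ K)
    (hQS : ∀ s, inc s ▷ _ ≫ Q = i ▷ _ ≫ S s) (hQK : inc e ≫ Q = i ▷ _ ≫ K) :
    ∃ H : (B ⊗ Δ[1]) ⊗ Δ[1] ⟶ Z, inc e ≫ H = K ∧ (∀ s, inc s ▷ _ ≫ H = S s) ∧
      (i ▷ _) ▷ _ ≫ H = Q := by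
  obtain ⟨H, h1, h2, h3, -⟩ := exists_lift_square i (terminal.from Z) e K S Q (terminal.from _)
    hSK hQS hQK (by simp) (by simp) (by simp)
  exact ⟨H, h1, h2, h3⟩

/-- Precomposition of a homotopy with one which is constant on a subobject. -/
lemma exists_homotopy_comp (H k : B ⊗ Δ[1] ⟶ Z) (h : inc 1 ≫ H = inc 0 ≫ k)
    (hH : i ▷ _ ≫ H = fst _ _ ≫ inc 0 ≫ i ▷ _ ≫ k) :
    ∃ L : B ⊗ Δ[1] ⟶ Z, inc 0 ≫ L = inc 0 ≫ H ∧ inc 1 ≫ L = inc 1 ≫ k ∧ i ▷ _ ≫ L = i ▷ _ ≫ k := by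
  obtain ⟨M, m1, m2, m3⟩ := exists_square_relative i 1 k
    (Fin.cons H fun _ ↦ fst _ _ ≫ inc 1 ≫ k) (fst _ _ ≫ i ▷ _ ≫ k)
    (Fin.forall_fin_two.2 ⟨h, inc_fst_assoc _ _ _⟩)
    (Fin.forall_fin_two.2 ⟨by
      change _ = i ▷ _ ≫ H
      rw [hH, whiskerRight_fst_assoc], by
      change _ = i ▷ _ ≫ fst _ _ ≫ inc 1 ≫ k
      rw [whiskerRight_fst_assoc, whiskerRight_fst_assoc, inc_comp_assoc]⟩)
    (inc_fst_assoc _ _ _)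
  refine ⟨inc 0 ≫ M, ?_, ?_, ?_⟩
  · rw [← inc_comp_assoc, m2]
    rfl
  · rw [← inc_comp_assoc, m2]
    exact inc_fst_assoc _ _ _
  · rw [← inc_comp_assoc, m3, inc_fst_assoc]

/-- Two homotopies from the same map, agreeing on a subobject. -/
lemma exists_homotopy_of_span (H L : B ⊗ Δ[1] ⟶ Z) (h : inc 0 ≫ H = inc 0 ≫ L)
    (hi : i ▷ _ ≫ H = i ▷ _ ≫ L) :
    ∃ K : B ⊗ Δ[1] ⟶ Z, inc 0 ≫ K = inc 1 ≫ H ∧ inc 1 ≫ K = inc 1 ≫ L ∧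
      i ▷ _ ≫ K = fst _ _ ≫ i ≫ inc 1 ≫ L := by
  obtain ⟨M, m1, m2, m3⟩ := exists_square_relative i 0 (fst _ _ ≫ inc 0 ≫ L)
    (Fin.cons H fun _ ↦ L) (fst _ _ ▷ _ ≫ i ▷ _ ≫ L)
    (Fin.forall_fin_two.2 ⟨h.trans (inc_fst_assoc _ _ _).symm, (inc_fst_assoc _ _ _).symm⟩)
    (Fin.forall_fin_two.2 ⟨by
      change _ = i ▷ _ ≫ H
      rw [hi, ← comp_whiskerRight_assoc, inc_fst, id_whiskerRight, Category.id_comp], by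
      change _ = i ▷ _ ≫ L
      rw [← comp_whiskerRight_assoc, inc_fst, id_whiskerRight, Category.id_comp]⟩)
    (by rw [inc_comp_assoc, inc_comp_assoc, whiskerRight_fst_assoc])
  refine ⟨inc 1 ≫ M, ?_, ?_, ?_⟩
  · rw [← inc_comp_assoc, m2]
    rfl
  · rw [← inc_comp_assoc, m2]
    rfl
  · rw [← inc_comp_assoc, m3, inc_comp_assoc, inc_comp_assoc]

end relative

/-- A weak lifting property gives a lifting property up to relative homotopy. -/
lemma exists_relative_lift {A B X Y X₁ Y₁ : SSet.{u}} {i : A ⟶ B} [Mono i] [KanComplex Y]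
    [KanComplex X₁] [KanComplex Y₁] {p : X ⟶ Y} {p₁ : X₁ ⟶ Y₁} {φ : X ⟶ X₁} {ψ : Y ⟶ Y₁}
    (hi : HasWeakLiftingProperty i p) (comm : p ≫ ψ = φ ≫ p₁) (hψ : IsKanEquivalence ψ)
    {a : A ⟶ X₁} {b : B ⟶ Y₁} (hab : a ≫ p₁ = i ≫ b) {f : A ⟶ X} (hf : Htpy (f ≫ φ) a) :
    ∃ (h : B ⟶ X₁) (K : B ⊗ Δ[1] ⟶ Y₁), i ≫ h = a ∧ inc 0 ≫ K = h ≫ p₁ ∧ inc 1 ≫ K = b ∧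
      i ▷ _ ≫ K = fst _ _ ≫ i ≫ b := by
  obtain ⟨G, g0, g1⟩ := hf
  -- The map `b` is deformed to a map that comes from `Y` and extends `f ≫ p`, with the deformation
  -- on `A` prescribed by `G`.
  obtain ⟨g, k, hg, hk, k0, k1⟩ := hψ.exists_extension i (f ≫ p) b (G ≫ p₁)
    (by rw [reassoc_of% g0, Category.assoc, comm]) (by rw [reassoc_of% g1, hab])
  obtain ⟨h₀, hp, F, f0, f1, fp⟩ := hi f g hg.symm
  -- Two homotopy extensions in `X₁` correct the values on `A`: `H₁` runs the fiberwise homotopy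
  -- back from `i ≫ h₀` to `f`, and `H₂` then follows `G` to `a`.
  obtain ⟨H₁, r1, s1⟩ := exists_extend_cylinder i 1 (F ≫ φ) (h₀ ≫ φ) (by
    rw [← ι₁_eq_inc, reassoc_of% f1])
  rw [ι₀_eq_inc] at f0
  have e1 : i ≫ inc 0 ≫ H₁ = f ≫ φ := by rw [← inc_comp_assoc, r1, reassoc_of% f0]
  obtain ⟨H₂, r2, s2⟩ := exists_extend_cylinder i 0 G (inc 0 ≫ H₁) (by rw [g0, e1])
  -- As `F` is fiberwise, `H₁ ≫ p₁` is constant on `A`. The composite `L` with `k` therefore agrees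
  -- with `H₂ ≫ p₁` on `A` and has the same start, so the other ends are homotopic relative to `A`.
  obtain ⟨L, l0, l1, l2⟩ := exists_homotopy_comp i (H₁ ≫ p₁) k
    (by rw [reassoc_of% s1, k0, ← hp, Category.assoc, comm]) (by
      rw [reassoc_of% r1, hk, reassoc_of% g0, ← comm, reassoc_of% fp])
  obtain ⟨K, K0, K1, K2⟩ := exists_homotopy_of_span i (H₂ ≫ p₁) L
    (by rw [reassoc_of% s2, l0]) (by rw [reassoc_of% r2, l2, hk])
  exact ⟨inc 1 ≫ H₂, K, by rw [← inc_comp_assoc, r2, g1], by rw [K0, Category.assoc],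
    by rw [K1, l1, k1], by rw [K2, l1, k1]⟩

end SSet

/-! ### Cubes and simplices are homeomorphic as pairs -/

namespace SSet

section homeomorph

variable {n : ℕ}

/-- The unit cube in euclidean space. -/
def solidCube (n : ℕ) : Set (Fin n → ℝ) := {v | ∀ i, 0 ≤ v i ∧ v i ≤ 1}

/-- The corner of the positive cone in euclidean space. -/
def solidSimplex (n : ℕ) : Set (Fin n → ℝ) := {v | (∀ i, 0 ≤ v i) ∧ ∑ i, v i ≤ 1}

lemma exists_add_mem_of_mem_interior {s : Set (Fin n → ℝ)} {v : Fin n → ℝ} (hv : v ∈ interior s) :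
    ∃ ε > 0, (fun i ↦ v i + ε) ∈ s ∧ (fun i ↦ v i - ε) ∈ s := by
  obtain ⟨ε, hε, h⟩ := Metric.mem_nhds_iff.1 (mem_interior_iff_mem_nhds.1 hv)
  refine ⟨ε / 2, by positivity, h ?_, h ?_⟩ <;>
  · rw [Metric.mem_ball, dist_pi_lt_iff hε]
    intro i
    rw [Real.dist_eq]
    simp only [add_sub_cancel_left, sub_sub_cancel_left, abs_neg]
    rw [abs_of_pos (by positivity)]
    linarith

lemma interior_solidCube : interior (solidCube n) = {v | ∀ i, 0 < v i ∧ v i < 1} := by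
  refine Set.Subset.antisymm (fun v hv i ↦ ?_) (interior_maximal (fun v hv i ↦
    ⟨(hv i).1.le, (hv i).2.le⟩) ?_)
  · obtain ⟨ε, hε, h1, h2⟩ := exists_add_mem_of_mem_interior hv
    have h1 := (h1 i).2
    have h2 := (h2 i).1
    constructor <;> linarith
  · simp only [Set.ofPred_forall, Set.ofPred_and]
    exact isOpen_iInter_of_finite fun i ↦ (isOpen_lt continuous_const (continuous_apply i)).inter
      (isOpen_lt (continuous_apply i) continuous_const)

lemma interior_solidSimplex :
    interior (solidSimplex n) = {v | (∀ i, 0 < v i) ∧ ∑ i, v i < 1} := by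
  refine Set.Subset.antisymm (fun v hv ↦ ?_) (interior_maximal (fun _ hv ↦
    ⟨fun i ↦ (hv.1 i).le, hv.2.le⟩) ?_)
  · obtain ⟨ε, hε, h1, h2⟩ := exists_add_mem_of_mem_interior hv
    refine ⟨fun i ↦ by linarith [h2.1 i], ?_⟩
    have h3 := h1.2
    rw [Finset.sum_add_distrib, Finset.sum_const, Finset.card_univ, Fintype.card_fin,
      nsmul_eq_mul] at h3
    rcases n with _ | n
    · simp
    · have : 0 < ((n + 1 : ℕ) : ℝ) * ε := by positivity
      linarith
  · simp only [Set.ofPred_forall, Set.ofPred_and]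
    exact (isOpen_iInter_of_finite fun i ↦ isOpen_lt continuous_const (continuous_apply i)).inter
      (isOpen_lt (by fun_prop) continuous_const)

lemma isClosed_solidCube : IsClosed (solidCube n) := by
  simp only [solidCube, Set.ofPred_forall, Set.ofPred_and]
  exact isClosed_iInter fun i ↦ (isClosed_le continuous_const (continuous_apply i)).inter
    (isClosed_le (continuous_apply i) continuous_const)

lemma isClosed_solidSimplex : IsClosed (solidSimplex n) := by
  simp only [solidSimplex, Set.ofPred_forall, Set.ofPred_and]
  exact (isClosed_iInter fun i ↦ isClosed_le continuous_const (continuous_apply i)).inter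
    (isClosed_le (by fun_prop) continuous_const)

lemma convex_solidCube : Convex ℝ (solidCube n) := by
  intro v hv w hw a b ha hb hab i
  have h1 := mul_nonneg ha (hv i).1
  have h2 := mul_nonneg hb (hw i).1
  have h3 := mul_le_mul_of_nonneg_left (hv i).2 ha
  have h4 := mul_le_mul_of_nonneg_left (hw i).2 hb
  constructor
  · change 0 ≤ a * v i + b * w i
    linarith
  · change a * v i + b * w i ≤ 1
    linarith

lemma convex_solidSimplex : Convex ℝ (solidSimplex n) := by
  intro v hv w hw a b ha hb hab
  refine ⟨fun i ↦ add_nonneg (mul_nonneg ha (hv.1 i)) (mul_nonneg hb (hw.1 i)), ?_⟩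
  change ∑ i, (a * v i + b * w i) ≤ 1
  rw [Finset.sum_add_distrib, ← Finset.mul_sum, ← Finset.mul_sum]
  have h3 := mul_le_mul_of_nonneg_left hv.2 ha
  have h4 := mul_le_mul_of_nonneg_left hw.2 hb
  linarith

lemma solidSimplex_subset : solidSimplex n ⊆ solidCube n := fun _ hv i ↦
  ⟨hv.1 i, (Finset.single_le_sum (fun j _ ↦ hv.1 j) (Finset.mem_univ i)).trans hv.2⟩

lemma isBounded_solidCube : Bornology.IsBounded (solidCube n) := by
  refine (Metric.isBounded_Icc (0 : Fin n → ℝ) 1).subset fun _ hv ↦ ⟨fun i ↦ (hv i).1, fun i ↦ (hv i).2⟩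

/-- Both sets are closed, bounded and convex with non-empty interior, so a homeomorphism of the
ambient space matches them and their interiors. -/
lemma exists_homeomorph_solid (n : ℕ) : ∃ e : (Fin n → ℝ) ≃ₜ (Fin n → ℝ),
    (∀ v, e v ∈ solidSimplex n ↔ v ∈ solidCube n) ∧
      ∀ v, e v ∈ interior (solidSimplex n) ↔ v ∈ interior (solidCube n) := by
  obtain ⟨e, h1, h2, -⟩ := exists_homeomorph_image_eq (convex_solidCube (n := n))
    (by
      rw [interior_solidCube]
      exact ⟨fun _ ↦ 1 / 2, fun i ↦ by norm_num⟩)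
    (NormedSpace.isVonNBounded_of_isBounded _ isBounded_solidCube) convex_solidSimplex (by
      rw [interior_solidSimplex]
      refine ⟨fun _ ↦ 1 / (n + 1), fun i ↦ by positivity, ?_⟩
      rw [Finset.sum_const, Finset.card_univ, Fintype.card_fin, nsmul_eq_mul, mul_one_div,
        div_lt_one (by positivity)]
      linarith)
    (NormedSpace.isVonNBounded_of_isBounded _ (isBounded_solidCube.subset solidSimplex_subset))
  rw [isClosed_solidCube.closure_eq, isClosed_solidSimplex.closure_eq] at h2
  exact ⟨e, fun v ↦ by rw [← h2, e.injective.mem_set_image],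
    fun v ↦ by rw [← h1, e.injective.mem_set_image]⟩

/-- The boundary of a topological simplex. -/
def simplexBoundary (n : ℕ) : Set (TopSimplex n) := {w | ∃ i, w i = 0}

/-- A cube and a simplex are homeomorphic as pairs. -/
lemma exists_homeomorph_cube_simplex (n : ℕ) : ∃ e : (Fin n → unitInterval) ≃ₜ TopSimplex n,
    ∀ y, e y ∈ simplexBoundary n ↔ y ∈ Cube.boundary (Fin n) := by
  obtain ⟨e, h1, h2⟩ := exists_homeomorph_solid n
  have hy (y : Fin n → unitInterval) : (fun i ↦ (y i : ℝ)) ∈ solidCube n := fun i ↦ (y i).2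
  let F (y : Fin n → unitInterval) : TopSimplex n :=
    ⟨Fin.cons (1 - ∑ i, e (fun i ↦ (y i : ℝ)) i) (e (fun i ↦ (y i : ℝ))), fun j ↦ by
      have := (h1 _).2 (hy y)
      induction j using Fin.cases with
      | zero => exact sub_nonneg.2 this.2
      | succ j => exact this.1 j, by
      rw [Fin.sum_univ_succ]
      simp⟩
  have hF : Continuous F := by
    have hc : Continuous fun y : Fin n → unitInterval ↦ e (fun i ↦ (y i : ℝ)) := by fun_prop
    refine Continuous.subtype_mk (continuous_pi fun j ↦ ?_) _
    induction j using Fin.cases with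
    | zero =>
      exact continuous_const.sub (continuous_finsetSum _ fun i _ ↦ (continuous_apply i).comp hc)
    | succ j => exact (continuous_apply j).comp hc
  have inj : Function.Injective F := fun y y' h ↦ by
    have h3 : e (fun i ↦ (y i : ℝ)) = e (fun i ↦ (y' i : ℝ)) :=
      funext fun j ↦ congrArg (fun w : TopSimplex n ↦ w j.succ) h
    exact funext fun i ↦ Subtype.ext (congrFun (e.injective h3) i)
  have surj : Function.Surjective F := fun w ↦ by
    have hs : w 0 + ∑ i : Fin n, w i.succ = 1 := by
      rw [← Fin.sum_univ_succ]
      exact w.2.2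
    have hw : (fun i : Fin n ↦ w i.succ) ∈ solidSimplex n := by
      refine ⟨fun i ↦ w.2.1 _, ?_⟩
      have : 0 ≤ w 0 := w.2.1 0
      linarith
    have h3 := (h1 (e.symm fun i : Fin n ↦ w i.succ)).1 (by rwa [e.apply_symm_apply])
    refine ⟨fun i ↦ ⟨_, h3 i⟩, _root_.stdSimplex.ext (funext fun j ↦ ?_)⟩
    have h4 : e (fun i ↦ e.symm (fun i : Fin n ↦ w i.succ) i) = fun i : Fin n ↦ w i.succ :=
      e.apply_symm_apply _
    induction j using Fin.cases with
    | zero =>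
      change 1 - ∑ i, e (fun i ↦ e.symm (fun i : Fin n ↦ w i.succ) i) i = w 0
      rw [h4]
      linarith
    | succ j => exact congrFun h4 j
  refine ⟨Continuous.homeoOfEquivCompactToT2 (f := Equiv.ofBijective F ⟨inj, surj⟩) hF, fun y ↦ ?_⟩
  change F y ∈ _ ↔ _
  have h3 := (h1 _).2 (hy y)
  have h4 : F y ∈ simplexBoundary n ↔ e (fun i ↦ (y i : ℝ)) ∉ interior (solidSimplex n) := by
    rw [interior_solidSimplex]
    change (∃ i, F y i = 0) ↔ ¬ ((∀ i, 0 < e (fun i ↦ (y i : ℝ)) i) ∧ ∑ i, e (fun i ↦ (y i : ℝ)) i < 1)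
    rw [Fin.exists_fin_succ, and_comm, not_and_or, not_forall, not_lt]
    refine or_congr ?_ (exists_congr fun i ↦ ?_)
    · change 1 - ∑ i, e (fun i ↦ (y i : ℝ)) i = 0 ↔ _
      have := h3.2
      exact ⟨fun h ↦ by linarith, fun h ↦ by linarith⟩
    · change e (fun i ↦ (y i : ℝ)) i = 0 ↔ _
      exact ⟨fun h ↦ by simp [h], fun h ↦ le_antisymm (not_lt.1 h) (h3.1 i)⟩
  rw [h4, h2, interior_solidCube]
  change ¬ (∀ i, 0 < (y i : ℝ) ∧ (y i : ℝ) < 1) ↔ ∃ i, y i = 0 ∨ y i = 1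
  rw [not_forall]
  refine exists_congr fun i ↦ ?_
  rw [not_and_or, not_lt, not_lt]
  refine or_congr ⟨fun h ↦ Subtype.ext (le_antisymm h (y i).2.1), fun h ↦ by simp [h]⟩
    ⟨fun h ↦ Subtype.ext (le_antisymm (y i).2.2 h), fun h ↦ by simp [h]⟩

end homeomorph

end SSet

/-! ### Relative lifts and weak homotopy equivalences of spaces -/

section relativeLift

variable {S T D D' : Type*} [TopologicalSpace S] [TopologicalSpace T] [TopologicalSpace D]
  [TopologicalSpace D']

/-- The lifting property up to relative homotopy. -/
def HasRelativeLift (B : Set D) (f : C(S, T)) : Prop :=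
  ∀ (a : C(B, S)) (b : C(D, T)), (∀ y, f (a y) = b y) →
    ∃ h : C(D, S), (∀ y : B, h y = a y) ∧ (f.comp h).HomotopicRel b B

lemma HasRelativeLift.of_homeomorph {B : Set D} {B' : Set D'} {f : C(S, T)}
    (h : HasRelativeLift B f) (e : D' ≃ₜ D) (he : ∀ y, e y ∈ B ↔ y ∈ B') : HasRelativeLift B' f := by
  intro a b hab
  have he' (y : B) : e.symm y ∈ B' := by
    rw [← he, e.apply_symm_apply]
    exact y.2
  obtain ⟨k, h1, ⟨H⟩⟩ := h (a.comp ⟨fun y ↦ ⟨e.symm y, he' y⟩, by fun_prop⟩)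
    (b.comp ⟨e.symm, e.symm.continuous⟩) fun y ↦ hab _
  refine ⟨k.comp ⟨e, e.continuous⟩, fun y ↦ ?_, ⟨⟨⟨H.toContinuousMap.comp
    ⟨fun p ↦ (p.1, e p.2), by fun_prop⟩, fun y ↦ ?_, fun y ↦ ?_⟩, fun t y hy ↦ ?_⟩⟩⟩
  · refine (h1 ⟨e y, (he _).2 y.2⟩).trans ?_
    simp
  · exact H.apply_zero (e y)
  · refine (H.apply_one (e y)).trans ?_
    simp
  · exact H.eq_fst t ((he y).2 hy)

/-- A homotopy between the images is a map of the `(n + 1)`-cube whose restriction to the boundary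
lifts through `g 0` and `g 1`. A lift of the whole cube with these boundary values is the desired
homotopy. -/
lemma HasRelativeLift.homotopicRel {n : ℕ} {f : C(S, T)}
    (h : HasRelativeLift (Cube.boundary (Fin (n + 1))) f) (g : Fin 2 → C(Fin n → unitInterval, S))
    (hg : ∀ y ∈ Cube.boundary (Fin n), g 0 y = g 1 y)
    (H : (f.comp (g 0)).HomotopicRel (f.comp (g 1)) (Cube.boundary (Fin n))) :
    (g 0).HomotopicRel (g 1) (Cube.boundary (Fin n)) := by
  obtain ⟨H⟩ := H
  have hb (y : Fin (n + 1) → unitInterval) (hy : y ∈ Cube.boundary (Fin (n + 1))) (h0 : y 0 ≠ 0)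
      (h1 : y 0 ≠ 1) : (fun i ↦ y (Fin.succ i)) ∈ Cube.boundary (Fin n) := by
    obtain ⟨i, hi⟩ := hy
    induction i using Fin.cases with
    | zero => exact (hi.elim h0 h1).elim
    | succ i => exact ⟨i, hi⟩
  -- Away from the two ends, a boundary point of the cube projects to the boundary of the `n`-cube,
  -- where `g 0` and `g 1` agree. Any threshold strictly between `0` and `1` would serve to glue
  -- them.
  let half : unitInterval := ⟨1 / 2, by norm_num, by norm_num⟩
  have half0 : half ≠ 0 := fun h ↦ by
    have := congrArg Subtype.val h
    norm_num [half] at this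
  have half1 : half ≠ 1 := fun h ↦ by
    have := congrArg Subtype.val h
    norm_num [half] at this
  have htail : Continuous fun (y : Cube.boundary (Fin (n + 1))) (i : Fin n) ↦ y.1 i.succ :=
    continuous_pi fun i ↦ (continuous_apply i.succ).comp continuous_subtype_val
  let a : C(Cube.boundary (Fin (n + 1)), S) :=
    ⟨fun y ↦ if y.1 0 ≤ half then g 0 (fun i ↦ y.1 i.succ) else g 1 (fun i ↦ y.1 i.succ),
      Continuous.if_le ((g 0).continuous.comp htail) ((g 1).continuous.comp htail)
        ((continuous_apply 0).comp continuous_subtype_val) continuous_const fun y hy ↦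
        hg _ (hb y.1 y.2 (hy ▸ half0) (hy ▸ half1))⟩
  let b : C(Fin (n + 1) → unitInterval, T) :=
    H.toContinuousMap.comp ⟨fun y ↦ (y 0, fun i ↦ y i.succ), by fun_prop⟩
  have ha0 (y : Cube.boundary (Fin (n + 1))) (hy : y.1 0 = 0) : a y = g 0 (fun i ↦ y.1 i.succ) :=
    if_pos (by rw [hy]; exact bot_le)
  have ha1 (y : Cube.boundary (Fin (n + 1))) (hy : y.1 0 = 1) : a y = g 1 (fun i ↦ y.1 i.succ) :=
    if_neg (by
      rw [hy, not_le]
      exact lt_of_le_of_ne le_top half1)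
  have ha2 (y : Cube.boundary (Fin (n + 1))) (hy : (fun i ↦ y.1 (Fin.succ i)) ∈ Cube.boundary (Fin n)) :
      a y = g 0 (fun i ↦ y.1 i.succ) := by
    change ite _ _ _ = _
    split_ifs
    · rfl
    · exact (hg _ hy).symm
  obtain ⟨k, hk, -⟩ := h a b fun y ↦ by
    change f (a y) = H (y.1 0, fun i ↦ y.1 i.succ)
    by_cases h0 : y.1 0 = 0
    · rw [ha0 y h0, h0]
      exact (H.apply_zero _).symm
    by_cases h1 : y.1 0 = 1
    · rw [ha1 y h1, h1]
      exact (H.apply_one _).symm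
    have hy := hb y.1 y.2 h0 h1
    rw [ha2 y hy]
    exact (H.eq_fst _ hy).symm
  have hc : Continuous fun p : unitInterval × (Fin n → unitInterval) ↦
      (Fin.cons p.1 p.2 : Fin (n + 1) → unitInterval) := by
    refine continuous_pi fun i ↦ ?_
    induction i using Fin.cases with
    | zero => exact continuous_fst
    | succ i => exact (continuous_apply i).comp continuous_snd
  refine ⟨⟨⟨k.comp ⟨_, hc⟩, fun y ↦ ?_, fun y ↦ ?_⟩, fun t y hy ↦ ?_⟩⟩
  · exact (hk ⟨Fin.cons 0 y, 0, Or.inl rfl⟩).trans (ha0 _ rfl)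
  · exact (hk ⟨Fin.cons 1 y, 0, Or.inr rfl⟩).trans (ha1 _ rfl)
  · obtain ⟨i, hi⟩ := id hy
    exact (hk ⟨Fin.cons t y, i.succ, hi⟩).trans (ha2 _ hy)

/-- A map with relative lifts for all cubes is a weak homotopy equivalence. -/
theorem isWeakHomotopyEquivalence_of_hasRelativeLift {f : C(S, T)}
    (h : ∀ n, HasRelativeLift (Cube.boundary (Fin n)) f) : IsWeakHomotopyEquivalence f := by
  have empty : IsEmpty (Cube.boundary (Fin 0)) := ⟨fun y ↦ y.2.choose.elim0⟩
  refine ⟨⟨?_, ?_⟩, fun n _ x ↦ ⟨?_, ?_⟩⟩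
  · intro x y
    induction x using Quotient.inductionOn with | _ x
    induction y using Quotient.inductionOn with | _ y
    intro hxy
    obtain ⟨γ⟩ : Joined (f x) (f y) := Quotient.exact hxy
    obtain ⟨H⟩ := (h 1).homotopicRel
      (Fin.cons (ContinuousMap.const _ x) fun _ ↦ ContinuousMap.const _ y)
      (fun y hy ↦ (empty.false ⟨y, hy⟩).elim) ⟨⟨⟨γ.toContinuousMap.comp ⟨Prod.fst, continuous_fst⟩,
        fun _ ↦ γ.source, fun _ ↦ γ.target⟩, fun t y hy ↦ (empty.false ⟨y, hy⟩).elim⟩⟩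
    exact Quotient.sound ⟨⟨H.toContinuousMap.comp ⟨fun t ↦ (t, fun i ↦ i.elim0), by fun_prop⟩,
      H.apply_zero _, H.apply_one _⟩⟩
  · intro y
    induction y using Quotient.inductionOn with | _ y
    obtain ⟨k, -, ⟨H⟩⟩ := h 0 ⟨fun y ↦ (empty.false y).elim, continuous_of_const fun y ↦
      (empty.false y).elim⟩ (ContinuousMap.const _ y) fun y ↦ (empty.false y).elim
    refine ⟨Quotient.mk _ (k fun i ↦ i.elim0), Quotient.sound ⟨⟨H.toContinuousMap.comp
      ⟨fun t ↦ (t, fun i ↦ i.elim0), by fun_prop⟩, ?_, ?_⟩⟩⟩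
    · exact H.apply_zero _
    · exact H.apply_one _
  · intro γ γ'
    induction γ using Quotient.inductionOn with | _ γ
    induction γ' using Quotient.inductionOn with | _ γ'
    intro hγ
    have hγ' : GenLoop.Homotopic (genLoopMap n f x γ) (genLoopMap n f x γ') := Quotient.exact hγ
    exact Quotient.sound ((h (n + 1)).homotopicRel (Fin.cons γ.1 fun _ ↦ γ'.1)
      (fun y hy ↦ (γ.2 y hy).trans (γ'.2 y hy).symm) hγ')
  · intro γ
    induction γ using Quotient.inductionOn with | _ γ
    obtain ⟨k, hk, hk'⟩ := h n (ContinuousMap.const _ x) γ.1 fun y ↦ (γ.2 y.1 y.2).symm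
    exact ⟨Quotient.mk _ ⟨k, fun y hy ↦ hk ⟨y, hy⟩⟩, Quotient.sound hk'⟩

/-- Weak homotopy equivalences are surjective on homotopy classes of maps of cubes which are
constant on the boundary. -/
lemma IsWeakHomotopyEquivalence.exists_homotopicRel {f : C(S, T)}
    (hf : IsWeakHomotopyEquivalence f) (n : ℕ) (x : S) (g : C(Fin n → unitInterval, T))
    (hg : ∀ y ∈ Cube.boundary (Fin n), g y = f x) :
    ∃ k : C(Fin n → unitInterval, S), (∀ y ∈ Cube.boundary (Fin n), k y = x) ∧
      (f.comp k).HomotopicRel g (Cube.boundary (Fin n)) := by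
  rcases n with _ | n
  · obtain ⟨z, hz⟩ := hf.1.2 (Quotient.mk _ (g fun i ↦ i.elim0))
    induction z using Quotient.inductionOn with | _ z
    obtain ⟨γ⟩ : Joined (f z) (g fun i ↦ i.elim0) := Quotient.exact hz
    refine ⟨ContinuousMap.const _ z, fun y hy ↦ hy.choose.elim0,
      ⟨⟨⟨γ.toContinuousMap.comp ⟨Prod.fst, continuous_fst⟩, fun y ↦ ?_, fun y ↦ ?_⟩,
        fun t y hy ↦ hy.choose.elim0⟩⟩⟩
    · exact γ.source
    · refine γ.target.trans (congrArg g (Subsingleton.elim _ _))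
  · obtain ⟨z, hz⟩ := (hf.2 (n + 1) (by omega) x).2 (Quotient.mk _ ⟨g, hg⟩)
    induction z using Quotient.inductionOn with | _ z
    exact ⟨z.1, z.2, (Quotient.exact hz : GenLoop.Homotopic _ _)⟩

end relativeLift

/-! ### Maps and homotopies of topological simplices in simplicial terms -/

namespace SSet
open HomotopicalAlgebra Opposite Limits
open scoped SSet.modelCategoryQuillen

section faces

variable {n : ℕ} {m : SimplexCategoryᵒᵖ}

lemma mem_boundary_iff {s : (Δ[n] : SSet.{u}).obj m} :
    s ∈ (boundary.{u} n).obj m ↔ ∃ j, ∀ l, vert s l ≠ j := by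
  change ¬ Function.Surjective (vert s) ↔ _
  simp [Function.Surjective]

lemma mem_horn_iff_vert {i : Fin (n + 1)} {s : (Δ[n] : SSet.{u}).obj m} :
    s ∈ (horn.{u} n i).obj m ↔ ∃ j, j ≠ i ∧ ∀ l, vert s l ≠ j := by
  change ¬ (Set.range (vert s) ∪ {i} = Set.univ) ↔ _
  simp only [Set.eq_univ_iff_forall, not_forall, Set.mem_union, Set.mem_range, not_or, not_exists,
    Set.mem_singleton_iff]
  exact exists_congr fun j ↦ and_comm

lemma horn_le_boundary (i : Fin (n + 1)) : horn.{u} n i ≤ boundary.{u} n := fun _ _ hs ↦ by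
  obtain ⟨j, -, h⟩ := mem_horn_iff_vert.1 hs
  exact mem_boundary_iff.2 ⟨j, h⟩

/-- The top simplex of a standard simplex. -/
def topSimplex (n : ℕ) : (Δ[n] : SSet.{u}) _⦋n⦌ := stdSimplex.objEquiv.symm (𝟙 _)

lemma map_topSimplex (s : (Δ[n] : SSet.{u}).obj m) :
    (Δ[n] : SSet.{u}).map (stdSimplex.objEquiv s).op (topSimplex n) = s :=
  vert_injective (OrderHom.ext _ _ rfl)

lemma map_vert_mem_simplexBoundary (s : (boundary.{u} n : SSet.{u}).obj m)
    (z : TopSimplex m.unop.len) : stdSimplex.map (vert s.1) z ∈ simplexBoundary n := by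
  obtain ⟨j, hj⟩ := mem_boundary_iff.1 s.2
  refine ⟨j, ?_⟩
  rw [coe_map_eq_push]
  exact push_eq_zero _ fun l hl ↦ (hj l hl).elim

lemma exists_of_mem_simplexBoundary {w : TopSimplex n} (hw : w ∈ simplexBoundary n) :
    ∃ (m : SimplexCategoryᵒᵖ) (s : (boundary.{u} n : SSet.{u}).obj m) (z : TopSimplex m.unop.len),
      stdSimplex.map (vert s.1) z = w := by
  obtain ⟨j, hj⟩ := hw
  rcases n with _ | n
  · obtain rfl : j = 0 := Subsingleton.elim (α := Fin 1) _ _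
    exact (zero_ne_one (hj.symm.trans ((Fin.sum_univ_one _).symm.trans w.2.2))).elim
  · obtain ⟨z, hz⟩ := exists_push_succAbove w hj
    refine ⟨op ⦋n⦌, ⟨_, δ_mem_boundary j⟩, z, _root_.stdSimplex.ext ?_⟩
    rw [coe_map_eq_push, ← hz, ← vert_δ.{u}]

end faces

section maps

variable {n : ℕ} {m : SimplexCategoryᵒᵖ} {T : TopCat.{u}}

/-- A map of a topological simplex as a map to the singular simplicial set. -/
noncomputable def simplexMap (g : C(TopSimplex n, T)) : Δ[n] ⟶ TopCat.toSSet.obj T :=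
  yonedaEquiv.symm (mkSing g)

lemma ev_simplexMap (g : C(TopSimplex n, T)) (s : (Δ[n] : SSet.{u}).obj m) (z) :
    ev ((simplexMap g).app m s) z = g (stdSimplex.map (vert s) z) := by
  change ev ((TopCat.toSSet.obj T).map (stdSimplex.objEquiv s).op (mkSing g)) z = _
  rw [ev_map, ev_mkSing]
  rfl

/-- A map to the singular simplicial set as a map of a topological simplex. -/
noncomputable def simplexEv (f : Δ[n] ⟶ TopCat.toSSet.obj T) : C(TopSimplex n, T) :=
  ev (f.app _ (topSimplex n))

lemma ev_app_eq_simplexEv (f : Δ[n] ⟶ TopCat.toSSet.obj T) (s : (Δ[n] : SSet.{u}).obj m) (z) :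
    ev (f.app m s) z = simplexEv f (stdSimplex.map (vert s) z) := by
  conv_lhs => rw [← map_topSimplex s, NatTrans.naturality_apply, ev_map]
  rfl

lemma simplexMap_simplexEv (f : Δ[n] ⟶ TopCat.toSSet.obj T) : simplexMap (simplexEv f) = f :=
  hom_sing_ext fun m s z ↦ by rw [ev_simplexMap, ev_app_eq_simplexEv]

/-- A map of the boundary of a topological simplex as a map to the singular simplicial set. -/
noncomputable def boundaryMap (a : C(simplexBoundary n, T)) :
    (boundary.{u} n : SSet.{u}) ⟶ TopCat.toSSet.obj T :=
  toSing (fun m s ↦ a.comp ⟨fun z ↦ ⟨_, map_vert_mem_simplexBoundary s z⟩,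
    (stdSimplex.continuous_map _).subtype_mk _⟩) fun {m m'} α s z ↦ congrArg a (Subtype.ext (by
      change stdSimplex.map (vert ((Δ[n] : SSet.{u}).map α s.1)) z =
        stdSimplex.map (vert s.1) (stdSimplex.map α.unop.toOrderHom z)
      refine _root_.stdSimplex.ext ?_
      rw [coe_map_eq_push, coe_map_eq_push, coe_map_eq_push, ← push_comp]
      rfl))

lemma ev_boundaryMap (a : C(simplexBoundary n, T)) (s : (boundary.{u} n : SSet.{u}).obj m) (z) :
    ev ((boundaryMap a).app m s) z = a ⟨_, map_vert_mem_simplexBoundary s z⟩ := by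
  rw [boundaryMap, ev_toSing]
  rfl

lemma pt_topSimplex (s : (boundary.{u} n : SSet.{u}).obj m) (z : TopSimplex m.unop.len) :
    pt (topSimplex.{u} n) (stdSimplex.map (vert s.1) z) =
      (toTop.map (boundary.{u} n).ι).hom (pt s z) := by
  rw [toTop_map_pt]
  change _ = pt s.1 z
  conv_rhs => rw [← map_topSimplex s.1, pt_map]
  rfl

/-- Relative lifts for singular simplicial sets give relative lifts for spaces. -/
lemma hasRelativeLift_simplexBoundary {S : TopCat.{u}} (f : S ⟶ T)
    (h : ∀ (a : (boundary.{u} n : SSet.{u}) ⟶ TopCat.toSSet.obj S) (b : Δ[n] ⟶ TopCat.toSSet.obj T),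
      a ≫ TopCat.toSSet.map f = (boundary.{u} n).ι ≫ b →
      ∃ (h : Δ[n] ⟶ TopCat.toSSet.obj S) (K : Δ[n] ⊗ Δ[1] ⟶ TopCat.toSSet.obj T),
        (boundary.{u} n).ι ≫ h = a ∧ inc 0 ≫ K = h ≫ TopCat.toSSet.map f ∧ inc 1 ≫ K = b ∧
        (boundary.{u} n).ι ▷ _ ≫ K = fst _ _ ≫ (boundary.{u} n).ι ≫ b) :
    HasRelativeLift (simplexBoundary n) f.hom := by
  intro a b hab
  obtain ⟨k, K, h1, h2, h3, h4⟩ := h (boundaryMap a) (simplexMap b) (hom_sing_ext fun m s z ↦ by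
    change ev ((TopCat.toSSet.map f).app m ((boundaryMap a).app m s)) z =
      ev ((simplexMap b).app m s.1) z
    rw [ev_app, ev_boundaryMap, ev_simplexMap]
    exact hab _)
  have hb (w : TopSimplex n) : ev ((simplexMap b).app _ (topSimplex n)) w = b w := by
    rw [ev_simplexMap]
    exact congrArg b (_root_.stdSimplex.ext ((coe_map_eq_push _ _).trans
      (funext fun i ↦ push_apply_of_injective (c := id) Function.injective_id w i)))
  refine ⟨simplexEv k, fun ⟨y, hy⟩ ↦ ?_, ⟨⟨⟨(realizeHomotopy K).comp
    ⟨fun p ↦ (pt (topSimplex n) p.2, p.1), ((pt (topSimplex n)).continuous.comp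
      continuous_snd).prodMk continuous_fst⟩, fun w ↦ ?_, fun w ↦ ?_⟩, fun t w hw ↦ ?_⟩⟩⟩
  · obtain ⟨m, s, z, rfl⟩ := exists_of_mem_simplexBoundary.{u} hy
    rw [← ev_boundaryMap, ← h1]
    exact (ev_app_eq_simplexEv k s.1 z).symm
  · refine (realizeHomotopy_end K _ 0).trans ?_
    rw [h2, realize_pt]
    rfl
  · refine (realizeHomotopy_end K _ 1).trans ?_
    rw [h3, realize_pt, hb]
  · obtain ⟨m, s, z, rfl⟩ := exists_of_mem_simplexBoundary.{u} hw
    change realizeHomotopy K (pt (topSimplex n) _, t) = f.hom (simplexEv k _)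
    rw [pt_topSimplex, ← realizeHomotopy_comp, h4, realizeHomotopy_const, realize_pt,
      ← ev_app_eq_simplexEv]
    change ev ((simplexMap b).app m s.1) z = f.hom (ev (((boundary.{u} n).ι ≫ k).app m s) z)
    rw [h1, ev_simplexMap, ev_boundaryMap]
    exact (hab ⟨_, map_vert_mem_simplexBoundary s z⟩).symm

/-- Relative homotopies of maps of simplices as simplicial homotopies. -/
lemma exists_homotopy_of_homotopicRel {g g' : C(TopSimplex n, T)}
    (h : g.HomotopicRel g' (simplexBoundary n)) :
    ∃ K : Δ[n] ⊗ Δ[1] ⟶ TopCat.toSSet.obj T, inc 0 ≫ K = simplexMap g ∧ inc 1 ≫ K = simplexMap g' ∧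
      (boundary.{u} n).ι ▷ _ ≫ K = fst _ _ ≫ (boundary.{u} n).ι ≫ simplexMap g := by
  obtain ⟨H⟩ := h
  let S : TopCat.{u} := TopCat.of (ULift.{u} (TopSimplex n))
  let up : C(TopSimplex n, S) := ⟨ULift.up, continuous_uliftUp⟩
  let L : C(S × unitInterval, T) := H.toContinuousMap.comp
    ⟨fun p ↦ (p.2, p.1.down), continuous_snd.prodMk (continuous_uliftDown.comp continuous_fst)⟩
  have hinc (e : Fin 2) (k : C(TopSimplex n, T)) (hk : ∀ w, H (intervalEnd e, w) = k w) :
      inc e ≫ simplexMap up ▷ _ ≫ singHomotopy L = simplexMap k := by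
    let k' : S ⟶ T := TopCat.ofHom (k.comp ⟨ULift.down, continuous_uliftDown⟩)
    rw [inc_comp_assoc, inc_singHomotopy L e k' fun x ↦ hk x.down]
    refine hom_sing_ext fun m s z ↦ ?_
    change ev ((TopCat.toSSet.map k').app m ((simplexMap up).app m s)) z = _
    rw [ev_app, ev_simplexMap, ev_simplexMap]
    rfl
  refine ⟨simplexMap up ▷ _ ≫ singHomotopy L, hinc 0 g H.apply_zero, hinc 1 g' H.apply_one,
    hom_sing_ext fun m s z ↦ ?_⟩
  change ev ((singHomotopy L).app m ((((simplexMap up).app m s.1.1, s.2)) :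
    (TopCat.toSSet.obj S ⊗ Δ[1] : SSet.{u}).obj m)) z = ev ((simplexMap g).app m s.1.1) z
  rw [ev_simplexMap]
  refine (congrArg (fun k : C(_, T) ↦ k z) (ev_toSing _ _ m _)).trans ?_
  change L (ev ((simplexMap up).app m s.1.1) z, _) = _
  rw [ev_simplexMap]
  exact H.eq_fst _ (map_vert_mem_simplexBoundary s.1 z)

end maps

end SSet

lemma IsWeakHomotopyEquivalence.exists_homotopicRel_simplexBoundary {S T : Type*}
    [TopologicalSpace S] [TopologicalSpace T] {f : C(S, T)} (hf : IsWeakHomotopyEquivalence f)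
    {n : ℕ} (x : S) (g : C(SSet.TopSimplex n, T)) (hg : ∀ w ∈ SSet.simplexBoundary n, g w = f x) :
    ∃ k : C(SSet.TopSimplex n, S), (∀ w ∈ SSet.simplexBoundary n, k w = x) ∧
      (f.comp k).HomotopicRel g (SSet.simplexBoundary n) := by
  obtain ⟨e, he⟩ := SSet.exists_homeomorph_cube_simplex n
  have he' {w} (hw : w ∈ SSet.simplexBoundary n) : e.symm w ∈ Cube.boundary (Fin n) := by
    rwa [← he, e.apply_symm_apply]
  obtain ⟨k, hk, ⟨H⟩⟩ := hf.exists_homotopicRel n x (g.comp ⟨e, e.continuous⟩)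
    fun y hy ↦ hg _ ((he y).2 hy)
  refine ⟨k.comp ⟨e.symm, e.symm.continuous⟩, fun w hw ↦ hk _ (he' hw), ⟨⟨⟨H.toContinuousMap.comp
    ⟨fun p ↦ (p.1, e.symm p.2), by fun_prop⟩, fun w ↦ H.apply_zero _, fun w ↦ ?_⟩,
      fun t w hw ↦ H.eq_fst t (he' hw)⟩⟩⟩
  exact (H.apply_one _).trans (congrArg g (e.apply_symm_apply w))

/-! ### Lifting maps of boundaries up to homotopy along weak homotopy equivalences -/

namespace SSet
open HomotopicalAlgebra Opposite Limits
open scoped SSet.modelCategoryQuillen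

/-- A constant map to a singular simplicial set. -/
noncomputable def constSing {T : TopCat.{u}} (X : SSet.{u}) (x : T) : X ⟶ TopCat.toSSet.obj T :=
  toSing (fun _ _ ↦ ContinuousMap.const _ x) fun _ _ _ ↦ rfl

lemma ev_constSing {T : TopCat.{u}} {X : SSet.{u}} (x : T) {n : SimplexCategoryᵒᵖ} (s : X.obj n) (z) :
    ev ((constSing X x).app n s) z = x :=
  congrArg (fun g : C(_, T) ↦ g z) (ev_toSing (fun _ _ ↦ ContinuousMap.const _ x) _ n s)

lemma comp_constSing {T : TopCat.{u}} {X Y : SSet.{u}} (x : T) (f : X ⟶ Y) :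
    f ≫ constSing Y x = constSing X x :=
  hom_sing_ext fun n s z ↦ (ev_constSing x (f.app n s) z).trans (ev_constSing x s z).symm

lemma constSing_comp_map {S T : TopCat.{u}} {X : SSet.{u}} (x : S) (f : S ⟶ T) :
    constSing X x ≫ TopCat.toSSet.map f = constSing X (f.hom x) := by
  refine hom_sing_ext fun n s z ↦ ?_
  change ev ((TopCat.toSSet.map f).app n ((constSing X x).app n s)) z = _
  rw [ev_app, ev_constSing, ev_constSing]

lemma simplexMap_comp_map {n : ℕ} {S T : TopCat.{u}} (g : C(TopSimplex n, S)) (f : S ⟶ T) :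
    simplexMap g ≫ TopCat.toSSet.map f = simplexMap (f.hom.comp g) := by
  refine hom_sing_ext fun m s z ↦ ?_
  change ev ((TopCat.toSSet.map f).app m ((simplexMap g).app m s)) z = _
  rw [ev_app, ev_simplexMap, ev_simplexMap]
  rfl

lemma exists_htpy_constSing {T : TopCat.{u}} (c : (Δ[0] : SSet.{u}) ⟶ TopCat.toSSet.obj T) :
    ∃ y : T, ∀ x, Joined x y → Htpy (constSing _ x) c := by
  refine ⟨simplexEv c (stdSimplex.vertex 0), fun x ⟨γ⟩ ↦ ?_⟩
  obtain ⟨K, h0, h1, -⟩ := exists_homotopy_of_homotopicRel (g := ContinuousMap.const _ x)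
    (g' := simplexEv c) ⟨⟨⟨γ.toContinuousMap.comp ⟨Prod.fst, continuous_fst⟩, fun _ ↦ γ.source,
      fun w ↦ γ.target.trans (congrArg _ (Subsingleton.elim _ _))⟩, fun t w ⟨i, hi⟩ ↦ by
        obtain rfl : i = 0 := Subsingleton.elim (α := Fin 1) _ _
        exact (zero_ne_one (hi.symm.trans ((Fin.sum_univ_one _).symm.trans w.2.2))).elim⟩⟩
  refine ⟨K, h0.trans (hom_sing_ext fun m s z ↦ ?_), h1.trans (simplexMap_simplexEv c)⟩
  rw [ev_simplexMap, ev_constSing]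
  rfl

/-- A map from the union of a weakly contractible piece and a simplex glued along its boundary
lifts, up to homotopy, along a weak homotopy equivalence. -/
lemma exists_lift_up_to_htpy {S T : TopCat.{u}} {f : S ⟶ T} (hf : IsWeakHomotopyEquivalence f.hom)
    {A Λ : SSet.{u}} {k : ℕ} (j : Λ ⟶ A) [Mono j] (d : Δ[k] ⟶ A) [Mono d]
    (hcov : ∀ n (x : A.obj n), (∃ l, j.app n l = x) ∨ ∃ s, d.app n s = x)
    (hj : ∀ n s, (∃ l, j.app n l = d.app n s) ↔ s ∈ (boundary.{u} k).obj n)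
    (hΛ : ∀ t : Λ ⟶ Δ[0], IsKanEquivalence t) (a : A ⟶ TopCat.toSSet.obj T) :
    ∃ b : A ⟶ TopCat.toSSet.obj S, Htpy (b ≫ TopCat.toSSet.map f) a := by
  let t : Λ ⟶ Δ[0] := stdSimplex.isTerminalObj₀.from Λ
  -- On the contractible piece `a` is homotopic to a constant, whose value can be moved to some `f
  -- x` by surjectivity on path components. Homotopy extension then replaces `a` by `a'`, which is
  -- constant on this piece.
  obtain ⟨c, hc⟩ := ((isKanEquivalence_iff t).1 (hΛ t) _).2 (j ≫ a)
  obtain ⟨y, hy⟩ := exists_htpy_constSing c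
  obtain ⟨x, hx⟩ : ∃ x, Joined (f.hom x) y := by
    obtain ⟨x, hx⟩ := hf.1.2 (Quotient.mk _ y)
    induction x using Quotient.inductionOn with | _ x
    exact ⟨x, Quotient.exact hx⟩
  have h1 : Htpy (j ≫ a) (constSing Λ (f.hom x)) := by
    have h := (hy _ hx).comp_left t
    rw [comp_constSing] at h
    exact (h.trans hc).symm
  obtain ⟨G, g0, g1⟩ := h1
  obtain ⟨H, hH, hH0⟩ := exists_extend_cylinder j 0 G a g0
  obtain ⟨a', ha'⟩ : ∃ a', inc 1 ≫ H = a' := ⟨_, rfl⟩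
  have ja : j ≫ a' = constSing Λ (f.hom x) := by rw [← ha', ← inc_comp_assoc, hH, g1]
  -- The remaining cell now has constant boundary, so surjectivity on homotopy groups, or on path
  -- components if `k = 0`, lifts it.
  obtain ⟨k', hk', hK⟩ := hf.exists_homotopicRel_simplexBoundary x (simplexEv (d ≫ a')) (by
    intro w hw
    obtain ⟨m, s, z, rfl⟩ := exists_of_mem_simplexBoundary.{u} hw
    obtain ⟨l, hl⟩ := (hj m s.1).2 s.2
    rw [← ev_app_eq_simplexEv]
    change ev (a'.app m (d.app m s.1)) z = _
    rw [← hl]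
    change ev ((j ≫ a').app m l) z = _
    rw [ja, ev_constSing])
  obtain ⟨K, K0, K1, K2⟩ := exists_homotopy_of_homotopicRel hK
  rw [simplexMap_simplexEv] at K1
  obtain ⟨b, b1, b2⟩ := exists_desc_of_cover j d (constSing Λ x) (simplexMap k') hcov
    (fun n _ _ h ↦ congrArg _ (app_injective_of_mono j n h)) (fun n l s h ↦ ev_ext fun z ↦ by
      rw [ev_constSing, ev_simplexMap]
      exact (hk' _ (map_vert_mem_simplexBoundary ⟨s, (hj n s).1 ⟨l, h⟩⟩ z)).symm)
    (fun n _ _ h ↦ congrArg _ (app_injective_of_mono d n h))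
  obtain ⟨M, m1, m2⟩ := exists_desc_of_cover (j ▷ Δ[1]) (d ▷ Δ[1]) (constSing _ (f.hom x)) K
    (fun n c ↦ (hcov n c.1).imp (fun ⟨l, h⟩ ↦ ⟨(l, c.2), Prod.ext h rfl⟩)
      fun ⟨s, h⟩ ↦ ⟨(s, c.2), Prod.ext h rfl⟩)
    (fun n _ _ h ↦ congrArg _ (Prod.ext (app_injective_of_mono j n (congrArg Prod.fst h))
      (congrArg Prod.snd h :))) (fun n l s h ↦ ev_ext fun z ↦ by
      have hs : s.1 ∈ (boundary.{u} k).obj n := (hj n s.1).1 ⟨l.1, congrArg Prod.fst h⟩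
      have h3 := ConcreteCategory.congr_hom (NatTrans.congr_app K2 n)
        (((⟨s.1, hs⟩, s.2)) : ((boundary.{u} k : SSet.{u}) ⊗ Δ[1] : SSet.{u}).obj n)
      refine (ev_constSing _ _ _).trans (Eq.trans ?_
        (congrArg (fun y : (TopCat.toSSet.obj T).obj n ↦ ev y z) h3.symm))
      change _ = ev ((simplexMap (f.hom.comp k')).app n s.1) z
      rw [ev_simplexMap]
      exact congrArg f.hom (hk' _ (map_vert_mem_simplexBoundary ⟨s.1, hs⟩ z)).symm)
    (fun n _ _ h ↦ congrArg _ (Prod.ext (app_injective_of_mono d n (congrArg Prod.fst h))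
      (congrArg Prod.snd h :)))
  refine ⟨b, Htpy.trans ⟨M, ?_, ?_⟩ (Htpy.symm ⟨H, hH0, ha'⟩)⟩
  · refine hom_eq_of_cover j d hcov ?_ ?_
    · rw [← inc_comp_assoc, m1, reassoc_of% b1, comp_constSing, constSing_comp_map]
    · rw [← inc_comp_assoc, m2, reassoc_of% b2, K0, simplexMap_comp_map]
  · refine hom_eq_of_cover j d hcov ?_ ?_
    · rw [← inc_comp_assoc, m1, ja, comp_constSing]
    · rw [← inc_comp_assoc, m2, K1]

section boundary

variable {n : ℕ}

lemma horn_isKanEquivalence_toPoint (i : Fin (n + 2)) (t : (horn.{u} (n + 1) i : SSet.{u}) ⟶ Δ[0]) :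
    IsKanEquivalence t := by
  have h1 : IsKanEquivalence (horn.{u} (n + 1) i).ι :=
    (IsKanAnodyne.of_anodyneExtensions (anodyneExtensions.horn_ι i)).isKanEquivalence
  have h2 := h1.comp (stdSimplex.isKanEquivalence_toPoint (n + 1)
    (stdSimplex.isTerminalObj₀.from _))
  rwa [stdSimplex.isTerminalObj₀.hom_ext (_ ≫ _) t] at h2

lemma vert_map_δ (i : Fin (n + 2)) {m : SimplexCategoryᵒᵖ} (s : (Δ[n] : SSet.{u}).obj m) (l) :
    vert ((SSet.stdSimplex.{u}.map (SimplexCategory.δ i)).app m s) l = i.succAbove (vert s l) := rfl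

lemma exists_face_eq {i : Fin (n + 2)} {m : SimplexCategoryᵒᵖ} {s : (Δ[n + 1] : SSet.{u}).obj m}
    (h : ∀ l, vert s l ≠ i) :
    ∃ s' : (Δ[n] : SSet.{u}).obj m, (SSet.stdSimplex.{u}.map (SimplexCategory.δ i)).app m s' = s := by
  choose v hv using fun l ↦ Fin.exists_succAbove_eq (h l)
  refine ⟨stdSimplex.objEquiv.symm (SimplexCategory.Hom.mk ⟨v, fun l l' hl ↦ ?_⟩),
    vert_injective (OrderHom.ext _ _ (funext hv))⟩
  rw [← (Fin.strictMono_succAbove i).le_iff_le, hv, hv]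
  exact (vert s).monotone hl

/-- Maps from the boundary of a simplex lift, up to homotopy, along a weak homotopy equivalence. -/
lemma exists_boundary_lift_up_to_htpy {S T : TopCat.{u}} {f : S ⟶ T}
    (hf : IsWeakHomotopyEquivalence f.hom) (n : ℕ)
    (a : (boundary.{u} n : SSet.{u}) ⟶ TopCat.toSSet.obj T) :
    ∃ b : (boundary.{u} n : SSet.{u}) ⟶ TopCat.toSSet.obj S, Htpy (b ≫ TopCat.toSSet.map f) a := by
  rcases n with _ | n
  · have h {m} (s : (boundary.{u} 0 : SSet.{u}).obj m) : False := by
      obtain ⟨j, hj⟩ := mem_boundary_iff.1 s.2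
      exact hj 0 (Subsingleton.elim (α := Fin 1) _ _)
    refine ⟨toSing (fun _ s ↦ (h s).elim) fun _ s ↦ (h s).elim, ?_⟩
    rw [hom_sing_ext (f := _ ≫ _) (g := a) fun _ s ↦ (h s).elim]
    exact Htpy.refl _
  -- The boundary is the union of the horn at `0` and the face opposite to `0`, which meet in the
  -- boundary of that face.
  · let j : (horn.{u} (n + 1) 0 : SSet.{u}) ⟶ (boundary.{u} (n + 1) : SSet.{u}) :=
      Subcomplex.homOfLE (horn_le_boundary 0)
    obtain ⟨d, hd⟩ : ∃ d : Δ[n] ⟶ (boundary.{u} (n + 1) : SSet.{u}),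
        d ≫ (boundary.{u} (n + 1)).ι = SSet.stdSimplex.{u}.map (SimplexCategory.δ 0) :=
      ⟨Subcomplex.lift _ (by
        rintro m _ ⟨s, rfl⟩
        exact mem_boundary_iff.2 ⟨0, fun l ↦ Fin.succAbove_ne 0 (vert s l)⟩), Subcomplex.lift_ι _ _⟩
    have hd' {m} (s : (Δ[n] : SSet.{u}).obj m) :
        (d.app m s).1 = (SSet.stdSimplex.{u}.map (SimplexCategory.δ 0)).app m s := by
      have h := ConcreteCategory.congr_hom (NatTrans.congr_app hd m) s
      exact h
    have : Mono d := mono_of_app_injective _ fun m s s' h ↦ by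
      have h1 := congrArg (fun x : (boundary.{u} (n + 1) : SSet.{u}).obj m ↦ vert x.1) h
      simp only [hd'] at h1
      refine vert_injective (OrderHom.ext _ _ (funext fun l ↦ ?_))
      have h2 := DFunLike.congr_fun h1 l
      rw [vert_map_δ, vert_map_δ] at h2
      exact Fin.succAbove_right_injective h2
    refine exists_lift_up_to_htpy hf j d (fun m x ↦ ?_) (fun m s ↦ ⟨?_, fun hs ↦ ?_⟩)
      (horn_isKanEquivalence_toPoint 0) a
    · obtain ⟨i, hi⟩ := mem_boundary_iff.1 x.2
      by_cases h : i = 0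
      · subst h
        obtain ⟨s, hs⟩ := exists_face_eq hi
        exact Or.inr ⟨s, Subtype.ext ((hd' s).trans hs)⟩
      · exact Or.inl ⟨⟨x.1, mem_horn_iff_vert.2 ⟨i, h, hi⟩⟩, rfl⟩
    · rintro ⟨l, hl⟩
      obtain ⟨i, h0, hi⟩ := mem_horn_iff_vert.1 l.2
      obtain ⟨i, rfl⟩ := Fin.exists_succAbove_eq h0
      refine mem_boundary_iff.2 ⟨i, fun r hr ↦ hi r ?_⟩
      have h1 : l.1 = _ := (congrArg Subtype.val hl).trans (hd' s)
      rw [h1, vert_map_δ, hr]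
    · obtain ⟨i, hi⟩ := mem_boundary_iff.1 hs
      refine ⟨⟨(d.app m s).1, mem_horn_iff_vert.2 ⟨Fin.succAbove 0 i, Fin.succAbove_ne _ _,
        fun r hr ↦ hi r ?_⟩⟩, rfl⟩
      rw [hd', vert_map_δ] at hr
      exact Fin.succAbove_right_injective hr

end boundary

end SSet
-- The lemma
theorem lemmaL {X Y : SSet.{u}} (p : X ⟶ Y)
    (hp : SSet.IsTrivialWeakKanFibration p)
    (hY : SSet.KanComplex Y)
    (hX : ∃ (X' : SSet.{u}) (q : X' ⟶ X), SSet.KanComplex X' ∧ SSet.IsWeakEquivalence q) :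
    SSet.IsWeakEquivalence p := by
  obtain ⟨X', q, hX', hq⟩ := hX
  refine isWeakHomotopyEquivalence_of_hasRelativeLift fun n ↦ ?_
  obtain ⟨e, he⟩ := SSet.exists_homeomorph_cube_simplex n
  refine HasRelativeLift.of_homeomorph (SSet.hasRelativeLift_simplexBoundary (SSet.toTop.map p)
    fun a b hab ↦ ?_) e he
  obtain ⟨c, hc⟩ := SSet.exists_boundary_lift_up_to_htpy hq n a
  -- As `X'` is Kan, its unit has a homotopy inverse. Composing the lift `c` with it and with `q`
  -- gives a map into `X` itself whose image is homotopic to `a`.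
  obtain ⟨g, -, hg⟩ := (SSet.isKanEquivalence_toSingTop X').exists_inverse
  have h := (hg.comp_left c).comp_right (TopCat.toSSet.map (SSet.toTop.map q))
  have e1 : q ≫ SSet.toSingTop X = SSet.toSingTop X' ≫ TopCat.toSSet.map (SSet.toTop.map q) :=
    sSetTopAdj.unit.naturality q
  rw [Category.comp_id] at h
  have hf : SSet.Htpy ((c ≫ g ≫ q) ≫ SSet.toSingTop X) a := by
    refine SSet.Htpy.trans ?_ hc
    simpa only [Category.assoc, e1] using h
  exact SSet.exists_relative_lift (X₁ := TopCat.toSSet.obj (SSet.toTop.obj X))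
    (Y₁ := TopCat.toSSet.obj (SSet.toTop.obj Y)) (hp.2 n) (sSetTopAdj.unit.naturality p)
    (SSet.isKanEquivalence_toSingTop Y) hab hf
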